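/- **Setting.** Let $g_1,g_2:\mathbb C^2\to\mathbb C$ be entire functions with the real property: $g_j$ is real on $\mathbb R^2$ and $\nabla g_j\neq 0$ on the real trace $\sigma_j'=\{\xi\in\mathbb R^2: g_j(\xi)=0\}$. Let $\xi^\star\in\sigma_1'\cap\sigma_2'$, $(a_j,b_j)=\nabla g_j(\xi^\star)$, $n_j=(a_j,b_j)/\sqrt{a_j^2+b_j^2}$, and assume the crossing is transverse, numbered so that $\Delta^\star=a_1b_2-a_2b_1>0$. An admissible surface near $\xi^\star$ is $\{\xi+i\eta(\xi)\}$, with $\xi$ in a real neighbourhood of $\xi^\star$ and $\eta$ a continuous real vector field, such that $g_j(\xi+i\varepsilon\eta(\xi))\ne0$ for $0<\varepsilon\le1$, $j=1,2$, and $\nabla g_j\cdot\eta\neq0$ on $\sigma_j'$. Fix such a surface $\Gamma$ and let $s_j=\operatorname{sign}(\eta(\xi^\star)\cdot n_j)\in\{1,-1\}$ (its bridge configuration). The point $\xi^\star$ is *inactive* in the direction $\tilde x$ if near $\xi^\star$ the surface $\Gamma$ can be deformed continuously through admissible surfaces to one with field $\eta'$ satisfying $\tilde x\cdot\eta'(\xi^\star)<0$,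 and *active* otherwise. The *active quadrant* is the open cone $\{c_1s_1n_1+c_2s_2n_2: c_1,c_2>0\}$. Let $A,\mu_1,\mu_2\in\mathbb C$ and let $F$ be holomorphic at all points near $\xi^\star$ of $\{\xi: g_j(\xi)\notin -is_j[0,\infty),\ j=1,2\}$, with $F(\xi)\,/\,\big(g_1(\xi)^{-\mu_1}g_2(\xi)^{-\mu_2}\big)\to A$ as $\xi\to\xi^\star$ in this set. Here $z^{-\mu_j}$ is the branch on $\mathbb C\setminus(-is_j[0,\infty))$ that is principal for $s_j\operatorname{Im}z>0$. For $a\in\mathbb R\setminus\{0\}$, $s=\pm1$, let $\mathcal J(\mu,a;s)=\int_{-\infty+is\varepsilon}^{\infty+is\varepsilon}z^{-\mu}e^{-isaz}\,dz$ for $\operatorname{Re}\mu>0$ (improper integral, principal branch, any $\varepsilon>0$), continued analytically to all $\mu\in\mathbb C$. For $\tilde x\in\mathbb R^2$, $|\tilde x|=1$, put $x_1'=(\tilde x_1b_2-\tilde x_2a_2)/\Delta^\star$, $x_2'=(-\tilde x_1b_1+\tilde x_2a_1)/\Delta^\star$ and assume $x_1',x_2'\ne0$ ($\tilde x$ is not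 orthogonal to $\sigma'_1$ or $\sigma_2'$ at $\xi^\star$). Let $\varphi$ be the holomorphic local inverse of $\psi=(g_1,g_2)$ with $\varphi(0)=\xi^\star$. For a real vector field $h$ on the square $|t_1|,|t_2|<\rho$ let $\Gamma_{h,\rho}$ be the surface $\{\varphi(t+ih(t))\}$, oriented by $(t_1,t_2)$, and $u_{\rm loc}(x)=\iint_{\Gamma_{h,\rho}}F(\xi)e^{-ix\cdot\xi}\,d\xi_1\wedge d\xi_2$. Call $\Gamma_{h,\rho}$ suitable if, for $t$ in the closed square: (a) $g_j(\varphi(t+i\varepsilon h(t)))\neq0$ for $0<\varepsilon\le1$; (b) $s_jh_j(t)>0$ where $t_j=0$; (c) $\operatorname{Im}(\tilde x\cdot\xi)<0$ at the points $\xi=\varphi(t+ih(t))$ with $t$ on the boundary of the square. **Theorem.** 1. $\mathcal J$ exists, and $\mathcal J(\mu,a;s)=2\pi e^{-is\mu\pi/2}a^{\mu-1}/\Gamma(\mu)$ if $a>0$, $\mathcal J(\mu,a;s)=0$ if $a<0$ (with $1/\Gamma(\mu)=0$ for $\mu\in\{0,-1,-2,\dots\}$). The local inverse $\varphi$ exists.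 2. $\xi^\star$ is active in the direction $\tilde x$ if and only if $\tilde x$ lies in the active quadrant, if and only if $\operatorname{sign}(\tilde x_1b_2-\tilde x_2a_2)=s_1$ and $\operatorname{sign}(-\tilde x_1b_1+\tilde x_2a_1)=s_2$. 3. Suppose $\xi^\star$ is active in the direction $\tilde x$, and let $$h_j(t)=\beta\Big(s_j\rho-2\,\frac{|x_1'|+|x_2'|}{x_j'}\,|t_j|\Big),\qquad L(x)=\frac{A\,e^{-ix\cdot\xi^\star}}{\Delta^\star}\,\mathcal J(\mu_1,r|x_1'|;s_1)\,\mathcal J(\mu_2,r|x_2'|;s_2),\quad x=r\tilde x .$$ For all sufficiently small $\rho>0$ and then all sufficiently small $\beta>0$, $\Gamma_{h,\rho}$ is suitable, the integrand of $u_{\rm loc}$ is integrable, and $$u_{\rm loc}(r\tilde x)=L(r\tilde x)+o\big(r^{\operatorname{Re}(\mu_1+\mu_2)-2}\big)\qquad(r\to\infty).$$ Moreover, for $r>0$ and $x=r\tilde x$, $$L(x)=\frac{4\pi^2A\,e^{-ix\cdot\xi^\star}e^{-i\frac\pi2(s_1\mu_1+s_2\mu_2)}}{\Gamma(\mu_1)\Gamma(\mu_2)(\Delta^\star)^{\mu_1+\mu_2-1}}\,|x_1b_2-x_2a_2|^{\mu_1-1}\,|-x_1b_1+x_2a_1|^{\mu_2-1}.$$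 If $A\ne0$ and $\mu_1,\mu_2\notin\{0,-1,-2,\dots\}$, then $u_{\rm loc}(r\tilde x)\sim L(r\tilde x)$, and $u_{\rm loc}(r\tilde x)$ is not $O(e^{-cr})$ for any $c>0$. 4. If $\xi^\star$ is inactive in the direction $\tilde x$, there is $v\in\mathbb R^2$ such that for all sufficiently small $\rho>0$ and then all sufficiently small $\beta>0$ the surface $\Gamma_{h,\rho}$ with constant field $h=\beta v$ is suitable, the integrand of $u_{\rm loc}$ is integrable, and $u_{\rm loc}(r\tilde x)=O(e^{-cr})$ as $r\to\infty$ for some $c>0$. 5. If $A\ne0$ and $\mu_1,\mu_2\notin\{0,-1,-2,\dots\}$, then for every $r>0$ the expression $\frac{A e^{-ir\tilde x\cdot\xi^\star}}{\Delta^\star}\mathcal J(\mu_1,rs_1x_1';s_1)\mathcal J(\mu_2,rs_2x_2';s_2)$, which equals $L(r\tilde x)$ in the active quadrant, is nonzero if and only if $\tilde x$ lies in the active quadrant. -/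

import Mathlib

open Filter Topology MeasureTheory Asymptotics Set

noncomputable section

namespace TransverseCrossing

/-- The point `t + i v` of `ℂ²` with real part `t` and imaginary part `v`. -/
def cplx (t v : ℝ × ℝ) : ℂ × ℂ :=
  ((t.1 : ℂ) + Complex.I * (v.1 : ℂ), (t.2 : ℂ) + Complex.I * (v.2 : ℂ))

/-- A point of `ℝ²` seen in `ℂ²`. -/
def toC (t : ℝ × ℝ) : ℂ × ℂ := ((t.1 : ℂ), (t.2 : ℂ))

/-- `∂g/∂ξ₁` at a real point (a real number when `g` has the real property). -/
def coefA (g : ℂ × ℂ → ℂ) (ξ : ℝ × ℝ) : ℝ :=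
  (deriv (fun z : ℂ => g (z, (ξ.2 : ℂ))) (ξ.1 : ℂ)).re

/-- `∂g/∂ξ₂` at a real point (a real number when `g` has the real property). -/
def coefB (g : ℂ × ℂ → ℂ) (ξ : ℝ × ℝ) : ℝ :=
  (deriv (fun z : ℂ => g ((ξ.1 : ℂ), z)) (ξ.2 : ℂ)).re

/-- The real property of the singularity `g = 0`: `g` is entire, real at real points, and regular
at every point of the real trace. -/
structure RealProperty (g : ℂ × ℂ → ℂ) : Prop where
  entire : Differentiable ℂ g
  real : ∀ ξ : ℝ × ℝ, (g (toC ξ)).im = 0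
  regular : ∀ ξ : ℝ × ℝ, g (toC ξ) = 0 → coefA g ξ ^ 2 + coefB g ξ ^ 2 ≠ 0

/-- The determinant `Δ = a₁ b₂ - a₂ b₁`. -/
def crossDet (g₁ g₂ : ℂ × ℂ → ℂ) (ξ : ℝ × ℝ) : ℝ :=
  coefA g₁ ξ * coefB g₂ ξ - coefA g₂ ξ * coefB g₁ ξ

/-! ### Integration surfaces near a real point, bridge configuration, activity -/

/-- The real vector field `η` describes, over `U ⊆ ℝ²`, a surface `ξ + i η(ξ)` of the class
considered: `η` is continuous, the surface is flattable with respect to `g₁ g₂ = 0` (no scaled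
surface `ξ + i ε η(ξ)`, `0 < ε ≤ 1`, meets the singularities), and `η` is nowhere zero on or
tangent to the real traces. -/
structure AdmissibleOn (g₁ g₂ : ℂ × ℂ → ℂ) (U : Set (ℝ × ℝ)) (η : ℝ × ℝ → ℝ × ℝ) : Prop where
  cont : ContinuousOn η U
  flattable : ∀ ξ ∈ U, ∀ ε ∈ Ioc (0 : ℝ) 1,
    g₁ (cplx ξ (ε • η ξ)) ≠ 0 ∧ g₂ (cplx ξ (ε • η ξ)) ≠ 0
  transverse₁ : ∀ ξ ∈ U, g₁ (toC ξ) = 0 →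
    coefA g₁ ξ * (η ξ).1 + coefB g₁ ξ * (η ξ).2 ≠ 0
  transverse₂ : ∀ ξ ∈ U, g₂ (toC ξ) = 0 →
    coefA g₂ ξ * (η ξ).1 + coefB g₂ ξ * (η ξ).2 ≠ 0

/-- The bridge sign of the surface with field `η` at a point of the real trace of `g = 0`: it is
`+1` (`-1`) if the trace is bypassed from above (below) in the direction of the normal `(a, b)`,
that is if `η · n` is positive (negative). -/
def bridgeSign (g : ℂ × ℂ → ℂ) (η : ℝ × ℝ → ℝ × ℝ) (ξ : ℝ × ℝ) : ℝ :=
  Real.sign (coefA g ξ * (η ξ).1 + coefB g ξ * (η ξ).2)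

/-- `ξ` is inactive in the direction `x`: near `ξ` the surface can be deformed continuously within
the class, without crossing the singularities, to a surface whose field `η'` satisfies
`x · η'(ξ) < 0`. -/
def IsInactive (g₁ g₂ : ℂ × ℂ → ℂ) (η : ℝ × ℝ → ℝ × ℝ) (ξ x : ℝ × ℝ) : Prop :=
  ∃ U ∈ 𝓝 ξ, ∃ H : ℝ → ℝ × ℝ → ℝ × ℝ,
    ContinuousOn (fun p : ℝ × (ℝ × ℝ) => H p.1 p.2) (Icc (0 : ℝ) 1 ×ˢ U) ∧
    (∀ τ ∈ Icc (0 : ℝ) 1, AdmissibleOn g₁ g₂ U (H τ)) ∧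
    (∀ ξ' ∈ U, H 0 ξ' = η ξ') ∧
    x.1 * (H 1 ξ).1 + x.2 * (H 1 ξ).2 < 0

/-- A point that is not inactive is active. -/
def IsActive (g₁ g₂ : ℂ × ℂ → ℂ) (η : ℝ × ℝ → ℝ × ℝ) (ξ x : ℝ × ℝ) : Prop :=
  ¬ IsInactive g₁ g₂ η ξ x

/-- The unit normal `(a, b) / √(a² + b²)` of the real trace. -/
def unitNormal (g : ℂ × ℂ → ℂ) (ξ : ℝ × ℝ) : ℝ × ℝ :=
  (1 / Real.sqrt (coefA g ξ ^ 2 + coefB g ξ ^ 2)) • (coefA g ξ, coefB g ξ)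

/-- The active quadrant.  The normal lines at the crossing cut the plane into the four open cones
spanned by `± n₁`, `± n₂`; this is the one that contains the bisector `s₁ n₁ + s₂ n₂` of the
quadrant `{v | s₁ n₁ · v > 0, s₂ n₂ · v > 0}` to which both arrows point. -/
def activeQuadrant (g₁ g₂ : ℂ × ℂ → ℂ) (s₁ s₂ : ℝ) (ξ : ℝ × ℝ) : Set (ℝ × ℝ) :=
  {x | ∃ c₁ > 0, ∃ c₂ > 0, x = (c₁ * s₁) • unitNormal g₁ ξ + (c₂ * s₂) • unitNormal g₂ ξ}

/-! ### The local behaviour of the transform -/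

/-- The branch of `z ↦ z ^ (-μ)` on the plane cut along `-i s [0, ∞)` (`s = ±1`) that agrees with
the principal branch on the half plane `s Im z > 0`. -/
def branchPow (s : ℝ) (μ z : ℂ) : ℂ :=
  Complex.exp (-(Complex.I * Real.pi * s * μ / 2)) * (-Complex.I * s * z) ^ (-μ)

/-- The set of `ξ ∈ ℂ²` with `g_j(ξ) ∉ -i s_j [0, ∞)` for `j = 1, 2`. -/
def cutDomain (g₁ g₂ : ℂ × ℂ → ℂ) (s₁ s₂ : ℝ) : Set (ℂ × ℂ) :=
  {ξ | -Complex.I * s₁ * g₁ ξ ∈ Complex.slitPlane ∧ -Complex.I * s₂ * g₂ ξ ∈ Complex.slitPlane}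

/-- `F ≈ A g₁^{-μ₁} g₂^{-μ₂}` at the crossing: `F` is holomorphic near `ξ` in the cut domain, and
its quotient by `g₁^{-μ₁} g₂^{-μ₂}` tends to `A` there. -/
structure CrossingBehaviour (F g₁ g₂ : ℂ × ℂ → ℂ) (s₁ s₂ : ℝ) (μ₁ μ₂ A : ℂ) (ξ : ℝ × ℝ) :
    Prop where
  holo : ∀ᶠ z in 𝓝[cutDomain g₁ g₂ s₁ s₂] (toC ξ), DifferentiableAt ℂ F z
  lead : Tendsto (fun z => F z / (branchPow s₁ μ₁ (g₁ z) * branchPow s₂ μ₂ (g₂ z)))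
    (𝓝[cutDomain g₁ g₂ s₁ s₂] (toC ξ)) (𝓝 A)

/-! ### The change of variables and the local integral -/

/-- `φ` is a holomorphic local inverse, sending `0` to `ξ`, of the change of variables
`ψ = (g₁, g₂)`. -/
structure IsLocalInverse (g₁ g₂ : ℂ × ℂ → ℂ) (ξ : ℝ × ℝ) (φ : ℂ × ℂ → ℂ × ℂ) : Prop where
  analytic : AnalyticAt ℂ φ 0
  base : φ 0 = toC ξ
  inverse : ∀ᶠ ζ in 𝓝 (0 : ℂ × ℂ), (g₁ (φ ζ), g₂ (φ ζ)) = ζ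

/-- Parametrisation of `ψ⁻¹(Γ'')`, where `Γ''` is the surface `t + i h(t)` in the variables `ζ`. -/
def surf (φ : ℂ × ℂ → ℂ × ℂ) (h : ℝ × ℝ → ℝ × ℝ) (t : ℝ × ℝ) : ℂ × ℂ := φ (cplx t (h t))

/-- The factor `j` in the pull-back `j dt₁ ∧ dt₂` of `dξ₁ ∧ dξ₂` along `P`. -/
def jac (P : ℝ × ℝ → ℂ × ℂ) (t : ℝ × ℝ) : ℂ :=
  deriv (fun y : ℝ => (P (y, t.2)).1) t.1 * deriv (fun y : ℝ => (P (t.1, y)).2) t.2 -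
    deriv (fun y : ℝ => (P (t.1, y)).1) t.2 * deriv (fun y : ℝ => (P (y, t.2)).2) t.1

/-- The form `F(ξ) e^{-i x·ξ} dξ₁ ∧ dξ₂` pulled back along `P`. -/
def integrand (F : ℂ × ℂ → ℂ) (x : ℝ × ℝ) (P : ℝ × ℝ → ℂ × ℂ) (t : ℝ × ℝ) : ℂ :=
  F (P t) * Complex.exp (-Complex.I * ((x.1 : ℂ) * (P t).1 + (x.2 : ℂ) * (P t).2)) * jac P t

/-- The open square `|t₁| < ρ`, `|t₂| < ρ`. -/
def square (ρ : ℝ) : Set (ℝ × ℝ) := Ioo (-ρ) ρ ×ˢ Ioo (-ρ) ρ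

/-- The integral of `F(ξ) e^{-i x·ξ} dξ₁ ∧ dξ₂` over the surface parametrised by `P` on the
square. -/
def uLoc (F : ℂ × ℂ → ℂ) (P : ℝ × ℝ → ℂ × ℂ) (ρ : ℝ) (x : ℝ × ℝ) : ℂ :=
  ∫ t in square ρ, integrand F x P t

/-- `x'₁ = (x₁ b₂ - x₂ a₂) / Δ`. -/
def xprime₁ (g₁ g₂ : ℂ × ℂ → ℂ) (ξ x : ℝ × ℝ) : ℝ :=
  (x.1 * coefB g₂ ξ - x.2 * coefA g₂ ξ) / crossDet g₁ g₂ ξ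

/-- `x'₂ = (-x₁ b₁ + x₂ a₁) / Δ`. -/
def xprime₂ (g₁ g₂ : ℂ × ℂ → ℂ) (ξ x : ℝ × ℝ) : ℝ :=
  (-x.1 * coefB g₁ ξ + x.2 * coefA g₁ ξ) / crossDet g₁ g₂ ξ

/-- The vector field `η''` on the square in the variables `ζ`. -/
def crossField (s₁ s₂ x₁ x₂ ρ β : ℝ) (t : ℝ × ℝ) : ℝ × ℝ :=
  (β * (s₁ * ρ - 2 * ((|x₁| + |x₂|) / x₁) * |t.1|),
    β * (s₂ * ρ - 2 * ((|x₁| + |x₂|) / x₂) * |t.2|))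

/-- Suitability of the local surface `ψ⁻¹(t + i h(t))` over the square for the direction `x`:
none of the scaled surfaces meets the singularities, the bridge configuration is `(s₁, s₂)`, and
`e^{-i r x·ξ}` decays exponentially at the points over the boundary. -/
structure SuitableSurface (g₁ g₂ : ℂ × ℂ → ℂ) (φ : ℂ × ℂ → ℂ × ℂ) (s₁ s₂ : ℝ) (x : ℝ × ℝ)
    (h : ℝ × ℝ → ℝ × ℝ) (ρ : ℝ) : Prop where
  flattable : ∀ t ∈ closure (square ρ), ∀ ε ∈ Ioc (0 : ℝ) 1,
    g₁ (surf φ (fun t => ε • h t) t) ≠ 0 ∧ g₂ (surf φ (fun t => ε • h t) t) ≠ 0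
  bridge₁ : ∀ t ∈ closure (square ρ), t.1 = 0 → 0 < s₁ * (h t).1
  bridge₂ : ∀ t ∈ closure (square ρ), t.2 = 0 → 0 < s₂ * (h t).2
  decay : ∀ t ∈ frontier (square ρ),
    ((x.1 : ℂ) * (surf φ h t).1 + (x.2 : ℂ) * (surf φ h t).2).im < 0

/-! ### The function `𝒥` and the leading term -/

/-- `f` is the entire function of `μ` which for `Re μ > 0` is the improper integral
`∫ z^{-μ} e^{-i s a z} dz` over the line from `-∞ + i s ε` to `∞ + i s ε`, for every `ε > 0`. -/
structure IsCalJ (a s : ℝ) (f : ℂ → ℂ) : Prop where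
  entire : Differentiable ℂ f
  value : ∀ μ : ℂ, 0 < μ.re → ∀ ε : ℝ, 0 < ε →
    Tendsto (fun R : ℝ × ℝ => ∫ y in (-R.1)..R.2,
        ((y : ℂ) + Complex.I * s * ε) ^ (-μ) *
          Complex.exp (-Complex.I * s * a * ((y : ℂ) + Complex.I * s * ε)))
      (atTop ×ˢ atTop) (𝓝 (f μ))

/-- `𝒥(μ, a; s)`, continued analytically in `μ` from `Re μ > 0`. -/
def calJ (μ : ℂ) (a s : ℝ) : ℂ := Classical.epsilon (IsCalJ a s) μ

/-- `A e^{-i x·ξ} / Δ · 𝒥(μ₁, α₁; s₁) · 𝒥(μ₂, α₂; s₂)`. -/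
def crossTerm (A μ₁ μ₂ : ℂ) (Δ s₁ s₂ : ℝ) (ξ x : ℝ × ℝ) (α₁ α₂ : ℝ) : ℂ :=
  A * Complex.exp (-Complex.I * ((x.1 : ℂ) * ξ.1 + (x.2 : ℂ) * ξ.2)) / Δ *
    calJ μ₁ α₁ s₁ * calJ μ₂ α₂ s₂

end TransverseCrossing

end

open TransverseCrossing

/-!
In the variables `ζ = ψ(ξ) = (g₁(ξ), g₂(ξ))` the two singularities are the coordinate axes, and the
local integral is a two-dimensional oscillatory integral whose amplitude is
`(A / Δ) ζ₁ ^ (-μ₁) ζ₂ ^ (-μ₂)` to leading order and whose phase is `x · ξ + x₁' ζ₁ + x₂' ζ₂` to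
first order. If phase and amplitude were exact, the integral over the bridged plane would be the
product of the two one-dimensional integrals `𝒥`. The theorem says that the corrections are of
lower order, and that the surface may be pushed into the region of decay when the signs of `x'`
and of the bridges disagree.

* *The function `𝒥`* (`isCalJ_calJValue`, `calJ_eq`). After the rotation `w = -i s z` the line of
  integration is vertical and `𝒥` is an inverse Laplace transform. For `Re μ > 1` it is computed by
  Fourier inversion (`integral_vertical_cpow_mul_exp`), and an integration by parts extends the
  value to `Re μ > 0`. The closed form is entire in `μ`, so it is the continuation.

* *Hankel's formula* (`integral_tent_hankel`). For `a > 0` the line may be bent into a tent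
  `t + i s (δ - σ |t|)`, along which the integrand decays exponentially; the integral then converges
  absolutely for every `μ`. This gives the analytic continuation as an honest integral, which is
  what dominated convergence needs.

* *The change of variables* (`exists_isLocalInverse`). The `g_j` are assumed only complex
  differentiable, so their analyticity is proved first (`analyticAt_of_differentiable`, Osgood's
  lemma). By reflection the local inverse is real at real points, hence the imaginary part of the
  phase over `t + i y` is `x' · y` up to a small multiple of `‖y‖`, uniformly in `t`
  (`IsLocalInverse.abs_im_phase_sub_le`). This controls every exponential below.

* *Activity* (`isActive_iff`). The products of the field with the two conormals cannot vanish along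
  an admissible deformation, so their signs `s_j` persist, and `x̃ · η = Σ x_j' (∇g_j · η)` stays
  positive when `s_j x_j' > 0`. Otherwise some vector with the bridge signs `s_j` points against `x̃`,
  and the given field is deformed to a small multiple of it (`exists_admissible_deformation`).

* *Active directions* (`tendsto_integral_tent`, `IsLocalInverse.tendsto_uLoc`). The surface of the
  theorem is a product of two tents of height `β ρ`. Cauchy's theorem in each variable lowers the tips
  to height `1 / r` with the boundary fixed. After the substitution `t = τ / r` the integrand
  tends pointwise to the product of two Hankel integrands, and is dominated by a fixed multiple of
  `exp (-c (|τ₁| + |τ₂|) / 2)`.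

* *Inactive directions* (`IsLocalInverse.exists_exp_decay`). With a constant field `v` such that
  `x' · v < 0` the integrand is exponentially small on the whole compact surface.
-/

/-! ### The inverse Laplace transform of a power -/

theorem integrableOn_cpow_mul_exp_neg_mul {a r : ℂ} (ha : 0 < a.re) (hr : 0 < r.re) :
    IntegrableOn (fun t : ℝ => (t : ℂ) ^ (a - 1) * Complex.exp (-(r * t))) (Ioi 0) := by
  have h := integrableOn_rpow_mul_exp_neg_mul_rpow (s := a.re - 1) (p := 1) (b := r.re)
    (by linarith) one_pos hr
  refine h.mono' ?_ ?_
  · refine ContinuousOn.aestronglyMeasurable (fun t ht => ?_) measurableSet_Ioi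
    refine ContinuousAt.continuousWithinAt ?_
    have : (t : ℂ) ∈ Complex.slitPlane := Or.inl (by simpa using ht)
    fun_prop (disch := assumption)
  · filter_upwards [ae_restrict_mem measurableSet_Ioi] with t ht
    have ht' : (0 : ℝ) < t := ht
    rw [norm_mul, Complex.norm_cpow_eq_rpow_re_of_pos ht', Complex.norm_exp]
    simp

/-- The Laplace transform of `t ^ (a - 1)`, at a complex frequency: the formula at real
frequencies extends to the half plane by the identity theorem. -/
theorem integral_cpow_mul_exp_neg_mul_complex {a r : ℂ} (ha : 0 < a.re) (hr : 0 < r.re) :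
    ∫ t : ℝ in Ioi 0, (t : ℂ) ^ (a - 1) * Complex.exp (-(r * t)) =
      (1 / r) ^ a * Complex.Gamma a := by
  set S : Set ℂ := {z | 0 < z.re} with hS
  have hSo : IsOpen S := isOpen_lt continuous_const Complex.continuous_re
  have hSc : IsPreconnected S := (convex_halfSpace_re_gt 0).isPreconnected
  set f : ℂ → ℂ := fun r => ∫ t : ℝ in Ioi 0, (t : ℂ) ^ (a - 1) * Complex.exp (-(r * t)) with hf
  set g : ℂ → ℂ := fun r => (1 / r) ^ a * Complex.Gamma a with hg
  have hfd : DifferentiableOn ℂ f S := by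
    intro r hr
    have hr' : 0 < r.re := hr
    refine DifferentiableAt.differentiableWithinAt ?_
    have hm : ∀ r : ℂ, 0 < r.re → AEStronglyMeasurable
        (fun t : ℝ => (t : ℂ) ^ (a - 1) * Complex.exp (-(r * t))) (volume.restrict (Ioi 0)) :=
      fun r hr => (integrableOn_cpow_mul_exp_neg_mul ha hr).aestronglyMeasurable
    have hnhds : {z : ℂ | r.re / 2 < z.re} ∈ 𝓝 r :=
      (isOpen_lt continuous_const Complex.continuous_re).mem_nhds
        (show r.re / 2 < r.re by linarith)
    have key := hasDerivAt_integral_of_dominated_loc_of_deriv_le (μ := volume.restrict (Ioi (0:ℝ)))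
      (F := fun (r : ℂ) (t : ℝ) => (t : ℂ) ^ (a - 1) * Complex.exp (-(r * t)))
      (F' := fun (r : ℂ) (t : ℝ) => -((t : ℂ) ^ (a + 1 - 1) * Complex.exp (-(r * t))))
      (bound := fun t => t ^ a.re * Real.exp (-(r.re / 2) * t ^ (1:ℝ))) (x₀ := r) hnhds
      ?_ (integrableOn_cpow_mul_exp_neg_mul ha hr') ?_ ?_ ?_ ?_
    · exact key.2.differentiableAt
    · filter_upwards [hSo.mem_nhds hr] with z hz using hm z hz
    · exact (integrableOn_cpow_mul_exp_neg_mul (a := a + 1) (r := r)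
        (by simp; linarith) hr').aestronglyMeasurable.neg
    · filter_upwards [ae_restrict_mem measurableSet_Ioi] with t ht z hz
      have ht' : (0 : ℝ) < t := ht
      have hz' : r.re / 2 < z.re := hz
      rw [norm_neg, norm_mul, Complex.norm_cpow_eq_rpow_re_of_pos ht', Complex.norm_exp]
      simp only [add_sub_cancel_right, Complex.neg_re, Complex.re_mul_ofReal, Real.rpow_one]
      gcongr
      nlinarith
    · exact integrableOn_rpow_mul_exp_neg_mul_rpow (by linarith) one_pos (by linarith)
    · filter_upwards [ae_restrict_mem measurableSet_Ioi] with t ht z hz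
      have ht' : (t : ℂ) ≠ 0 := by exact_mod_cast (ne_of_gt ht)
      have h1 : HasDerivAt (fun z : ℂ => Complex.exp (-(z * t))) (Complex.exp (-(z * t)) * -t) z :=
        (Complex.hasDerivAt_exp _).comp z (by
          have := ((hasDerivAt_id z).mul_const (t : ℂ)).neg
          rw [one_mul] at this
          exact this)
      convert! h1.const_mul ((t : ℂ) ^ (a - 1)) using 1
      have : (t : ℂ) ^ (a + 1 - 1) = (t : ℂ) ^ (a - 1) * t := by
        rw [show a + 1 - 1 = (a - 1) + 1 by ring, Complex.cpow_add _ _ ht', Complex.cpow_one]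
      rw [this]; ring
  have hgd : DifferentiableOn ℂ g S := by
    intro r hr
    have hr' : 0 < r.re := hr
    have h0 : r ≠ 0 := by rintro rfl; simp at hr'
    have h1 : (1 / r) ∈ Complex.slitPlane := by
      left
      rw [one_div, Complex.inv_re]
      exact div_pos hr' (Complex.normSq_pos.2 h0)
    refine DifferentiableAt.differentiableWithinAt ?_
    have : DifferentiableAt ℂ (fun r : ℂ => 1 / r) r := by fun_prop (disch := assumption)
    exact (this.cpow_const h1).mul_const _
  refine (hfd.analyticOnNhd hSo).eqOn_of_preconnected_of_frequently_eq (hgd.analyticOnNhd hSo)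
    hSc (z₀ := 1) (by simp [hS]) ?_ hr
  -- the two sides agree at `1 + 1/n`, and these points accumulate at `1`
  have hu : Tendsto (fun n : ℕ => (1 : ℂ) + ((1 / ((n : ℝ) + 1) : ℝ) : ℂ)) atTop (𝓝[≠] 1) := by
    refine tendsto_nhdsWithin_iff.2 ⟨?_, Eventually.of_forall fun n => ?_⟩
    · have := (Complex.continuous_ofReal.tendsto 0).comp
        (tendsto_one_div_add_atTop_nhds_zero_nat (𝕜 := ℝ))
      simpa using this.const_add 1
    · simp only [mem_compl_iff, mem_singleton_iff, add_eq_left, Complex.ofReal_eq_zero]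
      positivity
  refine hu.frequently (Frequently.of_forall fun n => ?_)
  have := Complex.integral_cpow_mul_exp_neg_mul_Ioi (a := a) (r := 1 + 1 / ((n : ℝ) + 1)) ha
    (by positivity)
  simp only [hf, hg]
  push_cast at this ⊢
  exact this

theorem norm_cpow_neg_le (z μ : ℂ) :
    ‖z ^ (-μ)‖ ≤ ‖z‖ ^ (-μ.re) * Real.exp (Real.pi * |μ.im|) := by
  refine (Complex.norm_cpow_le _ _).trans ?_
  rw [div_eq_mul_inv, ← Real.exp_neg, Complex.neg_re]
  gcongr
  simp only [Complex.neg_im, mul_neg, neg_neg]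
  refine (le_abs_self _).trans ?_
  rw [abs_mul]
  gcongr
  exact Complex.abs_arg_le_pi _

/-- Powers of points of a vertical line in the right half plane are absolutely integrable when the
exponent has real part `> 1`. -/
theorem integrable_vertical_cpow {ε : ℝ} (hε : 0 < ε) {μ : ℂ} (hμ : 1 < μ.re) :
    Integrable (fun y : ℝ => ((ε : ℂ) + Complex.I * y) ^ (-μ)) := by
  have h1 := integrable_rpow_neg_one_add_norm_sq (E := ℝ) (μ := volume) (r := μ.re)
    (by simpa using hμ)
  have hlow : ∀ y : ℝ, min ε 1 * (1 + ‖y‖ ^ 2) ^ (1 / 2 : ℝ) ≤ ‖(ε : ℂ) + Complex.I * y‖ := by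
    intro y
    rw [Complex.norm_eq_sqrt_sq_add_sq, ← Real.sqrt_eq_rpow]
    apply Real.le_sqrt_of_sq_le
    rw [mul_pow, Real.sq_sqrt (by positivity)]
    simp
    have h2 : min ε 1 ≤ ε := min_le_left _ _
    have h3 : min ε 1 ≤ 1 := min_le_right _ _
    have h4 : 0 < min ε 1 := lt_min hε one_pos
    nlinarith [sq_nonneg y, mul_le_mul h3 h3 h4.le zero_le_one, mul_le_mul h2 h2 h4.le hε.le,
      mul_nonneg (sub_nonneg.2 (mul_le_mul h3 h3 h4.le zero_le_one)) (sq_nonneg y)]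
  refine (h1.const_mul ((min ε 1) ^ (-μ.re) * Real.exp (Real.pi * |μ.im|))).mono' ?_ ?_
  · refine Continuous.aestronglyMeasurable ?_
    refine continuous_iff_continuousAt.2 fun y => ?_
    have : (ε : ℂ) + Complex.I * y ∈ Complex.slitPlane := Or.inl (by simpa using hε)
    fun_prop (disch := assumption)
  · refine Eventually.of_forall fun y => ?_
    have h4 : 0 < min ε 1 := lt_min hε one_pos
    have h5 : ‖(ε : ℂ) + Complex.I * y‖ ^ (-μ.re) ≤
        (min ε 1) ^ (-μ.re) * (1 + ‖y‖ ^ 2) ^ (-μ.re / 2) := by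
      have := Real.rpow_le_rpow_of_nonpos (x := min ε 1 * (1 + ‖y‖ ^ 2) ^ (1 / 2 : ℝ))
        (z := -μ.re) (by positivity) (hlow y) (by linarith)
      refine this.trans (le_of_eq ?_)
      rw [Real.mul_rpow h4.le (by positivity), ← Real.rpow_mul (by positivity)]
      congr 2; ring
    calc _ ≤ ‖(ε : ℂ) + Complex.I * y‖ ^ (-μ.re) * Real.exp (Real.pi * |μ.im|) :=
          norm_cpow_neg_le _ _
      _ ≤ ((min ε 1) ^ (-μ.re) * (1 + ‖y‖ ^ 2) ^ (-μ.re / 2)) * Real.exp (Real.pi * |μ.im|) := by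
          gcongr
      _ = _ := by ring

/-- The inverse Laplace transform of `w ^ (-μ)` for `Re μ > 1`, where the integral converges
absolutely: Fourier inversion for `t ^ (μ - 1) e ^ (-ε t)` on the half line. -/
theorem integral_vertical_cpow_mul_exp {ε : ℝ} (hε : 0 < ε) {μ : ℂ} (hμ : 1 < μ.re) {a : ℝ}
    (ha : a ≠ 0) :
    ∫ y : ℝ, ((ε : ℂ) + Complex.I * y) ^ (-μ) * Complex.exp (a * ((ε : ℂ) + Complex.I * y)) =
      if 0 < a then 2 * Real.pi * (a : ℂ) ^ (μ - 1) / Complex.Gamma μ else 0 := by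
  have hμ0 : 0 < μ.re := by linarith
  set f : ℝ → ℂ := (Ioi (0 : ℝ)).indicator
    (fun t : ℝ => (t : ℂ) ^ (μ - 1) * Complex.exp (-((ε : ℂ) * t))) with hf
  have hfi : Integrable f :=
    (integrable_indicator_iff measurableSet_Ioi).2
      (integrableOn_cpow_mul_exp_neg_mul hμ0 (by simpa using hε))
  have hne : ∀ y : ℝ, (ε : ℂ) + Complex.I * y ∈ Complex.slitPlane :=
    fun y => Or.inl (by simpa using hε)
  have hF : FourierTransform.fourier f = fun ξ : ℝ =>
      ((ε : ℂ) + Complex.I * ((2 * Real.pi * ξ : ℝ) : ℂ)) ^ (-μ) * Complex.Gamma μ := by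
    funext ξ
    rw [Real.fourier_eq']
    have h := integral_cpow_mul_exp_neg_mul_complex (a := μ)
      (r := (ε : ℂ) + Complex.I * ((2 * Real.pi * ξ : ℝ) : ℂ)) hμ0 (by simpa using hε)
    rw [one_div, Complex.inv_cpow _ _ (Complex.slitPlane_arg_ne_pi (hne _)),
      ← Complex.cpow_neg] at h
    rw [← h, ← integral_indicator measurableSet_Ioi]
    congr 1
    funext t
    by_cases ht : t ∈ Ioi (0 : ℝ)
    · simp only [hf, indicator_of_mem ht, smul_eq_mul]
      rw [mul_left_comm, ← Complex.exp_add]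
      congr 2
      simp
      ring
    · simp [hf, indicator_of_notMem ht]
  have h2π : (2 * Real.pi) ≠ 0 := by positivity
  have hFi : Integrable (FourierTransform.fourier f) := by
    rw [hF]
    exact ((integrable_vertical_cpow hε hμ).comp_mul_left' h2π).mul_const _
  have hcont : ContinuousAt f a := by
    rcases lt_or_gt_of_ne ha with h | h
    · have : f =ᶠ[𝓝 a] fun _ => 0 := by
        filter_upwards [Iio_mem_nhds h] with t ht
        exact indicator_of_notMem (by simpa using le_of_lt ht) _
      exact continuousAt_const.congr this.symm
    · have : f =ᶠ[𝓝 a] (fun t : ℝ => (t : ℂ) ^ (μ - 1) * Complex.exp (-((ε : ℂ) * t))) := by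
        filter_upwards [Ioi_mem_nhds h] with t ht
        exact indicator_of_mem ht _
      refine ContinuousAt.congr ?_ this.symm
      have : (a : ℂ) ∈ Complex.slitPlane := Or.inl (by simpa using h)
      fun_prop (disch := assumption)
  have hinv := hfi.fourierInv_fourier_eq hFi hcont
  rw [hF, Real.fourierInv_eq'] at hinv
  -- substitution `y = 2 π ξ`
  have hsub := Measure.integral_comp_mul_left (fun y : ℝ => ((ε : ℂ) + Complex.I * y) ^ (-μ) *
    Complex.exp (a * ((ε : ℂ) + Complex.I * y))) (2 * Real.pi)
  have hΓ : Complex.Gamma μ ≠ 0 := Complex.Gamma_ne_zero_of_re_pos hμ0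
  have hL : ∫ x : ℝ, ((ε : ℂ) + Complex.I * ((2 * Real.pi * x : ℝ) : ℂ)) ^ (-μ) *
      Complex.exp (a * ((ε : ℂ) + Complex.I * ((2 * Real.pi * x : ℝ) : ℂ))) =
      (Complex.exp (a * ε) / Complex.Gamma μ) * f a := by
    rw [← hinv, ← integral_const_mul]
    congr 1
    funext x
    rw [mul_add, Complex.exp_add, smul_eq_mul]
    have : Complex.exp (↑(2 * Real.pi * inner ℝ x a) * Complex.I) =
        Complex.exp (a * (Complex.I * ((2 * Real.pi * x : ℝ) : ℂ))) := by
      congr 1; simp; ring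
    rw [this]
    field_simp
  rw [hL, abs_of_pos (by positivity), eq_inv_smul_iff₀ h2π] at hsub
  rw [← hsub]
  split_ifs with h
  · have e : Complex.exp (a * ε) * Complex.exp (-((ε : ℂ) * a)) = 1 := by
      rw [← Complex.exp_add]; simp [mul_comm]
    simp only [hf, indicator_of_mem (show a ∈ Ioi (0:ℝ) from h), Complex.real_smul]
    push_cast
    linear_combination (2 * Real.pi * (a : ℂ) ^ (μ - 1) / Complex.Gamma μ) * e
  · simp [hf, h]

theorem tendsto_cpow_neg_cobounded {μ : ℂ} (hμ : 0 < μ.re) :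
    Tendsto (fun z : ℂ => z ^ (-μ)) (Bornology.cobounded ℂ) (𝓝 0) := by
  refine squeeze_zero_norm (fun z => norm_cpow_neg_le z μ) ?_
  have := (tendsto_rpow_neg_atTop hμ).comp (tendsto_norm_cobounded_atTop (E := ℂ))
  simpa using this.mul_const (Real.exp (Real.pi * |μ.im|))

theorem norm_exp_vertical (ε a y : ℝ) :
    ‖Complex.exp (a * ((ε : ℂ) + Complex.I * y))‖ = Real.exp (a * ε) := by
  rw [Complex.norm_exp]; simp

/-- The recurrence in `μ` satisfied by `2 π a ^ (μ - 1) / Γ(μ)`. -/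
theorem mul_div_Gamma_add_one {μ : ℂ} (hμ : μ ≠ 0) {a : ℝ} (ha : a ≠ 0) :
    μ * (2 * Real.pi * (a : ℂ) ^ (μ + 1 - 1) / Complex.Gamma (μ + 1)) =
      a * (2 * Real.pi * (a : ℂ) ^ (μ - 1) / Complex.Gamma μ) := by
  have ha' : (a : ℂ) ≠ 0 := by exact_mod_cast ha
  rw [Complex.Gamma_add_one _ hμ, show μ + 1 - 1 = (μ - 1) + 1 by ring,
    Complex.cpow_add _ _ ha', Complex.cpow_one]
  field_simp

/-- The inverse Laplace transform of `w ^ (-μ)` for `Re μ > 0`, as an improper integral: an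
integration by parts raises `μ` by one and so reduces it to the absolutely convergent case. -/
theorem tendsto_integral_vertical_cpow_mul_exp {ε : ℝ} (hε : 0 < ε) {μ : ℂ} (hμ : 0 < μ.re)
    {a : ℝ} (ha : a ≠ 0) :
    Tendsto (fun R : ℝ × ℝ => ∫ y in (-R.1)..R.2, ((ε : ℂ) + Complex.I * y) ^ (-μ) *
        Complex.exp (a * ((ε : ℂ) + Complex.I * y))) (atTop ×ˢ atTop)
      (𝓝 (if 0 < a then 2 * Real.pi * (a : ℂ) ^ (μ - 1) / Complex.Gamma μ else 0)) := by
  have ha' : (a : ℂ) ≠ 0 := by exact_mod_cast ha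
  have hμ0 : μ ≠ 0 := by rintro rfl; simp at hμ
  have hμ1 : 1 < (μ + 1).re := by simpa using hμ
  have hne : ∀ y : ℝ, (ε : ℂ) + Complex.I * y ∈ Complex.slitPlane :=
    fun y => Or.inl (by simpa using hε)
  set B : ℝ → ℂ := fun y => ((ε : ℂ) + Complex.I * y) ^ (-μ) *
    Complex.exp (a * ((ε : ℂ) + Complex.I * y)) with hB
  set C : ℝ → ℂ := fun y => ((ε : ℂ) + Complex.I * y) ^ (-(μ + 1)) *
    Complex.exp (a * ((ε : ℂ) + Complex.I * y)) with hC
  have hcont : ∀ ν : ℂ, Continuous fun y : ℝ => ((ε : ℂ) + Complex.I * y) ^ (-ν) *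
      Complex.exp (a * ((ε : ℂ) + Complex.I * y)) := fun ν =>
    continuous_iff_continuousAt.2 fun y => by
      have := hne y
      fun_prop (disch := assumption)
  have hd : ∀ y : ℝ, HasDerivAt B (Complex.I * (a * B y - μ * C y)) y := by
    intro y
    have h1 : HasDerivAt (fun w : ℂ => w ^ (-μ) * Complex.exp (a * w))
        ((-μ) * ((ε : ℂ) + Complex.I * y) ^ (-μ - 1) * Complex.exp (a * ((ε : ℂ) + Complex.I * y)) +
          ((ε : ℂ) + Complex.I * y) ^ (-μ) *
            (Complex.exp (a * ((ε : ℂ) + Complex.I * y)) * a)) ((ε : ℂ) + Complex.I * y) := by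
      have e1 := (hasDerivAt_id ((ε : ℂ) + Complex.I * y)).cpow_const (c := -μ) (hne y)
      have e2 : HasDerivAt (fun w : ℂ => a * w) a ((ε : ℂ) + Complex.I * y) := by
        simpa using (hasDerivAt_id ((ε : ℂ) + Complex.I * y)).const_mul (a : ℂ)
      have := e1.mul e2.cexp
      simpa using! this
    have h2 : HasDerivAt (fun y : ℝ => (ε : ℂ) + Complex.I * y) Complex.I y := by
      simpa using ((Complex.ofRealCLM.hasDerivAt (x := y)).const_mul Complex.I).const_add (ε : ℂ)
    have := h1.comp y h2
    convert! this using 1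
    simp only [hB, hC, show -(μ + 1) = -μ - 1 by ring]
    ring
  have hBi : ∀ u v : ℝ, IntervalIntegrable B volume u v :=
    fun u v => (hcont μ).intervalIntegrable _ _
  have hCi : ∀ u v : ℝ, IntervalIntegrable C volume u v :=
    fun u v => (hcont (μ + 1)).intervalIntegrable _ _
  have hparts : ∀ u v : ℝ, ∫ y in u..v, B y =
      (μ * ∫ y in u..v, C y) / a + (B v - B u) / (Complex.I * a) := by
    intro u v
    have h := intervalIntegral.integral_eq_sub_of_hasDerivAt (fun y _ => hd y)
      ((((hBi u v).const_mul (a : ℂ)).sub ((hCi u v).const_mul μ)).const_mul Complex.I)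
    rw [intervalIntegral.integral_const_mul, intervalIntegral.integral_sub
      ((hBi u v).const_mul (a : ℂ)) ((hCi u v).const_mul μ),
      intervalIntegral.integral_const_mul, intervalIntegral.integral_const_mul] at h
    rw [← h]
    field_simp
    ring
  have hCint : Integrable C := by
    refine ((integrable_vertical_cpow hε hμ1).norm.mul_const (Real.exp (a * ε))).mono'
      (hcont (μ + 1)).aestronglyMeasurable (Eventually.of_forall fun y => ?_)
    rw [norm_mul, norm_exp_vertical]
  have hB0 : ∀ l : Filter ℝ, Tendsto (fun y : ℝ => |y|) l atTop → Tendsto B l (𝓝 0) := by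
    intro l hl
    have h1 : Tendsto (fun y : ℝ => (ε : ℂ) + Complex.I * y) l (Bornology.cobounded ℂ) := by
      rw [← tendsto_norm_atTop_iff_cobounded]
      refine tendsto_atTop_mono (fun y => ?_) hl
      simpa using Complex.abs_im_le_norm ((ε : ℂ) + Complex.I * y)
    have h2 := ((tendsto_cpow_neg_cobounded hμ).comp h1).norm.mul_const (Real.exp (a * ε))
    rw [tendsto_zero_iff_norm_tendsto_zero]
    simpa [hB, norm_mul, norm_exp_vertical] using h2
  have hlimC := intervalIntegral_tendsto_integral hCint
    (tendsto_neg_atTop_atBot.comp (tendsto_fst (f := atTop) (g := (atTop : Filter ℝ))))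
    (tendsto_snd (f := (atTop : Filter ℝ)) (g := atTop))
  have hBr := (hB0 atTop tendsto_abs_atTop_atTop).comp
    (tendsto_snd (f := (atTop : Filter ℝ)) (g := atTop))
  have hBl := (hB0 atBot tendsto_abs_atBot_atTop).comp
    (tendsto_neg_atTop_atBot.comp (tendsto_fst (f := atTop) (g := (atTop : Filter ℝ))))
  have hlim := ((hlimC.const_mul μ).div_const (a : ℂ)).add
    ((hBr.sub hBl).div_const (Complex.I * a))
  have hval : (if 0 < a then 2 * Real.pi * (a : ℂ) ^ (μ - 1) / Complex.Gamma μ else 0) =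
      μ * (∫ y, C y) / a + (0 - 0) / (Complex.I * a) := by
    rw [hC, integral_vertical_cpow_mul_exp hε hμ1 ha]
    split_ifs
    · rw [mul_div_Gamma_add_one hμ0 ha, mul_div_cancel_left₀ _ ha']
      simp
    · simp
  rw [hval]
  exact hlim.congr fun R => (hparts (-R.1) R.2).symm

/-! ### The function `𝒥` -/

/-- The branch cut along `-i s [0, ∞)` is the principal one where `s Im z > 0`. -/
theorem branchPow_eq_cpow {s : ℝ} (hs : s = 1 ∨ s = -1) (μ : ℂ) {z : ℂ} (hz : 0 < s * z.im) :
    branchPow s μ z = z ^ (-μ) := by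
  set w : ℂ := -Complex.I * s * z with hw
  have hwre : 0 < w.re := by simpa [hw] using hz
  have hw0 : w ≠ 0 := by rintro h; simp [h] at hwre
  have hz0 : z ≠ 0 := by rintro rfl; simp at hz
  have hexpI : Complex.exp (Complex.I * Real.pi * s / 2) = Complex.I * s := by
    rcases hs with rfl | rfl
    · rw [show Complex.I * Real.pi * ((1 : ℝ) : ℂ) / 2 = Real.pi / 2 * Complex.I by push_cast; ring,
        Complex.exp_pi_div_two_mul_I]; simp
    · rw [show Complex.I * Real.pi * ((-1 : ℝ) : ℂ) / 2 = -(Real.pi / 2 * Complex.I) by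
        push_cast; ring, Complex.exp_neg, Complex.exp_pi_div_two_mul_I]; simp
  have hss : (s : ℂ) * s = 1 := by rcases hs with rfl | rfl <;> simp
  have hzw : z = Complex.exp (Complex.log w + Complex.I * Real.pi * s / 2) := by
    rw [Complex.exp_add, Complex.exp_log hw0, hexpI, hw]
    linear_combination (-z) * hss + z * s * s * Complex.I_mul_I
  have harg := abs_lt.1 (Complex.abs_arg_lt_pi_div_two_iff.2 (Or.inl hwre))
  have him : (Complex.log w + Complex.I * Real.pi * s / 2).im =
      Complex.arg w + Real.pi * s / 2 := by
    rw [show Complex.I * Real.pi * s / 2 = ((Real.pi * s / 2 : ℝ) : ℂ) * Complex.I by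
      push_cast; ring]
    simp [Complex.log_im]
  have hlog : Complex.log z = Complex.log w + Complex.I * Real.pi * s / 2 := by
    conv_lhs => rw [hzw]
    apply Complex.log_exp <;> rw [him] <;> rcases hs with rfl | rfl <;> linarith [Real.pi_pos]
  rw [branchPow, ← hw, Complex.cpow_def_of_ne_zero hw0, Complex.cpow_def_of_ne_zero hz0, hlog,
    ← Complex.exp_add]
  congr 1
  ring

/-- The closed form of `𝒥(μ, a; s)`. -/
noncomputable def calJValue (μ : ℂ) (a s : ℝ) : ℂ :=
  if 0 < a then
    2 * Real.pi * Complex.exp (-(Complex.I * s * μ * Real.pi / 2)) * (a : ℂ) ^ (μ - 1) /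
      Complex.Gamma μ
  else 0

theorem differentiable_calJValue (a s : ℝ) : Differentiable ℂ fun μ => calJValue μ a s := by
  unfold calJValue
  by_cases ha : 0 < a
  · have ha' : (a : ℂ) ≠ 0 := by exact_mod_cast ha.ne'
    simp only [if_pos ha, div_eq_mul_inv]
    refine Differentiable.mul ?_ Complex.differentiable_one_div_Gamma
    refine Differentiable.mul (by fun_prop) ?_
    intro μ
    exact DifferentiableAt.const_cpow (by fun_prop) (Or.inl ha')
  · simp only [if_neg ha]
    exact differentiable_const 0

/-- The rotation `w = -i s z` takes the line `Im z = s ε` to the line `Re w = ε`, on which the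
integral is an inverse Laplace transform. -/
theorem isCalJ_calJValue {a s : ℝ} (ha : a ≠ 0) (hs : s = 1 ∨ s = -1) :
    IsCalJ a s fun μ => calJValue μ a s := by
  refine ⟨differentiable_calJValue a s, fun μ hμ ε hε => ?_⟩
  set K : ℂ := if 0 < a then 2 * Real.pi * (a : ℂ) ^ (μ - 1) / Complex.Gamma μ else 0 with hK
  set f : ℝ → ℂ := fun y => ((ε : ℂ) + Complex.I * y) ^ (-μ) *
    Complex.exp (a * ((ε : ℂ) + Complex.I * y)) with hf
  set c : ℂ := Complex.exp (-(Complex.I * Real.pi * s * μ / 2)) with hc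
  have hss : (s : ℂ) * s = 1 := by rcases hs with rfl | rfl <;> simp
  have hval : calJValue μ a s = c * K := by
    rw [calJValue, hK, hc, show Complex.I * s * μ * Real.pi / 2 = Complex.I * Real.pi * s * μ / 2 by
      ring]
    split_ifs <;> ring
  have hint : ∀ y : ℝ, ((y : ℂ) + Complex.I * s * ε) ^ (-μ) *
      Complex.exp (-Complex.I * s * a * ((y : ℂ) + Complex.I * s * ε)) = c * f (-s * y) := by
    intro y
    have hs2 : s * s = 1 := by exact_mod_cast hss
    rw [← branchPow_eq_cpow hs μ (by simp [← mul_assoc, hs2, hε]), branchPow, mul_assoc, hf]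
    have h1 : -Complex.I * s * ((y : ℂ) + Complex.I * s * ε) =
        (ε : ℂ) + Complex.I * ((-s * y : ℝ) : ℂ) := by
      push_cast
      linear_combination (ε : ℂ) * hss - s * s * ε * Complex.I_mul_I
    rw [show -Complex.I * s * a * ((y : ℂ) + Complex.I * s * ε) =
      a * (-Complex.I * s * ((y : ℂ) + Complex.I * s * ε)) by ring, h1]
  have hlim := (tendsto_integral_vertical_cpow_mul_exp hε hμ ha).const_mul c
  simp only [hint, intervalIntegral.integral_const_mul]
  rw [hval]
  rcases hs with rfl | rfl
  · refine (hlim.comp (tendsto_snd.prodMk tendsto_fst)).congr fun R => ?_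
    simp only [Function.comp_apply, neg_mul, one_mul, intervalIntegral.integral_comp_neg f, neg_neg]
    rfl
  · simp only [neg_neg, one_mul]
    exact hlim

/-- The analytic continuation is unique, so that `calJ`, chosen by `Classical.epsilon`, has a
definite value. -/
theorem TransverseCrossing.IsCalJ.eq {a s : ℝ} {f g : ℂ → ℂ} (hf : IsCalJ a s f)
    (hg : IsCalJ a s g) : f = g := by
  refine AnalyticOnNhd.eq_of_eventuallyEq (z₀ := 1) (fun z _ => hf.entire.analyticAt z)
    (fun z _ => hg.entire.analyticAt z) ?_
  filter_upwards [(isOpen_lt continuous_const Complex.continuous_re).mem_nhds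
    (show (0 : ℝ) < (1 : ℂ).re by simp)] with μ hμ
  exact tendsto_nhds_unique (hf.value μ hμ 1 one_pos) (hg.value μ hμ 1 one_pos)

theorem calJ_eq {a s : ℝ} (ha : a ≠ 0) (hs : s = 1 ∨ s = -1) (μ : ℂ) :
    calJ μ a s = calJValue μ a s :=
  congrFun ((Classical.epsilon_spec ⟨_, isCalJ_calJValue ha hs⟩ :
    IsCalJ a s (Classical.epsilon (IsCalJ a s))).eq (isCalJ_calJValue ha hs)) μ

theorem calJValue_ne_zero_iff {μ : ℂ} (hμ : ∀ n : ℕ, μ ≠ -n) {a : ℝ} (s : ℝ) :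
    calJValue μ a s ≠ 0 ↔ 0 < a := by
  rw [calJValue]
  split_ifs with h
  · have ha' : (a : ℂ) ≠ 0 := by exact_mod_cast h.ne'
    simp [h, Complex.Gamma_ne_zero hμ, Complex.cpow_eq_zero_iff, ha', Real.pi_ne_zero]
  · simp [h]

/-- Homogeneity of `𝒥` in its second argument. -/
theorem calJValue_mul {μ : ℂ} {r a : ℝ} (hr : 0 < r) (s : ℝ) :
    calJValue μ (r * a) s = (r : ℂ) ^ (μ - 1) * calJValue μ a s := by
  rw [calJValue, calJValue]
  by_cases ha : 0 < a
  · rw [if_pos ha, if_pos (mul_pos hr ha), Complex.ofReal_mul,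
      Complex.mul_cpow_ofReal_nonneg hr.le ha.le]
    ring
  · rw [if_neg ha, if_neg (by rwa [mul_pos_iff_of_pos_left hr]), mul_zero]

/-! ### Tent-shaped contours in the cut disc -/

/-- The tent-shaped path of height `δ` and slope `σ`, in the rotated coordinate `w = -i s z`: the
point `z = t + i s (δ - σ |t|)` becomes `δ - σ |t| - i s t`, and the cut `-i s [0, ∞)` becomes the
negative real axis. -/
noncomputable def tent (s δ σ t : ℝ) : ℂ := ((δ - σ * |t| : ℝ) : ℂ) - Complex.I * s * t

/-- The derivative of `tent s δ σ` away from its tip. -/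
noncomputable def tentDeriv (s σ t : ℝ) : ℂ :=
  (if 0 < t then -(σ : ℂ) else σ) - Complex.I * s

theorem hasDerivAt_tent (s δ σ : ℝ) {t : ℝ} (ht : t ≠ 0) :
    HasDerivAt (tent s δ σ) (tentDeriv s σ t) t := by
  have h1 : HasDerivAt (fun t : ℝ => Complex.I * s * t) (Complex.I * s) t := by
    simpa using (Complex.ofRealCLM.hasDerivAt (x := t)).const_mul (Complex.I * s)
  rcases lt_or_gt_of_ne ht with h | h
  · have h2 : HasDerivAt (fun t : ℝ => δ - σ * |t|) σ t := by
      simpa using ((hasDerivAt_abs_neg h).const_mul σ).const_sub δ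
    have := h2.ofReal_comp.sub h1
    rw [tentDeriv, if_neg h.not_gt]
    exact this
  · have h2 : HasDerivAt (fun t : ℝ => δ - σ * |t|) (-σ) t := by
      simpa using ((hasDerivAt_abs_pos h).const_mul σ).const_sub δ
    have := h2.ofReal_comp.sub h1
    rw [Complex.ofReal_neg] at this
    rw [tentDeriv, if_pos h]
    exact this

theorem continuous_tent (s δ σ : ℝ) : Continuous (tent s δ σ) := by
  unfold tent; fun_prop

theorem measurable_tentDeriv (s σ : ℝ) : Measurable (tentDeriv s σ) :=
  (Measurable.ite measurableSet_Ioi measurable_const measurable_const).sub measurable_const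

theorem norm_tentDeriv_le {s : ℝ} (hs : s = 1 ∨ s = -1) (σ t : ℝ) :
    ‖tentDeriv s σ t‖ ≤ |σ| + 1 := by
  refine (norm_sub_le _ _).trans ?_
  refine add_le_add (le_of_eq ?_) (le_of_eq ?_)
  · split_ifs <;> simp
  · rcases hs with rfl | rfl <;> simp

theorem tent_re (s δ σ t : ℝ) : (tent s δ σ t).re = δ - σ * |t| := by simp [tent]

theorem tent_im (s δ σ t : ℝ) : (tent s δ σ t).im = -(s * t) := by simp [tent]

theorem tent_mem_slitPlane {s : ℝ} (hs : s = 1 ∨ s = -1) {δ : ℝ} (hδ : 0 < δ) (σ t : ℝ) :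
    tent s δ σ t ∈ Complex.slitPlane := by
  rw [Complex.mem_slitPlane_iff, tent_re, tent_im]
  rcases eq_or_ne t 0 with rfl | ht
  · left; simpa using hδ
  · right; rcases hs with rfl | rfl <;> simpa using ht

theorem norm_tent_le {s : ℝ} (hs : s = 1 ∨ s = -1) (δ σ t : ℝ) :
    ‖tent s δ σ t‖ ≤ |δ| + (|σ| + 1) * |t| := by
  refine (Complex.norm_le_abs_re_add_abs_im _).trans ?_
  rw [tent_re, tent_im, abs_neg, abs_mul, show |s| = 1 by rcases hs with rfl | rfl <;> simp]
  have := abs_sub δ (σ * |t|)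
  rw [abs_mul, abs_abs] at this
  linarith

theorem tent_mul {r : ℝ} (hr : 0 ≤ r) (s δ σ t : ℝ) :
    tent s (r * δ) σ (r * t) = r * tent s δ σ t := by
  simp only [tent, abs_mul, abs_of_nonneg hr]; push_cast; ring

/-- A holomorphic function on a disc cut along the negative real axis has a primitive there: in
the coordinate `log z` the cut disc becomes a convex half strip. -/
theorem exists_primitive_cutDisc {f : ℂ → ℂ} {R : ℝ}
    (hf : DifferentiableOn ℂ f (Complex.slitPlane ∩ Metric.ball 0 R)) :
    ∃ Φ : ℂ → ℂ, ∀ z ∈ Complex.slitPlane ∩ Metric.ball (0 : ℂ) R, HasDerivAt Φ (f z) z := by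
  rcases le_or_gt R 0 with hR | hR
  · exact ⟨0, fun z hz => by simp [Metric.ball_eq_empty.2 hR] at hz⟩
  set S : Set ℂ := {u | u.re < Real.log R} ∩ ({u | -Real.pi < u.im} ∩ {u | u.im < Real.pi}) with hS
  have hSc : Convex ℝ S := (convex_halfSpace_re_lt _).inter
    ((convex_halfSpace_im_gt _).inter (convex_halfSpace_im_lt _))
  have hSo : IsOpen S := (isOpen_lt Complex.continuous_re continuous_const).inter
    ((isOpen_lt continuous_const Complex.continuous_im).inter
      (isOpen_lt Complex.continuous_im continuous_const))
  have hexp : ∀ u ∈ S, Complex.exp u ∈ Complex.slitPlane ∩ Metric.ball (0 : ℂ) R := by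
    rintro u ⟨h1, h2, h3⟩
    refine ⟨?_, ?_⟩
    · rw [Complex.mem_slitPlane_iff_arg]
      refine ⟨?_, Complex.exp_ne_zero _⟩
      have : (Complex.log (Complex.exp u)).im = u.im := by
        rw [Complex.log_exp h2 (le_of_lt h3)]
      rw [Complex.log_im] at this
      rw [this]
      exact ne_of_lt h3
    · rw [mem_ball_zero_iff, Complex.norm_exp]
      exact (Real.lt_log_iff_exp_lt hR).1 h1
  have hd : DifferentiableOn ℂ (fun u => f (Complex.exp u) * Complex.exp u) S := by
    refine DifferentiableOn.mul ?_ Complex.differentiable_exp.differentiableOn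
    exact hf.comp Complex.differentiable_exp.differentiableOn hexp
  obtain ⟨Ψ, hΨ⟩ := hSc.exists_forall_hasDerivWithinAt hd
  refine ⟨fun z => Ψ (Complex.log z), fun z hz => ?_⟩
  have hz0 := Complex.slitPlane_ne_zero hz.1
  have hlog : Complex.log z ∈ S := by
    have := Complex.mem_slitPlane_iff_arg.1 hz.1
    refine ⟨?_, ?_, ?_⟩
    · change (Complex.log z).re < _
      rw [Complex.log_re]
      exact Real.log_lt_log (norm_pos_iff.2 hz0) (by simpa using hz.2)
    · change _ < (Complex.log z).im
      rw [Complex.log_im]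
      exact Complex.neg_pi_lt_arg z
    · change (Complex.log z).im < _
      rw [Complex.log_im]
      exact lt_of_le_of_ne (Complex.arg_le_pi z) this.1
  have h := ((hΨ _ hlog).hasDerivAt (hSo.mem_nhds hlog)).comp z (Complex.hasDerivAt_log hz.1)
  convert! h using 1
  rw [Complex.exp_log hz0]
  field_simp

theorem intervalIntegrable_tent {f : ℂ → ℂ} {S : Set ℂ} (hf : ContinuousOn f S) {s : ℝ}
    (hs : s = 1 ∨ s = -1) {δ σ ρ : ℝ} (hρ : 0 ≤ ρ) (hm : ∀ t ∈ Icc (-ρ) ρ, tent s δ σ t ∈ S) :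
    IntervalIntegrable (fun t => f (tent s δ σ t) * tentDeriv s σ t) volume (-ρ) ρ := by
  rw [intervalIntegrable_iff_integrableOn_Icc_of_le (by linarith)]
  refine Integrable.mul_bdd (c := |σ| + 1) ?_ (measurable_tentDeriv s σ).aestronglyMeasurable
    (Eventually.of_forall fun t => norm_tentDeriv_le hs σ t)
  exact (hf.comp (continuous_tent s δ σ).continuousOn hm).integrableOn_compact isCompact_Icc

theorem integral_tent_eq_sub {f Φ : ℂ → ℂ} {S : Set ℂ} (hf : ContinuousOn f S)
    (hΦ : ∀ z ∈ S, HasDerivAt Φ (f z) z) {s : ℝ}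
    (hs : s = 1 ∨ s = -1) {δ σ ρ : ℝ} (hρ : 0 ≤ ρ) (hm : ∀ t ∈ Icc (-ρ) ρ, tent s δ σ t ∈ S) :
    ∫ t in (-ρ)..ρ, f (tent s δ σ t) * tentDeriv s σ t =
      Φ (tent s δ σ ρ) - Φ (tent s δ σ (-ρ)) := by
  refine integral_eq_of_hasDerivAt_off_countable_of_le (fun t => Φ (tent s δ σ t)) _
    (by linarith) (countable_singleton (0 : ℝ)) ?_ ?_ (intervalIntegrable_tent hf hs hρ hm)
  · intro t ht
    exact ((hΦ _ (hm t ht)).continuousAt.comp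
      (continuous_tent s δ σ).continuousAt).continuousWithinAt
  · rintro t ⟨ht, ht0⟩
    exact (hΦ _ (hm t (Ioo_subset_Icc_self ht))).comp t (hasDerivAt_tent s δ σ ht0)

/-- Cauchy's theorem for two tents with the same end points in the cut disc. -/
theorem integral_tent_eq_integral_tent {f : ℂ → ℂ} {R : ℝ}
    (hf : DifferentiableOn ℂ f (Complex.slitPlane ∩ Metric.ball 0 R)) {s : ℝ}
    (hs : s = 1 ∨ s = -1) {δ₁ σ₁ δ₂ σ₂ ρ : ℝ} (hρ : 0 ≤ ρ)
    (h₁ : ∀ t ∈ Icc (-ρ) ρ, tent s δ₁ σ₁ t ∈ Complex.slitPlane ∩ Metric.ball 0 R)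
    (h₂ : ∀ t ∈ Icc (-ρ) ρ, tent s δ₂ σ₂ t ∈ Complex.slitPlane ∩ Metric.ball 0 R)
    (hend : δ₁ - σ₁ * ρ = δ₂ - σ₂ * ρ) :
    ∫ t in (-ρ)..ρ, f (tent s δ₁ σ₁ t) * tentDeriv s σ₁ t =
      ∫ t in (-ρ)..ρ, f (tent s δ₂ σ₂ t) * tentDeriv s σ₂ t := by
  obtain ⟨Φ, hΦ⟩ := exists_primitive_cutDisc hf
  rw [integral_tent_eq_sub hf.continuousOn hΦ hs hρ h₁,
    integral_tent_eq_sub hf.continuousOn hΦ hs hρ h₂]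
  simp only [tent, abs_neg, abs_of_nonneg hρ, hend]

theorem integrable_exp_neg_mul_abs {c : ℝ} (hc : 0 < c) :
    Integrable fun t : ℝ => Real.exp (-c * |t|) := by
  rw [← integrableOn_univ, ← Iic_union_Ioi (a := (0 : ℝ))]
  refine IntegrableOn.union ?_ ?_
  · refine (integrableOn_exp_mul_Iic hc 0).congr_fun (fun t ht => ?_) measurableSet_Iic
    simp [abs_of_nonpos (show t ≤ 0 from ht)]
  · refine (integrableOn_exp_mul_Ioi (neg_lt_zero.2 hc) 0).congr_fun (fun t ht => ?_)
      measurableSet_Ioi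
    simp [abs_of_pos (show 0 < t from ht)]

/-- Powers grow more slowly than exponentials, in the form used for `exists_norm_tent_cpow_le`. -/
theorem one_add_mul_abs_rpow_le (M q : ℝ) (hM : 0 ≤ M) (hq : 0 ≤ q) {κ : ℝ} (hκ : 0 < κ) :
    ∃ C : ℝ, ∀ t : ℝ, (1 + M * |t|) ^ q ≤ C * Real.exp (κ * |t|) := by
  set θ : ℝ := min 1 (κ / (M * q + 1)) with hθ
  have hθ0 : 0 < θ := lt_min one_pos (by positivity)
  refine ⟨(θ⁻¹) ^ q, fun t => ?_⟩
  have h1 : 1 + M * |t| ≤ θ⁻¹ * Real.exp (θ * (M * |t|)) := by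
    rw [← div_eq_inv_mul, le_div_iff₀ hθ0]
    have := Real.add_one_le_exp (θ * (M * |t|))
    have : θ ≤ 1 := min_le_left _ _
    nlinarith
  calc (1 + M * |t|) ^ q ≤ (θ⁻¹ * Real.exp (θ * (M * |t|))) ^ q := by gcongr
    _ = (θ⁻¹) ^ q * Real.exp (θ * (M * |t|) * q) := by
        rw [Real.mul_rpow (by positivity) (by positivity), ← Real.exp_mul]
    _ ≤ _ := by
        refine mul_le_mul_of_nonneg_left (Real.exp_le_exp.2 ?_) (by positivity)
        have h2 : θ * (M * q + 1) ≤ κ := by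
          rw [← le_div_iff₀ (by positivity)]; exact min_le_right _ _
        have h3 : θ * (M * q) ≤ κ := by nlinarith
        calc θ * (M * |t|) * q = θ * (M * q) * |t| := by ring
          _ ≤ κ * |t| := by gcongr

/-- A tent of height one stays away from the singularity at the origin. -/
theorem inv_le_norm_tent {s : ℝ} (hs : s = 1 ∨ s = -1) {σ B : ℝ} (hσ : σ ∈ Icc 0 B) (t : ℝ) :
    (1 + B)⁻¹ ≤ ‖tent s 1 σ t‖ := by
  have hB : 0 ≤ B := hσ.1.trans hσ.2
  rcases le_total (1 + B)⁻¹ |t| with h | h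
  · refine h.trans ?_
    have := Complex.abs_im_le_norm (tent s 1 σ t)
    rw [tent_im, abs_neg, abs_mul, show |s| = 1 by rcases hs with rfl | rfl <;> simp, one_mul]
      at this
    exact this
  · refine le_trans ?_ ((le_abs_self _).trans (Complex.abs_re_le_norm (tent s 1 σ t)))
    rw [tent_re]
    have h1 : σ * |t| ≤ B * (1 + B)⁻¹ := mul_le_mul hσ.2 h (abs_nonneg _) hB
    have h2 : B * (1 + B)⁻¹ + (1 + B)⁻¹ = 1 := by field_simp; ring
    linarith

/-- Powers grow subexponentially along the tents of height one, uniformly for bounded slopes. -/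
theorem exists_norm_tent_cpow_le {s : ℝ} (hs : s = 1 ∨ s = -1) (μ : ℂ) {B : ℝ} (hB : 0 ≤ B)
    {κ : ℝ} (hκ : 0 < κ) :
    ∃ C : ℝ, 0 ≤ C ∧ ∀ σ ∈ Icc 0 B, ∀ t : ℝ,
      ‖tent s 1 σ t ^ (-μ)‖ ≤ C * Real.exp (κ * |t|) := by
  obtain ⟨C, hC⟩ := one_add_mul_abs_rpow_le (B + 1) |μ.re| (by linarith) (abs_nonneg _) hκ
  have hC0 : 0 ≤ C := by
    have := hC 0
    simp at this
    linarith
  refine ⟨((1 + B)⁻¹ ^ (-|μ.re|) * C) * Real.exp (Real.pi * |μ.im|), by positivity,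
    fun σ hσ t => ?_⟩
  refine (norm_cpow_neg_le _ _).trans ?_
  have hlow := inv_le_norm_tent hs hσ t
  have hinv : (1 + B)⁻¹ ≤ 1 := inv_le_one_of_one_le₀ (by linarith)
  have hpos : 0 < (1 + B)⁻¹ := by positivity
  have hup : ‖tent s 1 σ t‖ ≤ 1 + (B + 1) * |t| := by
    refine (norm_tent_le hs 1 σ t).trans ?_
    rw [abs_one, abs_of_nonneg hσ.1]
    have := hσ.2
    gcongr
  have h1 : ‖tent s 1 σ t‖ ^ (-μ.re) ≤ (1 + B)⁻¹ ^ (-|μ.re|) * (C * Real.exp (κ * |t|)) := by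
    have hlow1 : 1 ≤ (1 + B)⁻¹ ^ (-|μ.re|) :=
      Real.one_le_rpow_of_pos_of_le_one_of_nonpos hpos hinv (by simp)
    have hup1 : 1 ≤ C * Real.exp (κ * |t|) :=
      (Real.one_le_rpow (by nlinarith [abs_nonneg t]) (abs_nonneg _)).trans (hC t)
    rcases le_total 0 μ.re with h | h
    · calc ‖tent s 1 σ t‖ ^ (-μ.re) ≤ (1 + B)⁻¹ ^ (-μ.re) :=
            Real.rpow_le_rpow_of_nonpos hpos hlow (by linarith)
        _ = (1 + B)⁻¹ ^ (-|μ.re|) := by rw [abs_of_nonneg h]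
        _ ≤ _ := le_mul_of_one_le_right (by linarith) hup1
    · calc ‖tent s 1 σ t‖ ^ (-μ.re) ≤ (1 + (B + 1) * |t|) ^ (-μ.re) := by
            have : 0 ≤ -μ.re := by linarith
            gcongr
        _ = (1 + (B + 1) * |t|) ^ |μ.re| := by rw [abs_of_nonpos h]
        _ ≤ _ := (hC t).trans (le_mul_of_one_le_left (by linarith) hlow1)
  calc _ ≤ ((1 + B)⁻¹ ^ (-|μ.re|) * (C * Real.exp (κ * |t|))) * Real.exp (Real.pi * |μ.im|) := by
        gcongr
    _ = _ := by ring

/-! ### The Hankel integral along a tent -/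

theorem norm_exp_mul_tent (a s δ σ t : ℝ) :
    ‖Complex.exp (a * tent s δ σ t)‖ = Real.exp (a * (δ - σ * |t|)) := by
  rw [Complex.norm_exp, Complex.re_ofReal_mul, tent_re]

theorem differentiableAt_cpow_mul_exp (μ : ℂ) (a : ℝ) {z : ℂ} (hz : z ∈ Complex.slitPlane) :
    DifferentiableAt ℂ (fun w : ℂ => w ^ (-μ) * Complex.exp (a * w)) z := by
  fun_prop (disch := assumption)

theorem exists_norm_tent_hankel_le {s : ℝ} (hs : s = 1 ∨ s = -1) (μ : ℂ) {a σ : ℝ} (ha : 0 < a)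
    (hσ : 0 < σ) : ∃ C : ℝ, ∀ t : ℝ,
      ‖tent s 1 σ t ^ (-μ) * Complex.exp (a * tent s 1 σ t)‖ ≤
        C * Real.exp (-(a * σ / 2) * |t|) := by
  obtain ⟨C, hC0, hC⟩ := exists_norm_tent_cpow_le hs μ hσ.le (κ := a * σ / 2) (by positivity)
  refine ⟨C * Real.exp a, fun t => ?_⟩
  rw [norm_mul, norm_exp_mul_tent]
  calc _ ≤ (C * Real.exp (a * σ / 2 * |t|)) * Real.exp (a * (1 - σ * |t|)) := by
        gcongr
        exact hC σ ⟨hσ.le, le_rfl⟩ t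
    _ = (C * Real.exp a) * Real.exp (-(a * σ / 2) * |t|) := by
        rw [mul_assoc, mul_assoc, ← Real.exp_add, ← Real.exp_add]
        ring_nf

theorem integrable_tent_hankel {s : ℝ} (hs : s = 1 ∨ s = -1) (μ : ℂ) {a σ : ℝ} (ha : 0 < a)
    (hσ : 0 < σ) :
    Integrable fun t => tent s 1 σ t ^ (-μ) * Complex.exp (a * tent s 1 σ t) * tentDeriv s σ t := by
  obtain ⟨C, hC⟩ := exists_norm_tent_hankel_le hs μ ha hσ
  refine Integrable.mul_bdd (c := |σ| + 1) ?_ (measurable_tentDeriv s σ).aestronglyMeasurable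
    (Eventually.of_forall fun t => norm_tentDeriv_le hs σ t)
  refine ((integrable_exp_neg_mul_abs (c := a * σ / 2) (by positivity)).const_mul C).mono' ?_
    (Eventually.of_forall hC)
  refine Continuous.aestronglyMeasurable (continuous_iff_continuousAt.2 fun t => ?_)
  exact (differentiableAt_cpow_mul_exp μ a
    (tent_mem_slitPlane hs one_pos σ t)).continuousAt.comp (f := tent s 1 σ)
    (continuous_tent s 1 σ).continuousAt

theorem tendsto_integral_symm {f : ℝ → ℂ} (hf : Integrable f) :
    Tendsto (fun R : ℝ => ∫ t in (-R)..R, f t) atTop (𝓝 (∫ t, f t)) :=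
  intervalIntegral_tendsto_integral hf tendsto_neg_atTop_atBot tendsto_id

/-- Integration by parts along the tent raises `μ` by one. -/
theorem mul_integral_tent_hankel {s : ℝ} (hs : s = 1 ∨ s = -1) (μ : ℂ) {a σ : ℝ} (ha : 0 < a)
    (hσ : 0 < σ) :
    a * ∫ t, tent s 1 σ t ^ (-μ) * Complex.exp (a * tent s 1 σ t) * tentDeriv s σ t =
      μ * ∫ t, tent s 1 σ t ^ (-(μ + 1)) * Complex.exp (a * tent s 1 σ t) * tentDeriv s σ t := by
  have h0 := integrable_tent_hankel hs μ ha hσ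
  have h1 := integrable_tent_hankel hs (μ + 1) ha hσ
  rw [← sub_eq_zero, ← integral_const_mul, ← integral_const_mul,
    ← integral_sub (h0.const_mul _) (h1.const_mul _)]
  refine tendsto_nhds_unique (tendsto_integral_symm ((h0.const_mul _).sub (h1.const_mul _))) ?_
  set Φ : ℂ → ℂ := fun w => w ^ (-μ) * Complex.exp (a * w) with hΦ
  set f : ℂ → ℂ := fun w => a * (w ^ (-μ) * Complex.exp (a * w)) -
    μ * (w ^ (-(μ + 1)) * Complex.exp (a * w)) with hf
  have hd : ∀ z ∈ Complex.slitPlane, HasDerivAt Φ (f z) z := by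
    intro z hz
    have e1 := (hasDerivAt_id z).cpow_const (c := -μ) hz
    have e2 : HasDerivAt (fun w : ℂ => a * w) a z := by
      simpa using (hasDerivAt_id z).const_mul (a : ℂ)
    convert! e1.mul e2.cexp using 1
    simp only [hf, id, show -(μ + 1) = -μ - 1 by ring]
    ring
  have hfc : ContinuousOn f Complex.slitPlane := fun z hz =>
    ContinuousAt.continuousWithinAt (by fun_prop (disch := assumption))
  have hlim : ∀ e : ℝ, |e| = 1 → Tendsto (fun R : ℝ => Φ (tent s 1 σ (e * R))) atTop (𝓝 0) := by
    intro e he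
    obtain ⟨C, hC⟩ := exists_norm_tent_hankel_le hs μ ha hσ
    refine squeeze_zero_norm (fun R => hC (e * R)) ?_
    have h2 : Tendsto (fun R : ℝ => -(a * σ / 2) * |e * R|) atTop atBot := by
      simp only [abs_mul, he, one_mul]
      exact tendsto_abs_atTop_atTop.const_mul_atTop_of_neg (by nlinarith [mul_pos ha hσ])
    simpa using (Real.tendsto_exp_atBot.comp h2).const_mul C
  have h3 := (hlim 1 (by simp)).sub (hlim (-1) (by simp))
  rw [sub_zero] at h3
  refine h3.congr' ?_
  filter_upwards [eventually_ge_atTop 0] with R hR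
  have := integral_tent_eq_sub hfc hd hs hR (δ := 1) (σ := σ)
    (fun t _ => tent_mem_slitPlane hs one_pos σ t)
  rw [one_mul, neg_one_mul, ← this]
  congr 1
  funext t
  simp only [hf]
  ring

/-- For `Re μ > 0` the integral along the tent is the improper integral along the vertical line
through its tip: the horizontal segments that close the contour contribute nothing in the limit. -/
theorem integral_tent_hankel_of_re_pos {s : ℝ} (hs : s = 1 ∨ s = -1) {μ : ℂ} (hμ : 0 < μ.re)
    {a σ : ℝ} (ha : 0 < a) (hσ : 0 < σ) :
    ∫ t, tent s 1 σ t ^ (-μ) * Complex.exp (a * tent s 1 σ t) * tentDeriv s σ t =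
      -Complex.I * s * (2 * Real.pi * (a : ℂ) ^ (μ - 1) / Complex.Gamma μ) := by
  set f : ℂ → ℂ := fun w => w ^ (-μ) * Complex.exp (a * w) with hf
  set line : ℝ → ℂ := fun R => ∫ t in (-R)..R, f (tent s 1 0 t) * tentDeriv s 0 t with hline
  -- the limit along the line
  have hlimLine : Tendsto line atTop
      (𝓝 (-Complex.I * s * (2 * Real.pi * (a : ℂ) ^ (μ - 1) / Complex.Gamma μ))) := by
    have h := tendsto_integral_vertical_cpow_mul_exp one_pos hμ ha.ne'
    rw [if_pos ha] at h
    have h2 := (h.comp ((tendsto_id (x := (atTop : Filter ℝ))).prodMk tendsto_id)).const_mul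
      (-Complex.I * s)
    refine h2.congr fun R => ?_
    simp only [hline, Function.comp_apply, id]
    have e : ∀ t : ℝ, f (tent s 1 0 t) * tentDeriv s 0 t =
        -Complex.I * s * f (((1 : ℝ) : ℂ) + Complex.I * ((-s * t : ℝ) : ℂ)) := by
      intro t
      have : tent s 1 0 t = ((1 : ℝ) : ℂ) + Complex.I * ((-s * t : ℝ) : ℂ) := by
        simp [tent]; ring
      rw [this, tentDeriv]
      simp
      ring
    simp only [e, intervalIntegral.integral_const_mul]
    congr 1
    rcases hs with rfl | rfl
    · simp only [neg_mul, one_mul]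
      rw [intervalIntegral.integral_comp_neg
        (fun t : ℝ => f (((1 : ℝ) : ℂ) + Complex.I * (t : ℂ))), neg_neg]
    · simp only [neg_neg, one_mul]
      rfl
  have hfslit : ∀ z ∈ Complex.slitPlane, DifferentiableAt ℂ f z := fun z hz =>
    differentiableAt_cpow_mul_exp μ a hz
  -- the closing segments
  set K : ℝ → ℝ := fun R => R ^ (-μ.re) * (Real.exp (Real.pi * |μ.im|) * (Real.exp a / a)) with hK
  have hK0 : Tendsto K atTop (𝓝 0) := by
    simpa using (tendsto_rpow_neg_atTop hμ).mul_const
      (Real.exp (Real.pi * |μ.im|) * (Real.exp a / a))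
  have hseg : ∀ R > 0, ∀ e : ℝ, e = 1 ∨ e = -1 →
      ‖∫ x in (1 - σ * R)..1, f ((x : ℂ) + Complex.I * ((e * R : ℝ) : ℂ))‖ ≤ K R := by
    intro R hR e he
    have hle : 1 - σ * R ≤ 1 := by nlinarith [mul_pos hσ hR]
    have hb : ∀ x : ℝ, ‖f ((x : ℂ) + Complex.I * ((e * R : ℝ) : ℂ))‖ ≤
        R ^ (-μ.re) * Real.exp (Real.pi * |μ.im|) * Real.exp (a * x) := by
      intro x
      rw [hf, norm_mul, norm_exp_vertical]
      gcongr
      refine (norm_cpow_neg_le _ _).trans ?_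
      refine mul_le_mul_of_nonneg_right ?_ (Real.exp_pos _).le
      refine Real.rpow_le_rpow_of_nonpos hR ?_ (by linarith)
      have := Complex.abs_im_le_norm ((x : ℂ) + Complex.I * ((e * R : ℝ) : ℂ))
      have him : ((x : ℂ) + Complex.I * ((e * R : ℝ) : ℂ)).im = e * R := by
        rw [Complex.add_im, Complex.ofReal_im, Complex.I_mul_im, Complex.ofReal_re, zero_add]
      rw [him] at this
      rcases he with rfl | rfl <;> simpa [abs_of_pos hR] using this
    have hE : ∫ x in (1 - σ * R)..1, Real.exp (a * x) ≤ Real.exp a / a := by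
      rw [intervalIntegral.integral_comp_mul_left _ ha.ne', integral_exp, mul_one, smul_eq_mul,
        div_eq_inv_mul]
      gcongr
      linarith [Real.exp_pos (a * (1 - σ * R))]
    calc _ ≤ ∫ x in (1 - σ * R)..1,
          R ^ (-μ.re) * Real.exp (Real.pi * |μ.im|) * Real.exp (a * x) :=
          intervalIntegral.norm_integral_le_of_norm_le hle (Eventually.of_forall fun x _ => hb x)
            (Continuous.intervalIntegrable (by fun_prop) _ _)
      _ ≤ R ^ (-μ.re) * Real.exp (Real.pi * |μ.im|) * (Real.exp a / a) := by
          rw [intervalIntegral.integral_const_mul]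
          gcongr
      _ = K R := by rw [hK]; ring
  have hdiff : ∀ R > 0, ‖(∫ t in (-R)..R, f (tent s 1 σ t) * tentDeriv s σ t) - line R‖ ≤
      K R + K R := by
    intro R hR
    set R' : ℝ := 2 + (σ + 1) * R with hR'
    have hball : ∀ σ' ∈ Icc 0 σ, ∀ t ∈ Icc (-R) R,
        tent s 1 σ' t ∈ Complex.slitPlane ∩ Metric.ball (0 : ℂ) R' := by
      intro σ' hσ' t ht
      refine ⟨tent_mem_slitPlane hs one_pos _ _, ?_⟩
      rw [mem_ball_zero_iff]
      refine (norm_tent_le hs 1 σ' t).trans_lt ?_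
      have h1 : |t| ≤ R := abs_le.2 ht
      rw [abs_one, abs_of_nonneg hσ'.1]
      have : (σ' + 1) * |t| ≤ (σ + 1) * R :=
        mul_le_mul (by linarith [hσ'.2]) h1 (abs_nonneg _) (by linarith)
      linarith
    have hfD : DifferentiableOn ℂ f (Complex.slitPlane ∩ Metric.ball (0 : ℂ) R') :=
      fun z hz => (hfslit z hz.1).differentiableWithinAt
    obtain ⟨Φ, hΦ⟩ := exists_primitive_cutDisc hfD
    have hpt : ∀ e : ℝ, e = 1 ∨ e = -1 → ∀ x ∈ Icc (1 - σ * R) 1,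
        ((x : ℂ) + Complex.I * ((e * R : ℝ) : ℂ)) ∈
          Complex.slitPlane ∩ Metric.ball (0 : ℂ) R' := by
      intro e he x hx
      have him : ((x : ℂ) + Complex.I * ((e * R : ℝ) : ℂ)).im = e * R := by
        rw [Complex.add_im, Complex.ofReal_im, Complex.I_mul_im, Complex.ofReal_re, zero_add]
      have hre : ((x : ℂ) + Complex.I * ((e * R : ℝ) : ℂ)).re = x := by
        rw [Complex.add_re, Complex.ofReal_re, Complex.I_mul_re, Complex.ofReal_im, neg_zero,
          add_zero]
      refine ⟨?_, ?_⟩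
      · rw [Complex.mem_slitPlane_iff, him]
        right
        rcases he with rfl | rfl <;> simp [hR.ne']
      · rw [mem_ball_zero_iff]
        refine (Complex.norm_le_abs_re_add_abs_im _).trans_lt ?_
        rw [hre, him]
        have h1 : |x| ≤ 1 + σ * R := by
          rw [abs_le]; constructor <;> nlinarith [hx.1, hx.2, mul_pos hσ hR]
        have h2 : |e * R| = R := by rcases he with rfl | rfl <;> simp [abs_of_pos hR]
        rw [h2]
        nlinarith
    have hsegΦ : ∀ e : ℝ, e = 1 ∨ e = -1 →
        ∫ x in (1 - σ * R)..1, f ((x : ℂ) + Complex.I * ((e * R : ℝ) : ℂ)) =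
          Φ (((1 : ℝ) : ℂ) + Complex.I * ((e * R : ℝ) : ℂ)) -
            Φ (((1 - σ * R : ℝ) : ℂ) + Complex.I * ((e * R : ℝ) : ℂ)) := by
      intro e he
      have hle : 1 - σ * R ≤ 1 := by nlinarith [mul_pos hσ hR]
      have hpath : ∀ x : ℝ, HasDerivAt (fun x : ℝ => (x : ℂ) + Complex.I * ((e * R : ℝ) : ℂ)) 1 x :=
        fun x => ((hasDerivAt_id x).ofReal_comp.congr_deriv Complex.ofReal_one).add_const _
      refine intervalIntegral.integral_eq_sub_of_hasDerivAt
        (f := fun x : ℝ => Φ ((x : ℂ) + Complex.I * ((e * R : ℝ) : ℂ))) (fun x hx => ?_) ?_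
      · rw [uIcc_of_le hle] at hx
        simpa using! (hΦ _ (hpt e he x hx)).comp x (hpath x)
      · refine ContinuousOn.intervalIntegrable ?_
        rw [uIcc_of_le hle]
        intro x hx
        exact ((hfslit _ (hpt e he x hx).1).continuousAt.comp (f := fun x : ℝ =>
          (x : ℂ) + Complex.I * ((e * R : ℝ) : ℂ)) (hpath x).continuousAt).continuousWithinAt
    have hneg : -s = 1 ∨ -s = -1 := by rcases hs with rfl | rfl <;> simp
    have e1 : ∀ σ', tent s 1 σ' R =
        ((1 - σ' * R : ℝ) : ℂ) + Complex.I * ((-s * R : ℝ) : ℂ) := fun σ' => by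
      simp only [tent, abs_of_pos hR]; push_cast; ring
    have e2 : ∀ σ', tent s 1 σ' (-R) =
        ((1 - σ' * R : ℝ) : ℂ) + Complex.I * ((s * R : ℝ) : ℂ) := fun σ' => by
      simp only [tent, abs_neg, abs_of_pos hR]; push_cast; ring
    have hEq : (∫ t in (-R)..R, f (tent s 1 σ t) * tentDeriv s σ t) - line R =
        (∫ x in (1 - σ * R)..1, f ((x : ℂ) + Complex.I * ((s * R : ℝ) : ℂ))) -
          ∫ x in (1 - σ * R)..1, f ((x : ℂ) + Complex.I * ((-s * R : ℝ) : ℂ)) := by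
      simp only [hline]
      rw [integral_tent_eq_sub hfD.continuousOn hΦ hs hR.le (hball σ ⟨hσ.le, le_rfl⟩),
        integral_tent_eq_sub hfD.continuousOn hΦ hs hR.le (hball 0 ⟨le_rfl, hσ.le⟩),
        hsegΦ s hs, hsegΦ (-s) hneg, e1, e1, e2, e2]
      simp only [zero_mul, sub_zero]
      ring
    rw [hEq]
    exact (norm_sub_le _ _).trans (add_le_add (hseg R hR s hs) (hseg R hR (-s) hneg))
  refine tendsto_nhds_unique (tendsto_integral_symm (integrable_tent_hankel hs μ ha hσ)) ?_
  have hz : Tendsto (fun R => (∫ t in (-R)..R, f (tent s 1 σ t) * tentDeriv s σ t) - line R)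
      atTop (𝓝 0) := by
    refine squeeze_zero_norm' ?_ (by simpa using hK0.add hK0)
    filter_upwards [eventually_gt_atTop 0] with R hR using hdiff R hR
  simpa using hz.add hlimLine

/-- Hankel's formula: the integral along the tent converges absolutely for every `μ`, and the
recurrence in `μ` carries the value from the half plane `Re μ > 0` to all of `ℂ`. -/
theorem integral_tent_hankel {s : ℝ} (hs : s = 1 ∨ s = -1) (μ : ℂ)
    {a σ : ℝ} (ha : 0 < a) (hσ : 0 < σ) :
    ∫ t, tent s 1 σ t ^ (-μ) * Complex.exp (a * tent s 1 σ t) * tentDeriv s σ t =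
      -Complex.I * s * (2 * Real.pi * (a : ℂ) ^ (μ - 1) / Complex.Gamma μ) := by
  have ha' : (a : ℂ) ≠ 0 := by exact_mod_cast ha.ne'
  suffices H : ∀ n : ℕ, ∀ μ : ℂ, -(n : ℝ) < μ.re →
      ∫ t, tent s 1 σ t ^ (-μ) * Complex.exp (a * tent s 1 σ t) * tentDeriv s σ t =
        -Complex.I * s * (2 * Real.pi * (a : ℂ) ^ (μ - 1) / Complex.Gamma μ) by
    obtain ⟨n, hn⟩ := exists_nat_gt (-μ.re)
    exact H n μ (by linarith)
  intro n
  induction n with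
  | zero => exact fun μ hμ => integral_tent_hankel_of_re_pos hs (by simpa using hμ) ha hσ
  | succ n ih =>
    intro μ hμ
    have h1 := ih (μ + 1) (by
      push_cast at hμ
      simp only [Complex.add_re, Complex.one_re]
      linarith)
    have h2 := mul_integral_tent_hankel hs μ ha hσ
    rw [h1] at h2
    refine mul_left_cancel₀ ha' (h2.trans ?_)
    rcases eq_or_ne μ 0 with rfl | hμ0
    · simp
    · linear_combination (-Complex.I * s) * mul_div_Gamma_add_one hμ0 ha.ne'

/-! ### Holomorphic functions of two variables are analytic -/

/-- Integration against a finite measure on a compact space, as a continuous functional. -/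
noncomputable def integralCLM {K : Type*} [TopologicalSpace K] [CompactSpace K]
    [MeasurableSpace K] [OpensMeasurableSpace K] (ν : Measure K) [IsFiniteMeasure ν] :
    C(K, ℂ) →L[ℂ] ℂ :=
  LinearMap.mkContinuous
    { toFun := fun h => ∫ p, h p ∂ν
      map_add' := fun f g => by
        have hi : ∀ h : C(K, ℂ), Integrable h ν := fun h =>
          (BoundedContinuousFunction.mkOfCompact h).integrable ν
        simpa using integral_add (hi f) (hi g)
      map_smul' := fun c f => by simpa using integral_const_mul c f }
    (ν.real univ) (fun h => by
      have := norm_integral_le_of_norm_le_const (μ := ν)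
        (Eventually.of_forall fun p => h.norm_coe_le_norm p)
      simpa [mul_comm] using this)

theorem integralCLM_apply {K : Type*} [TopologicalSpace K] [CompactSpace K]
    [MeasurableSpace K] [OpensMeasurableSpace K] (ν : Measure K) [IsFiniteMeasure ν] (h : C(K, ℂ)) :
    integralCLM ν h = ∫ p, h p ∂ν := rfl

theorem mem_resolventSet_of_forall_ne {K : Type*} [TopologicalSpace K] [CompactSpace K]
    (a : C(K, ℂ)) {z : ℂ} (h : ∀ p, z ≠ a p) : z ∈ resolventSet ℂ a := by
  rw [spectrum.mem_resolventSet_iff, ContinuousMap.isUnit_iff_forall_ne_zero]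
  intro p
  simpa [sub_eq_zero] using h p

theorem resolvent_apply {K : Type*} [TopologicalSpace K] [CompactSpace K] (a : C(K, ℂ))
    {z : ℂ} (h : ∀ p, z ≠ a p) (p : K) : resolvent a z p = (z - a p)⁻¹ := by
  have hu := mem_resolventSet_of_forall_ne a h
  rw [spectrum.mem_resolventSet_iff] at hu
  have h1 : (algebraMap ℂ C(K, ℂ) z - a) * resolvent a z = 1 := Ring.mul_inverse_cancel _ hu
  have h2 := DFunLike.congr_fun h1 p
  rw [ContinuousMap.mul_apply, ContinuousMap.sub_apply, ContinuousMap.one_apply] at h2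
  exact eq_inv_of_mul_eq_one_right h2

theorem analyticAt_resolvent {K : Type*} [TopologicalSpace K] [CompactSpace K] (a : C(K, ℂ))
    {z : ℂ} (h : ∀ p, z ≠ a p) : AnalyticAt ℂ (resolvent a) z := by
  have ho : IsOpen (resolventSet ℂ a) := spectrum.isOpen_resolventSet a
  refine DifferentiableOn.analyticAt (s := resolventSet ℂ a) (fun w hw => ?_)
    (ho.mem_nhds (mem_resolventSet_of_forall_ne a h))
  exact (spectrum.hasDerivAt_resolvent_const_left hw).differentiableAt.differentiableWithinAt

/-- Lebesgue measure on the interval `[0, 2π]` that parametrises a circle. -/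
noncomputable def angleMeasure : Measure (Icc (0 : ℝ) (2 * Real.pi)) :=
  Measure.comap Subtype.val volume

instance : IsFiniteMeasure angleMeasure := by
  refine ⟨?_⟩
  rw [angleMeasure, comap_subtype_coe_apply measurableSet_Icc, image_univ,
    Subtype.range_coe]
  exact measure_Icc_lt_top

theorem circleIntegral_eq_integral_Icc (f : ℂ → ℂ) (c : ℂ) :
    ∮ z in C(c, 1), f z = ∫ θ : Icc (0 : ℝ) (2 * Real.pi),
      deriv (circleMap c 1) θ * f (circleMap c 1 θ) ∂angleMeasure := by
  rw [circleIntegral, intervalIntegral.integral_of_le (by positivity),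
    ← integral_Icc_eq_integral_Ioc, ← integral_subtype_comap measurableSet_Icc]
  rfl

/-- Osgood's lemma in two variables. The Cauchy integral over a torus represents `g` as a
continuous functional of the product of two resolvents in the Banach algebra of continuous
functions on the torus. -/
theorem analyticAt_of_differentiable {g : ℂ × ℂ → ℂ} (hg : Differentiable ℂ g) (c : ℂ × ℂ) :
    AnalyticAt ℂ g c := by
  set K := Icc (0 : ℝ) (2 * Real.pi) with hK
  set γ₁ : ℝ → ℂ := circleMap c.1 1 with hγ₁
  set γ₂ : ℝ → ℂ := circleMap c.2 1 with hγ₂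
  have hc₁ : Continuous γ₁ := continuous_circleMap _ _
  have hc₂ : Continuous γ₂ := continuous_circleMap _ _
  have hd : ∀ c : ℂ, Continuous (deriv (circleMap c 1)) := fun c => by
    have : deriv (circleMap c 1) = fun θ => circleMap 0 1 θ * Complex.I := by
      funext θ; exact deriv_circleMap c 1 θ
    rw [this]; fun_prop
  set a₁ : C(K × K, ℂ) := ⟨fun p => γ₁ p.1, by fun_prop⟩ with ha₁
  set a₂ : C(K × K, ℂ) := ⟨fun p => γ₂ p.2, by fun_prop⟩ with ha₂
  have hgc := hg.continuous
  have hd₁ : Continuous (deriv γ₁) := hd _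
  have hd₂ : Continuous (deriv γ₂) := hd _
  set G : C(K × K, ℂ) := ⟨fun p => deriv γ₁ p.1 * deriv γ₂ p.2 * g (γ₁ p.1, γ₂ p.2), by
    fun_prop⟩ with hG
  have hne : ∀ (c z : ℂ), z ∈ Metric.ball c 1 → ∀ θ : ℝ, z ≠ circleMap c 1 θ := by
    intro c z hz θ h
    rw [h, Metric.mem_ball, dist_eq_norm] at hz
    simp at hz
  have hr₁ : ∀ z : ℂ × ℂ, z ∈ Metric.ball c 1 → ∀ p, z.1 ≠ a₁ p := fun z hz p =>
    hne _ _ (by rw [← ball_prod_same] at hz; exact hz.1) _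
  have hr₂ : ∀ z : ℂ × ℂ, z ∈ Metric.ball c 1 → ∀ p, z.2 ≠ a₂ p := fun z hz p =>
    hne _ _ (by rw [← ball_prod_same] at hz; exact hz.2) _
  have hrep : ∀ z ∈ Metric.ball c 1, g z = (2 * Real.pi * Complex.I)⁻¹ *
      ((2 * Real.pi * Complex.I)⁻¹ * integralCLM (angleMeasure.prod angleMeasure)
        (G * resolvent a₁ z.1 * resolvent a₂ z.2)) := by
    intro z hz
    have hz' := hz
    rw [← ball_prod_same] at hz'
    have h2πI : (2 * Real.pi * Complex.I : ℂ) ≠ 0 := Complex.two_pi_I_ne_zero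
    have hin : ∀ v : ℂ, (∮ w in C(c.2, 1), (w - z.2)⁻¹ • g (v, w)) =
        (2 * Real.pi * Complex.I) • g (v, z.2) := fun v =>
      DifferentiableOn.circleIntegral_sub_inv_smul
        (Differentiable.differentiableOn (by fun_prop)) hz'.2
    have hout : (∮ v in C(c.1, 1), (v - z.1)⁻¹ • g (v, z.2)) =
        (2 * Real.pi * Complex.I) • g (z.1, z.2) :=
      DifferentiableOn.circleIntegral_sub_inv_smul (f := fun v => g (v, z.2))
        (Differentiable.differentiableOn (by fun_prop)) hz'.1
    have hi : Integrable (fun p => (G * resolvent a₁ z.1 * resolvent a₂ z.2) p)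
        (angleMeasure.prod angleMeasure) :=
      (BoundedContinuousFunction.mkOfCompact (G * resolvent a₁ z.1 * resolvent a₂ z.2)).integrable _
    rw [integralCLM_apply, integral_prod _ hi]
    have e1 : ∀ θ : K,
        ∫ τ : K, (G * resolvent a₁ z.1 * resolvent a₂ z.2) (θ, τ) ∂angleMeasure =
        deriv γ₁ θ * ((γ₁ θ - z.1)⁻¹ * ((2 * Real.pi * Complex.I) * g (γ₁ θ, z.2))) := by
      intro θ
      rw [← smul_eq_mul (2 * Real.pi * Complex.I), ← hin, circleIntegral_eq_integral_Icc,
        ← mul_assoc, ← integral_const_mul]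
      congr 1
      funext τ
      rw [ContinuousMap.mul_apply, ContinuousMap.mul_apply, resolvent_apply a₁ (hr₁ z hz),
        resolvent_apply a₂ (hr₂ z hz), ← neg_sub z.1, ← neg_sub z.2 (circleMap c.2 1 τ),
        inv_neg, inv_neg]
      simp only [hG, ha₁, ha₂, ContinuousMap.coe_mk, smul_eq_mul]
      ring
    simp only [e1]
    have e2 : ∫ θ : K, deriv γ₁ θ * ((γ₁ θ - z.1)⁻¹ *
        ((2 * Real.pi * Complex.I) * g (γ₁ θ, z.2))) ∂angleMeasure =
        (2 * Real.pi * Complex.I) * ((2 * Real.pi * Complex.I) * g z) := by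
      have := hout
      rw [circleIntegral_eq_integral_Icc, smul_eq_mul] at this
      rw [show g z = g (z.1, z.2) from rfl, ← this, ← integral_const_mul]
      congr 1
      funext θ
      simp only [smul_eq_mul]
      ring
    rw [e2]
    field_simp
  have hcb : c ∈ Metric.ball c 1 := Metric.mem_ball_self one_pos
  have han : AnalyticAt ℂ (fun z : ℂ × ℂ => (2 * Real.pi * Complex.I)⁻¹ *
      ((2 * Real.pi * Complex.I)⁻¹ * integralCLM (angleMeasure.prod angleMeasure)
        (G * resolvent a₁ z.1 * resolvent a₂ z.2))) c := by
    refine analyticAt_const.mul (analyticAt_const.mul ?_)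
    refine ((integralCLM (angleMeasure.prod angleMeasure)).analyticAt _).comp ?_
    refine (analyticAt_const.mul ?_).mul ?_
    · exact (analyticAt_resolvent a₁ (hr₁ c hcb)).comp analyticAt_fst
    · exact (analyticAt_resolvent a₂ (hr₂ c hcb)).comp analyticAt_snd
  refine han.congr ?_
  filter_upwards [Metric.ball_mem_nhds c one_pos] with z hz
  exact (hrep z hz).symm

/-! ### The local change of variables -/

/-- The linear form `a z₁ + b z₂` on `ℂ²`. -/
noncomputable def linForm (a b : ℂ) : ℂ × ℂ →L[ℂ] ℂ :=
  a • ContinuousLinearMap.fst ℂ ℂ ℂ + b • ContinuousLinearMap.snd ℂ ℂ ℂ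

@[simp] theorem linForm_apply (a b : ℂ) (z : ℂ × ℂ) : linForm a b z = a * z.1 + b * z.2 := by
  simp [linForm]

theorem cplx_sub_toC (t y : ℝ × ℝ) : cplx t y - toC t = (Complex.I * y.1, Complex.I * y.2) := by
  simp [cplx, toC]

theorem norm_I_mul_pair (y : ℝ × ℝ) : ‖((Complex.I * y.1, Complex.I * y.2) : ℂ × ℂ)‖ = ‖y‖ := by
  simp [Prod.norm_def]

/-- If `P` is real at real points and strictly differentiable at a real point, with derivative
`a z₁ + b z₂`, then its imaginary part at `t + i y` is `a y₁ + b y₂` up to an arbitrarily small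
multiple of `‖y‖`. -/
theorem abs_im_sub_le_of_hasStrictFDerivAt {P : ℂ × ℂ → ℂ} {a b : ℝ} {ξ : ℝ × ℝ}
    (hP : HasStrictFDerivAt P (linForm a b) (toC ξ))
    (hreal : ∀ᶠ t in 𝓝 ξ, (P (toC t)).im = 0) {c : ℝ} (hc : 0 < c) :
    ∃ R > 0, ∀ t y : ℝ × ℝ, ‖t - ξ‖ < R → ‖y‖ < R →
      |(P (cplx t y)).im - (a * y.1 + b * y.2)| ≤ c * ‖y‖ := by
  have h := hP.isLittleO.def hc
  obtain ⟨R₁, hR₁, h1⟩ := Metric.eventually_nhds_iff_ball.1 h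
  obtain ⟨R₂, hR₂, h2⟩ := Metric.eventually_nhds_iff_ball.1 hreal
  refine ⟨min (R₁ / 2) R₂, by positivity, fun t y ht hy => ?_⟩
  have hnt : ‖toC t - toC ξ‖ = ‖t - ξ‖ := by
    simp [toC, Prod.norm_def, ← Complex.ofReal_sub]
  have hball : (cplx t y, toC t) ∈ Metric.ball (toC ξ, toC ξ) R₁ := by
    have a1 : ‖t - ξ‖ < R₁ / 2 := ht.trans_le (min_le_left _ _)
    have a2 : ‖y‖ < R₁ / 2 := hy.trans_le (min_le_left _ _)
    rw [mem_ball_iff_norm, Prod.norm_def, max_lt_iff]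
    refine ⟨?_, by simp only [Prod.snd_sub, hnt]; linarith⟩
    have : cplx t y - toC ξ = (toC t - toC ξ) + (Complex.I * y.1, Complex.I * y.2) := by
      rw [← cplx_sub_toC]; abel
    simp only [Prod.fst_sub, this]
    refine (norm_add_le _ _).trans_lt ?_
    rw [hnt, norm_I_mul_pair]
    linarith
  have h3 := h1 _ hball
  have hreal : (P (toC t)).im = 0 :=
    h2 t (by rw [mem_ball_iff_norm]; exact ht.trans_le (min_le_right _ _))
  simp only [cplx_sub_toC, norm_I_mul_pair] at h3
  refine le_trans (le_of_eq ?_) ((Complex.abs_im_le_norm _).trans h3)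
  congr 1
  simp [hreal]

theorem im_deriv_eq_zero {f : ℂ → ℂ} {x : ℝ} (hf : DifferentiableAt ℂ f x)
    (h : ∀ y : ℝ, (f y).im = 0) : (deriv f (x : ℂ)).im = 0 := by
  have h1 := (Complex.imCLM.hasFDerivAt (x := f x)).comp_hasDerivAt x hf.hasDerivAt.comp_ofReal
  have h2 : (Complex.imCLM ∘ fun y : ℝ => f y) = fun _ => (0 : ℝ) := by
    funext y; simpa using h y
  rw [h2] at h1
  simpa using h1.unique (hasDerivAt_const x (0 : ℝ))

theorem hasStrictFDerivAt_of_realProperty {g : ℂ × ℂ → ℂ} (hg : RealProperty g) (ξ : ℝ × ℝ) :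
    HasStrictFDerivAt g (linForm (coefA g ξ) (coefB g ξ)) (toC ξ) := by
  have h := (analyticAt_of_differentiable hg.entire (toC ξ)).hasStrictFDerivAt
  have hfd := h.hasFDerivAt
  have h1 : HasDerivAt (fun z : ℂ => g (z, (ξ.2 : ℂ))) (fderiv ℂ g (toC ξ) (1, 0)) (ξ.1 : ℂ) :=
    HasFDerivAt.comp_hasDerivAt (f := fun z : ℂ => (z, (ξ.2 : ℂ))) (ξ.1 : ℂ) hfd
      ((hasDerivAt_id _).prodMk (hasDerivAt_const _ _))
  have h2 : HasDerivAt (fun z : ℂ => g ((ξ.1 : ℂ), z)) (fderiv ℂ g (toC ξ) (0, 1)) (ξ.2 : ℂ) :=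
    HasFDerivAt.comp_hasDerivAt (f := fun z : ℂ => ((ξ.1 : ℂ), z)) (ξ.2 : ℂ) hfd
      ((hasDerivAt_const _ _).prodMk (hasDerivAt_id _))
  have i1 := im_deriv_eq_zero (x := ξ.1) h1.differentiableAt fun y => hg.real (y, ξ.2)
  have i2 := im_deriv_eq_zero (x := ξ.2) h2.differentiableAt fun y => hg.real (ξ.1, y)
  have e1 : ((coefA g ξ : ℝ) : ℂ) = fderiv ℂ g (toC ξ) (1, 0) := by
    rw [← h1.deriv]; exact Complex.ext (by simp [coefA]) (by simp [i1])
  have e2 : ((coefB g ξ : ℝ) : ℂ) = fderiv ℂ g (toC ξ) (0, 1) := by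
    rw [← h2.deriv]; exact Complex.ext (by simp [coefB]) (by simp [i2])
  have : linForm (coefA g ξ) (coefB g ξ) = fderiv ℂ g (toC ξ) := by
    ext <;> simp [e1, e2]
  rwa [this]

/-- Schwarz reflection: a function with the real property commutes with conjugation. -/
theorem RealProperty.map_star {g : ℂ × ℂ → ℂ} (hg : RealProperty g) (z : ℂ × ℂ) :
    g (star z) = star (g z) := by
  -- one-variable reflection for an entire function that is reflected on the real line
  have key : ∀ f h : ℂ → ℂ, Differentiable ℂ f → Differentiable ℂ h →
      (∀ y : ℝ, h y = star (f y)) → ∀ w, h (star w) = star (f w) := by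
    intro f h hf hh hfh w
    have hd : Differentiable ℂ fun w => star (f (star w)) := fun w => by
      have h1 := (hf (star w)).star_conj
      have e : (starRingEnd ℂ) (star w) = w := star_star w
      rw [e] at h1
      exact h1
    have heq : (fun w => star (f (star w))) = h := by
      refine AnalyticOnNhd.eq_of_frequently_eq (z₀ := 0) (fun z _ => hd.analyticAt z)
        (fun z _ => hh.analyticAt z) ?_
      have hu : Tendsto (fun n : ℕ => ((1 / ((n : ℝ) + 1) : ℝ) : ℂ)) atTop (𝓝[≠] 0) := by
        refine tendsto_nhdsWithin_iff.2 ⟨?_, Eventually.of_forall fun n => ?_⟩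
        · have h1 : Tendsto (fun n : ℕ => ((1 / ((n : ℝ) + 1) : ℝ) : ℂ)) atTop (𝓝 ((0 : ℝ) : ℂ)) :=
            (Complex.continuous_ofReal.tendsto 0).comp
              (tendsto_one_div_add_atTop_nhds_zero_nat (𝕜 := ℝ))
          rwa [Complex.ofReal_zero] at h1
        · simp only [mem_compl_iff, mem_singleton_iff, Complex.ofReal_eq_zero]
          positivity
      refine hu.frequently (Frequently.of_forall fun n => ?_)
      rw [hfh]
      congr 2
      exact Complex.conj_ofReal _
    rw [← heq]
    simp
  have hreal : ∀ x y : ℝ, g ((x : ℂ), (y : ℂ)) = star (g ((x : ℂ), (y : ℂ))) := fun x y =>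
    (Complex.conj_eq_iff_im.2 (hg.real (x, y))).symm
  have hge := hg.entire
  have h1 : ∀ (y : ℝ) (w : ℂ), g (star w, (y : ℂ)) = star (g (w, (y : ℂ))) := fun y =>
    key (fun w => g (w, (y : ℂ))) (fun w => g (w, (y : ℂ))) (by fun_prop) (by fun_prop)
      fun x => hreal x y
  exact key (fun w => g (z.1, w)) (fun w => g (star z.1, w)) (by fun_prop) (by fun_prop)
    (fun y => h1 y z.1) z.2

/-- The map `(a₁ z₁ + b₁ z₂, a₂ z₁ + b₂ z₂)` of nonzero determinant, with its inverse. -/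
noncomputable def crossEquiv (a₁ b₁ a₂ b₂ : ℂ) (h : a₁ * b₂ - a₂ * b₁ ≠ 0) :
    (ℂ × ℂ) ≃L[ℂ] (ℂ × ℂ) :=
  ContinuousLinearEquiv.equivOfInverse ((linForm a₁ b₁).prod (linForm a₂ b₂))
    ((linForm (b₂ / (a₁ * b₂ - a₂ * b₁)) (-b₁ / (a₁ * b₂ - a₂ * b₁))).prod
      (linForm (-a₂ / (a₁ * b₂ - a₂ * b₁)) (a₁ / (a₁ * b₂ - a₂ * b₁))))
    (fun z => by
      refine Prod.ext ?_ ?_ <;> simp only [ContinuousLinearMap.prod_apply, linForm_apply]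
      · refine Eq.trans ?_ (mul_div_cancel_left₀ z.1 h)
        ring
      · refine Eq.trans ?_ (mul_div_cancel_left₀ z.2 h)
        ring)
    (fun z => by
      refine Prod.ext ?_ ?_ <;> simp only [ContinuousLinearMap.prod_apply, linForm_apply]
      · refine Eq.trans ?_ (mul_div_cancel_left₀ z.1 h)
        ring
      · refine Eq.trans ?_ (mul_div_cancel_left₀ z.2 h)
        ring)

theorem crossEquiv_symm_apply {a₁ b₁ a₂ b₂ : ℂ} (h : a₁ * b₂ - a₂ * b₁ ≠ 0) (z : ℂ × ℂ) :
    (crossEquiv a₁ b₁ a₂ b₂ h).symm z =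
      (b₂ / (a₁ * b₂ - a₂ * b₁) * z.1 + -b₁ / (a₁ * b₂ - a₂ * b₁) * z.2,
        -a₂ / (a₁ * b₂ - a₂ * b₁) * z.1 + a₁ / (a₁ * b₂ - a₂ * b₁) * z.2) := by
  change ((linForm _ _).prod (linForm _ _)) z = _
  simp

section LocalInverse

variable {g₁ g₂ : ℂ × ℂ → ℂ} {ξ : ℝ × ℝ}

theorem crossDet_cast_ne_zero (hΔ : 0 < crossDet g₁ g₂ ξ) :
    (coefA g₁ ξ : ℂ) * coefB g₂ ξ - coefA g₂ ξ * coefB g₁ ξ ≠ 0 := by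
  have := hΔ.ne'
  rw [crossDet] at this
  exact_mod_cast this

theorem hasStrictFDerivAt_cross (hg₁ : RealProperty g₁) (hg₂ : RealProperty g₂)
    (hΔ : 0 < crossDet g₁ g₂ ξ) :
    HasStrictFDerivAt (fun z => (g₁ z, g₂ z))
      (crossEquiv (coefA g₁ ξ) (coefB g₁ ξ) (coefA g₂ ξ) (coefB g₂ ξ)
        (crossDet_cast_ne_zero hΔ) : (ℂ × ℂ) →L[ℂ] (ℂ × ℂ)) (toC ξ) :=
  (hasStrictFDerivAt_of_realProperty hg₁ ξ).prodMk (hasStrictFDerivAt_of_realProperty hg₂ ξ)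

theorem exists_isLocalInverse (hg₁ : RealProperty g₁) (hg₂ : RealProperty g₂)
    (hξ₁ : g₁ (toC ξ) = 0) (hξ₂ : g₂ (toC ξ) = 0) (hΔ : 0 < crossDet g₁ g₂ ξ) :
    ∃ φ, IsLocalInverse g₁ g₂ ξ φ := by
  have h := hasStrictFDerivAt_cross hg₁ hg₂ hΔ
  set e := h.toOpenPartialHomeomorph (fun z => (g₁ z, g₂ z)) with he
  have hsrc : toC ξ ∈ e.source := h.mem_toOpenPartialHomeomorph_source
  have hval : e (toC ξ) = 0 := by
    rw [he, HasStrictFDerivAt.toOpenPartialHomeomorph_coe]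
    simp [hξ₁, hξ₂]
  have htgt : (0 : ℂ × ℂ) ∈ e.target := hval ▸ e.map_source hsrc
  refine ⟨e.symm, ?_, ?_, ?_⟩
  · rw [← hval]
    refine e.analyticAt_symm' hsrc ?_ h.hasFDerivAt.fderiv
    exact (analyticAt_of_differentiable hg₁.entire _).prod
      (analyticAt_of_differentiable hg₂.entire _)
  · rw [← hval, e.left_inv hsrc]
  · filter_upwards [e.open_target.mem_nhds htgt] with ζ hζ
    exact e.right_inv hζ

variable {φ : ℂ × ℂ → ℂ × ℂ}

theorem IsLocalInverse.hasStrictFDerivAt (hg₁ : RealProperty g₁) (hg₂ : RealProperty g₂)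
    (hΔ : 0 < crossDet g₁ g₂ ξ) (hφ : IsLocalInverse g₁ g₂ ξ φ) :
    HasStrictFDerivAt φ
      ((crossEquiv (coefA g₁ ξ) (coefB g₁ ξ) (coefA g₂ ξ) (coefB g₂ ξ)
        (crossDet_cast_ne_zero hΔ)).symm : (ℂ × ℂ) →L[ℂ] (ℂ × ℂ)) 0 := by
  set E := crossEquiv (coefA g₁ ξ) (coefB g₁ ξ) (coefA g₂ ξ) (coefB g₂ ξ)
        (crossDet_cast_ne_zero hΔ) with hE
  have h1 := hφ.analytic.hasStrictFDerivAt
  have h2 : HasFDerivAt (fun z => (g₁ z, g₂ z)) (E : (ℂ × ℂ) →L[ℂ] (ℂ × ℂ)) (φ 0) := by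
    rw [hφ.base]
    exact (hasStrictFDerivAt_cross hg₁ hg₂ hΔ).hasFDerivAt
  have h3 := (h2.comp 0 h1.hasFDerivAt).unique
    ((hasFDerivAt_id (𝕜 := ℂ) (0 : ℂ × ℂ)).congr_of_eventuallyEq hφ.inverse)
  have h4 : fderiv ℂ φ 0 = (E.symm : (ℂ × ℂ) →L[ℂ] (ℂ × ℂ)) := by
    refine ContinuousLinearMap.ext fun v => ?_
    have := DFunLike.congr_fun h3 v
    exact (E.symm_apply_eq.2 this.symm).symm
  rwa [h4] at h1

/-- The local inverse is real at real points. -/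
theorem IsLocalInverse.eventually_real (hg₁ : RealProperty g₁) (hg₂ : RealProperty g₂)
    (hΔ : 0 < crossDet g₁ g₂ ξ) (hφ : IsLocalInverse g₁ g₂ ξ φ) :
    ∀ᶠ t in 𝓝 (0 : ℝ × ℝ), (φ (toC t)).1.im = 0 ∧ (φ (toC t)).2.im = 0 := by
  have h := hasStrictFDerivAt_cross hg₁ hg₂ hΔ
  have hcont : Continuous toC := by unfold toC; fun_prop
  have h0 : toC 0 = 0 := by simp [toC]
  have hto : Tendsto toC (𝓝 0) (𝓝 0) := h0 ▸ hcont.tendsto 0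
  have hφc : Tendsto φ (𝓝 0) (𝓝 (toC ξ)) := hφ.base ▸ hφ.analytic.continuousAt
  have hstar : Tendsto (fun z : ℂ × ℂ => star z) (𝓝 (toC ξ)) (𝓝 (toC ξ)) := by
    have : star (toC ξ) = toC ξ := by
      refine Prod.ext ?_ ?_ <;> exact Complex.conj_ofReal _
    have h1 := continuous_star.tendsto (toC ξ)
    rwa [this] at h1
  have hinv := h.eventually_left_inverse
  filter_upwards [hto.eventually hφ.inverse, (hφc.comp hto).eventually hinv,
    (hstar.comp (hφc.comp hto)).eventually hinv] with t h1 h2 h3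
  have hψ : (g₁ (star (φ (toC t))), g₂ (star (φ (toC t)))) =
      (g₁ (φ (toC t)), g₂ (φ (toC t))) := by
    rw [RealProperty.map_star hg₁, RealProperty.map_star hg₂]
    have e1 := congrArg Prod.fst h1
    have e2 := congrArg Prod.snd h1
    simp only at e1 e2
    rw [e1, e2]
    refine Prod.ext ?_ ?_ <;> exact Complex.conj_ofReal _
  simp only [Function.comp_apply] at h2 h3
  rw [hψ, h2] at h3
  have e1 := congrArg Prod.fst h3
  have e2 := congrArg Prod.snd h3
  exact ⟨Complex.conj_eq_iff_im.1 e1.symm, Complex.conj_eq_iff_im.1 e2.symm⟩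

/-- The Jacobian determinant of a map of `ℂ²`. -/
noncomputable def jacDet (φ : ℂ × ℂ → ℂ × ℂ) (ζ : ℂ × ℂ) : ℂ :=
  (fderiv ℂ φ ζ (1, 0)).1 * (fderiv ℂ φ ζ (0, 1)).2 -
    (fderiv ℂ φ ζ (0, 1)).1 * (fderiv ℂ φ ζ (1, 0)).2

theorem AnalyticAt.jacDet {ζ : ℂ × ℂ} (h : AnalyticAt ℂ φ ζ) : AnalyticAt ℂ (jacDet φ) ζ := by
  have hd := h.fderiv
  have h1 : ∀ v : ℂ × ℂ, AnalyticAt ℂ (fun ζ => fderiv ℂ φ ζ v) ζ := fun v =>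
    ((ContinuousLinearMap.apply ℂ (ℂ × ℂ) v).analyticAt _).comp hd
  have hf : ∀ v : ℂ × ℂ, AnalyticAt ℂ (fun ζ => (fderiv ℂ φ ζ v).1) ζ := fun v =>
    ((ContinuousLinearMap.fst ℂ ℂ ℂ).analyticAt _).comp (h1 v)
  have hs : ∀ v : ℂ × ℂ, AnalyticAt ℂ (fun ζ => (fderiv ℂ φ ζ v).2) ζ := fun v =>
    ((ContinuousLinearMap.snd ℂ ℂ ℂ).analyticAt _).comp (h1 v)
  exact ((hf _).mul (hs _)).sub ((hf _).mul (hs _))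

theorem IsLocalInverse.jacDet_zero (hg₁ : RealProperty g₁) (hg₂ : RealProperty g₂)
    (hΔ : 0 < crossDet g₁ g₂ ξ) (hφ : IsLocalInverse g₁ g₂ ξ φ) :
    jacDet φ 0 = 1 / crossDet g₁ g₂ ξ := by
  have hne := crossDet_cast_ne_zero hΔ
  rw [jacDet, (IsLocalInverse.hasStrictFDerivAt hg₁ hg₂ hΔ hφ).hasFDerivAt.fderiv]
  simp only [ContinuousLinearEquiv.coe_coe, crossEquiv_symm_apply, crossDet]
  push_cast
  rw [eq_div_iff hne]
  simp only [mul_one, mul_zero, add_zero, zero_add]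
  have hsq : ∀ a d : ℂ, d ≠ 0 → a / d * d = a := fun a d h => div_mul_cancel₀ a h
  rw [sub_mul, mul_assoc, hsq _ _ hne, mul_assoc, hsq _ _ hne, div_mul_eq_mul_div,
    div_mul_eq_mul_div, ← sub_div, div_eq_one_iff_eq hne]
  ring

/-- The phase `x · φ` in the variables `ζ`. -/
noncomputable def phase (φ : ℂ × ℂ → ℂ × ℂ) (x : ℝ × ℝ) (ζ : ℂ × ℂ) : ℂ :=
  (x.1 : ℂ) * (φ ζ).1 + (x.2 : ℂ) * (φ ζ).2

theorem IsLocalInverse.hasStrictFDerivAt_phase (hg₁ : RealProperty g₁) (hg₂ : RealProperty g₂)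
    (hΔ : 0 < crossDet g₁ g₂ ξ) (hφ : IsLocalInverse g₁ g₂ ξ φ) (x : ℝ × ℝ) :
    HasStrictFDerivAt (phase φ x) (linForm (xprime₁ g₁ g₂ ξ x) (xprime₂ g₁ g₂ ξ x)) 0 := by
  have h := IsLocalInverse.hasStrictFDerivAt hg₁ hg₂ hΔ hφ
  have h2 := ((linForm (x.1 : ℂ) (x.2 : ℂ)).hasStrictFDerivAt (x := φ 0)).comp 0 h
  have hne := crossDet_cast_ne_zero hΔ
  have hf : (fun ζ => linForm (x.1 : ℂ) (x.2 : ℂ) (φ ζ)) = phase φ x := by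
    funext ζ; simp [phase]
  rw [hf] at h2
  convert! h2 using 1
  ext <;>
  · simp [xprime₁, xprime₂, crossDet, crossEquiv_symm_apply]
    ring

/-- The imaginary part of the phase over `t + i y` is `x' · y`, up to an arbitrarily small multiple
of `‖y‖`. -/
theorem IsLocalInverse.abs_im_phase_sub_le (hg₁ : RealProperty g₁) (hg₂ : RealProperty g₂)
    (hΔ : 0 < crossDet g₁ g₂ ξ) (hφ : IsLocalInverse g₁ g₂ ξ φ) (x : ℝ × ℝ) {c : ℝ} (hc : 0 < c) :
    ∃ R > 0, ∀ t y : ℝ × ℝ, ‖t‖ < R → ‖y‖ < R →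
      |(phase φ x (cplx t y)).im - (xprime₁ g₁ g₂ ξ x * y.1 + xprime₂ g₁ g₂ ξ x * y.2)| ≤
        c * ‖y‖ := by
  have h0 : toC 0 = 0 := by simp [toC]
  have h := abs_im_sub_le_of_hasStrictFDerivAt (ξ := 0)
    (h0 ▸ IsLocalInverse.hasStrictFDerivAt_phase hg₁ hg₂ hΔ hφ x) (by
      filter_upwards [IsLocalInverse.eventually_real hg₁ hg₂ hΔ hφ] with t ht
      simp [phase, ht.1, ht.2]) hc
  simpa using h

end LocalInverse

/-! ### Active and inactive directions -/

section Activity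

variable {g₁ g₂ : ℂ × ℂ → ℂ} {ξ x : ℝ × ℝ}

theorem RealProperty.continuous_coef {g : ℂ × ℂ → ℂ} (hg : RealProperty g) :
    Continuous (coefA g) ∧ Continuous (coefB g) := by
  have hfd : Continuous (fderiv ℂ g) := continuous_iff_continuousAt.2 fun z =>
    (analyticAt_of_differentiable hg.entire z).fderiv.continuousAt
  have hto : Continuous toC := by unfold toC; fun_prop
  have he : ∀ ξ, fderiv ℂ g (toC ξ) = linForm (coefA g ξ) (coefB g ξ) := fun ξ =>
    (hasStrictFDerivAt_of_realProperty hg ξ).hasFDerivAt.fderiv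
  have hA : coefA g = fun ξ => (fderiv ℂ g (toC ξ) (1, 0)).re := by funext ξ; simp [he]
  have hB : coefB g = fun ξ => (fderiv ℂ g (toC ξ) (0, 1)).re := by funext ξ; simp [he]
  rw [hA, hB]
  exact ⟨Complex.continuous_re.comp ((hfd.comp hto).clm_apply continuous_const),
    Complex.continuous_re.comp ((hfd.comp hto).clm_apply continuous_const)⟩

theorem sign_spec {p s : ℝ} (hp : p ≠ 0) (hs : s = Real.sign p) :
    (s = 1 ∨ s = -1) ∧ 0 < s * p := by
  rcases lt_or_gt_of_ne hp with h | h
  · rw [Real.sign_of_neg h] at hs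
    subst hs
    exact ⟨Or.inr rfl, by linarith⟩
  · rw [Real.sign_of_pos h] at hs
    subst hs
    exact ⟨Or.inl rfl, by linarith⟩

theorem sign_eq_iff {p s : ℝ} (hp : p ≠ 0) (hs : s = 1 ∨ s = -1) :
    Real.sign p = s ↔ 0 < s * p := by
  rcases lt_or_gt_of_ne hp with h | h
  · rw [Real.sign_of_neg h]
    rcases hs with rfl | rfl
    · constructor <;> intro <;> linarith
    · constructor <;> intro <;> linarith
  · rw [Real.sign_of_pos h]
    rcases hs with rfl | rfl
    · constructor <;> intro <;> linarith
    · constructor <;> intro <;> linarith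

/-- The scalar product with `x` in terms of the two conormals at the crossing. -/
theorem dot_eq_xprime (hΔ : 0 < crossDet g₁ g₂ ξ) (v : ℝ × ℝ) :
    x.1 * v.1 + x.2 * v.2 =
      xprime₁ g₁ g₂ ξ x * (coefA g₁ ξ * v.1 + coefB g₁ ξ * v.2) +
      xprime₂ g₁ g₂ ξ x * (coefA g₂ ξ * v.1 + coefB g₂ ξ * v.2) := by
  have h := hΔ.ne'
  rw [xprime₁, xprime₂, div_mul_eq_mul_div, div_mul_eq_mul_div, ← add_div, eq_div_iff h, crossDet]
  ring

/-- The active quadrant in the coordinates `x'`, which are those of `x` in the basis of the two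
conormals. -/
theorem mem_activeQuadrant_iff (hΔ : 0 < crossDet g₁ g₂ ξ) {s₁ s₂ : ℝ} (hs₁ : s₁ = 1 ∨ s₁ = -1)
    (hs₂ : s₂ = 1 ∨ s₂ = -1) :
    x ∈ activeQuadrant g₁ g₂ s₁ s₂ ξ ↔
      0 < s₁ * xprime₁ g₁ g₂ ξ x ∧ 0 < s₂ * xprime₂ g₁ g₂ ξ x := by
  have h1 : s₁ * s₁ = 1 := by rcases hs₁ with rfl | rfl <;> simp
  have h2 : s₂ * s₂ = 1 := by rcases hs₂ with rfl | rfl <;> simp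
  have hΔ' := hΔ
  rw [crossDet] at hΔ'
  have hpos : ∀ a b : ℝ, (a ≠ 0 ∨ b ≠ 0) → 0 < Real.sqrt (a ^ 2 + b ^ 2) := by
    rintro a b (h | h) <;> positivity
  have hN1 : 0 < Real.sqrt (coefA g₁ ξ ^ 2 + coefB g₁ ξ ^ 2) := by
    apply hpos
    by_contra! h
    rw [h.1, h.2] at hΔ'
    simp at hΔ'
  have hN2 : 0 < Real.sqrt (coefA g₂ ξ ^ 2 + coefB g₂ ξ ^ 2) := by
    apply hpos
    by_contra! h
    rw [h.1, h.2] at hΔ'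
    simp at hΔ'
  set N1 := Real.sqrt (coefA g₁ ξ ^ 2 + coefB g₁ ξ ^ 2) with hN1d
  set N2 := Real.sqrt (coefA g₂ ξ ^ 2 + coefB g₂ ξ ^ 2) with hN2d
  constructor
  · rintro ⟨c₁, hc₁, c₂, hc₂, hx⟩
    have e1 : x.1 = c₁ * s₁ * (1 / N1 * coefA g₁ ξ) + c₂ * s₂ * (1 / N2 * coefA g₂ ξ) := by
      rw [hx]; simp [unitNormal, ← hN1d, ← hN2d]
    have e2 : x.2 = c₁ * s₁ * (1 / N1 * coefB g₁ ξ) + c₂ * s₂ * (1 / N2 * coefB g₂ ξ) := by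
      rw [hx]; simp [unitNormal, ← hN1d, ← hN2d]
    have f1 : xprime₁ g₁ g₂ ξ x = c₁ * s₁ / N1 := by
      rw [xprime₁, div_eq_iff hΔ.ne', e1, e2, crossDet]; ring
    have f2 : xprime₂ g₁ g₂ ξ x = c₂ * s₂ / N2 := by
      rw [xprime₂, div_eq_iff hΔ.ne', e1, e2, crossDet]; ring
    rw [f1, f2]
    constructor
    · rw [show s₁ * (c₁ * s₁ / N1) = s₁ * s₁ * (c₁ / N1) by ring, h1]; positivity
    · rw [show s₂ * (c₂ * s₂ / N2) = s₂ * s₂ * (c₂ / N2) by ring, h2]; positivity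
  · rintro ⟨p1, p2⟩
    refine ⟨s₁ * xprime₁ g₁ g₂ ξ x * N1, by positivity, s₂ * xprime₂ g₁ g₂ ξ x * N2,
      by positivity, ?_⟩
    have k1 : s₁ * xprime₁ g₁ g₂ ξ x * N1 * s₁ * (1 / N1) = xprime₁ g₁ g₂ ξ x := by
      rw [show s₁ * xprime₁ g₁ g₂ ξ x * N1 * s₁ * (1 / N1) =
        s₁ * s₁ * xprime₁ g₁ g₂ ξ x * (N1 * (1 / N1)) by ring, h1, mul_one_div_cancel hN1.ne']
      ring
    have k2 : s₂ * xprime₂ g₁ g₂ ξ x * N2 * s₂ * (1 / N2) = xprime₂ g₁ g₂ ξ x := by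
      rw [show s₂ * xprime₂ g₁ g₂ ξ x * N2 * s₂ * (1 / N2) =
        s₂ * s₂ * xprime₂ g₁ g₂ ξ x * (N2 * (1 / N2)) by ring, h2, mul_one_div_cancel hN2.ne']
      ring
    rw [unitNormal, unitNormal, smul_smul, smul_smul, ← hN1d, ← hN2d, k1, k2]
    have d1 := dot_eq_xprime (x := x) hΔ (1, 0)
    have d2 := dot_eq_xprime (x := x) hΔ (0, 1)
    refine Prod.ext ?_ ?_
    · simpa using d1
    · simpa using d2

/-- If the bridge signs do not match the signs of `x'`, some field with these bridge signs points
against `x`. -/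
theorem exists_neg_of_not_pos {s₁ s₂ y₁ y₂ : ℝ} (hs₁ : s₁ = 1 ∨ s₁ = -1) (hs₂ : s₂ = 1 ∨ s₂ = -1)
    (hy₁ : y₁ ≠ 0) (hy₂ : y₂ ≠ 0) (h : ¬ (0 < s₁ * y₁ ∧ 0 < s₂ * y₂)) :
    ∃ q₁ q₂ : ℝ, 0 < s₁ * q₁ ∧ 0 < s₂ * q₂ ∧ y₁ * q₁ + y₂ * q₂ < 0 := by
  have key : ∀ s t y z : ℝ, (s = 1 ∨ s = -1) → (t = 1 ∨ t = -1) → s * y < 0 →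
      ∃ q p : ℝ, 0 < s * q ∧ 0 < t * p ∧ y * q + z * p < 0 := by
    intro s t y z hs ht hy
    have h1 : s * s = 1 := by rcases hs with rfl | rfl <;> simp
    have h2 : t * t = 1 := by rcases ht with rfl | rfl <;> simp
    have hM : 0 < (|z| + 1) / -(s * y) := div_pos (by positivity) (by linarith)
    refine ⟨s * ((|z| + 1) / -(s * y)), t, ?_, by linarith, ?_⟩
    · rw [← mul_assoc, h1]; linarith
    · have e : y * (s * ((|z| + 1) / -(s * y))) = -(|z| + 1) := by
        have : s * y ≠ 0 := hy.ne
        rw [show y * (s * ((|z| + 1) / -(s * y))) = (s * y) / -(s * y) * (|z| + 1) by ring,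
          div_neg, div_self this]
        ring
      have h3 : z * t ≤ |z| := by
        refine (le_abs_self _).trans ?_
        rw [abs_mul, show |t| = 1 by rcases ht with rfl | rfl <;> simp, mul_one]
      rw [e]; linarith
  have hne₁ : s₁ * y₁ ≠ 0 := mul_ne_zero (by rcases hs₁ with rfl | rfl <;> simp) hy₁
  have hne₂ : s₂ * y₂ ≠ 0 := mul_ne_zero (by rcases hs₂ with rfl | rfl <;> simp) hy₂
  rcases lt_or_gt_of_ne hne₁ with h1 | h1
  · exact key s₁ s₂ y₁ y₂ hs₁ hs₂ h1
  · rcases lt_or_gt_of_ne hne₂ with h2 | h2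
    · obtain ⟨q, p, a, b, c⟩ := key s₂ s₁ y₂ y₁ hs₂ hs₁ h2
      exact ⟨p, q, b, a, by linarith⟩
    · exact absurd ⟨h1, h2⟩ h

/-- Along an admissible deformation the field never becomes tangent to the real traces at the
crossing, so its bridge signs are constant. -/
theorem bridge_pos_of_deformation {U : Set (ℝ × ℝ)} (hU : U ∈ 𝓝 ξ) {H : ℝ → ℝ × ℝ → ℝ × ℝ}
    (hcont : ContinuousOn (fun p : ℝ × (ℝ × ℝ) => H p.1 p.2) (Icc (0 : ℝ) 1 ×ˢ U)) {a b s : ℝ}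
    (hne : ∀ τ ∈ Icc (0 : ℝ) 1, a * (H τ ξ).1 + b * (H τ ξ).2 ≠ 0)
    (h0 : 0 < s * (a * (H 0 ξ).1 + b * (H 0 ξ).2)) :
    0 < s * (a * (H 1 ξ).1 + b * (H 1 ξ).2) := by
  have hξ := mem_of_mem_nhds hU
  have hs : s ≠ 0 := by rintro rfl; simp at h0
  have hc : ContinuousOn (fun τ => s * (a * (H τ ξ).1 + b * (H τ ξ).2)) (Icc (0 : ℝ) 1) := by
    have h1 : ContinuousOn (fun τ : ℝ => H τ ξ) (Icc (0 : ℝ) 1) :=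
      hcont.comp (f := fun τ : ℝ => (τ, ξ)) (by fun_prop) fun τ hτ => ⟨hτ, hξ⟩
    fun_prop
  by_contra! hneg
  obtain ⟨τ, hτ, hz⟩ := intermediate_value_Icc' zero_le_one hc ⟨hneg, h0.le⟩
  exact mul_ne_zero hs (hne τ hτ) hz

/-- The surface can be deformed, near the crossing, to one with a small constant field of the same
bridge signs: the given field is first scaled down, and then moved along a segment on which the
imaginary parts of `g₁` and `g₂` keep their signs. -/
theorem exists_admissible_deformation (hg₁ : RealProperty g₁) (hg₂ : RealProperty g₂)
    {U : Set (ℝ × ℝ)} (hU : U ∈ 𝓝 ξ) {η : ℝ × ℝ → ℝ × ℝ} (hη : AdmissibleOn g₁ g₂ U η)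
    {s₁ s₂ : ℝ} (hη₁ : 0 < s₁ * (coefA g₁ ξ * (η ξ).1 + coefB g₁ ξ * (η ξ).2))
    (hη₂ : 0 < s₂ * (coefA g₂ ξ * (η ξ).1 + coefB g₂ ξ * (η ξ).2))
    {v : ℝ × ℝ} (hv₁ : 0 < s₁ * (coefA g₁ ξ * v.1 + coefB g₁ ξ * v.2))
    (hv₂ : 0 < s₂ * (coefA g₂ ξ * v.1 + coefB g₂ ξ * v.2)) :
    ∃ κ > (0 : ℝ), ∃ V ∈ 𝓝 ξ, ∃ H : ℝ → ℝ × ℝ → ℝ × ℝ,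
      ContinuousOn (fun p : ℝ × (ℝ × ℝ) => H p.1 p.2) (Icc (0 : ℝ) 1 ×ˢ V) ∧
      (∀ τ ∈ Icc (0 : ℝ) 1, AdmissibleOn g₁ g₂ V (H τ)) ∧
      (∀ ξ' ∈ V, H 0 ξ' = η ξ') ∧ H 1 ξ = κ • v := by
  have hηc : ContinuousAt η ξ := hη.cont.continuousAt hU
  -- a neighbourhood on which the convex hull of `η` and `v` is uniformly transverse
  have main : ∀ {g : ℂ × ℂ → ℂ} {s : ℝ}, RealProperty g →
      0 < s * (coefA g ξ * (η ξ).1 + coefB g ξ * (η ξ).2) →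
      0 < s * (coefA g ξ * v.1 + coefB g ξ * v.2) →
      ∃ κ₀ > (0 : ℝ), ∀ κ ∈ Ioc 0 κ₀, ∀ᶠ ξ' in 𝓝 ξ, ∀ α β : ℝ, 0 ≤ α → 0 ≤ β → α + β = κ →
        (∀ ε ∈ Ioc (0 : ℝ) 1, g (cplx ξ' (ε • (α • η ξ' + β • v))) ≠ 0) ∧
        coefA g ξ' * (α • η ξ' + β • v).1 + coefB g ξ' * (α • η ξ' + β • v).2 ≠ 0 := by
    intro g s hg h1 h2
    obtain ⟨hcA, hcB⟩ := RealProperty.continuous_coef hg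
    set a := coefA g ξ with ha
    set b := coefB g ξ with hb
    set p1 := s * (a * (η ξ).1 + b * (η ξ).2) with hp1
    set p2 := s * (a * v.1 + b * v.2) with hp2
    set m := min p1 p2 / 2 with hm
    have hm0 : 0 < m := by have := lt_min h1 h2; positivity
    have hmp1 : m < p1 := by have := min_le_left p1 p2; have := lt_min h1 h2; linarith
    have hmp2 : m < p2 := by have := min_le_right p1 p2; have := lt_min h1 h2; linarith
    set M := max (‖η ξ‖ + 1) (‖v‖ + 1) with hM
    have hM0 : 0 < M := lt_max_of_lt_left (by positivity)
    have hs0 : s ≠ 0 := by rintro rfl; simp [hp1] at h1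
    have hc : 0 < m / (2 * M * |s|) := by positivity
    obtain ⟨R, hR, hest⟩ := abs_im_sub_le_of_hasStrictFDerivAt
      (hasStrictFDerivAt_of_realProperty hg ξ) (Eventually.of_forall hg.real) hc
    refine ⟨R / (2 * M), by positivity, fun κ hκ => ?_⟩
    have e1 : ∀ᶠ ξ' in 𝓝 ξ, m < s * (a * (η ξ').1 + b * (η ξ').2) := by
      have : ContinuousAt (fun ξ' => s * (a * (η ξ').1 + b * (η ξ').2)) ξ := by fun_prop
      exact this.eventually (lt_mem_nhds hmp1)
    have e2 : ∀ᶠ ξ' in 𝓝 ξ, m < s * (coefA g ξ' * (η ξ').1 + coefB g ξ' * (η ξ').2) := by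
      have : ContinuousAt (fun ξ' => s * (coefA g ξ' * (η ξ').1 + coefB g ξ' * (η ξ').2)) ξ := by
        fun_prop
      exact this.eventually (lt_mem_nhds hmp1)
    have e3 : ∀ᶠ ξ' in 𝓝 ξ, m < s * (coefA g ξ' * v.1 + coefB g ξ' * v.2) := by
      have : ContinuousAt (fun ξ' => s * (coefA g ξ' * v.1 + coefB g ξ' * v.2)) ξ := by fun_prop
      exact this.eventually (lt_mem_nhds hmp2)
    have e4 : ∀ᶠ ξ' in 𝓝 ξ, ‖η ξ'‖ < M :=
      hηc.norm.eventually (gt_mem_nhds (by rw [hM]; exact lt_max_of_lt_left (by linarith)))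
    have e5 : ∀ᶠ ξ' in 𝓝 ξ, ‖ξ' - ξ‖ < R := by
      filter_upwards [Metric.ball_mem_nhds ξ hR] with ξ' h using by rwa [mem_ball_iff_norm] at h
    filter_upwards [e1, e2, e3, e4, e5] with ξ' f1 f2 f3 f4 f5 α β hα hβ hαβ
    have hvM : ‖v‖ ≤ M := by
      have := le_max_right (‖η ξ‖ + 1) (‖v‖ + 1); linarith
    set w := α • η ξ' + β • v with hw
    have hwn : ‖w‖ ≤ κ * M := by
      calc ‖w‖ ≤ ‖α • η ξ'‖ + ‖β • v‖ := norm_add_le _ _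
        _ = α * ‖η ξ'‖ + β * ‖v‖ := by
          rw [norm_smul, norm_smul, Real.norm_of_nonneg hα, Real.norm_of_nonneg hβ]
        _ ≤ α * M + β * M := by gcongr
        _ = κ * M := by rw [← hαβ]; ring
    have hw1 : w.1 = α * (η ξ').1 + β * v.1 := by simp [hw]
    have hw2 : w.2 = α * (η ξ').2 + β * v.2 := by simp [hw]
    have hκm : ∀ A B : ℝ, m < s * (A * (η ξ').1 + B * (η ξ').2) → m < s * (A * v.1 + B * v.2) →
        κ * m ≤ s * (A * w.1 + B * w.2) := by
      intro A B k1 k2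
      calc κ * m = α * m + β * m := by rw [← hαβ]; ring
        _ ≤ α * (s * (A * (η ξ').1 + B * (η ξ').2)) + β * (s * (A * v.1 + B * v.2)) := by gcongr
        _ = _ := by rw [hw1, hw2]; ring
    refine ⟨fun ε hε hzero => ?_, fun hzero => ?_⟩
    · have hεw : ‖ε • w‖ = ε * ‖w‖ := by rw [norm_smul, Real.norm_of_nonneg hε.1.le]
      have hsmall : ‖ε • w‖ < R := by
        rw [hεw]
        have h3 : κ * M ≤ R / 2 := by
          calc κ * M ≤ R / (2 * M) * M := by gcongr; exact hκ.2
            _ = R / 2 := by field_simp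
        have h4 : ε * ‖w‖ ≤ 1 * ‖w‖ := by gcongr; exact hε.2
        linarith
      have h5 := hest ξ' (ε • w) f5 hsmall
      rw [hzero, hεw] at h5
      have h6 : κ * m ≤ s * (a * w.1 + b * w.2) := hκm a b f1 (hmp2)
      have h7 : |s * (a * w.1 + b * w.2)| ≤ m / (2 * M) * ‖w‖ := by
        have : |a * w.1 + b * w.2| ≤ m / (2 * M * |s|) * ‖w‖ := by
          have h8 : |(0 : ℂ).im - (a * (ε • w).1 + b * (ε • w).2)| = ε * |a * w.1 + b * w.2| := by
            rw [← abs_of_pos hε.1, ← abs_mul, ← abs_neg]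
            congr 1
            simp [abs_of_pos hε.1]
            ring
          rw [h8] at h5
          refine le_of_mul_le_mul_left (h5.trans (le_of_eq ?_)) hε.1
          ring
        rw [abs_mul]
        calc |s| * |a * w.1 + b * w.2| ≤ |s| * (m / (2 * M * |s|) * ‖w‖) := by gcongr
          _ = m / (2 * M) * ‖w‖ := by
            have : |s| ≠ 0 := abs_ne_zero.2 hs0
            field_simp
      have h9 : m / (2 * M) * ‖w‖ ≤ κ * m / 2 := by
        calc m / (2 * M) * ‖w‖ ≤ m / (2 * M) * (κ * M) := by gcongr
          _ = κ * m / 2 := by field_simp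
      have h10 := (le_abs_self _).trans (h7.trans h9)
      have := mul_pos hκ.1 hm0
      linarith
    · have h6 := hκm _ _ f2 f3
      rw [hzero, mul_zero] at h6
      have := mul_pos hκ.1 hm0
      linarith
  obtain ⟨κ₁, hκ₁, H1⟩ := main hg₁ hη₁ hv₁
  obtain ⟨κ₂, hκ₂, H2⟩ := main hg₂ hη₂ hv₂
  set κ := min (min κ₁ κ₂) 1 with hκ
  have hκ0 : 0 < κ := lt_min (lt_min hκ₁ hκ₂) one_pos
  have hκ1 : κ ≤ 1 := min_le_right _ _
  have E1 := H1 κ ⟨hκ0, (min_le_left _ _).trans (min_le_left _ _)⟩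
  have E2 := H2 κ ⟨hκ0, (min_le_left _ _).trans (min_le_right _ _)⟩
  set V := {ξ' | ξ' ∈ U ∧ (∀ α β : ℝ, 0 ≤ α → 0 ≤ β → α + β = κ →
        (∀ ε ∈ Ioc (0 : ℝ) 1, g₁ (cplx ξ' (ε • (α • η ξ' + β • v))) ≠ 0) ∧
        coefA g₁ ξ' * (α • η ξ' + β • v).1 + coefB g₁ ξ' * (α • η ξ' + β • v).2 ≠ 0) ∧
      (∀ α β : ℝ, 0 ≤ α → 0 ≤ β → α + β = κ →
        (∀ ε ∈ Ioc (0 : ℝ) 1, g₂ (cplx ξ' (ε • (α • η ξ' + β • v))) ≠ 0) ∧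
        coefA g₂ ξ' * (α • η ξ' + β • v).1 + coefB g₂ ξ' * (α • η ξ' + β • v).2 ≠ 0)} with hV
  have hVn : V ∈ 𝓝 ξ := by filter_upwards [hU, E1, E2] with ξ' a b c using ⟨a, b, c⟩
  have hVU : V ⊆ U := fun ξ' h => h.1
  -- the weights of `η` and `v`: first `(1, 0)` to `(κ, 0)`, then on to `(0, κ)`
  set α : ℝ → ℝ := fun τ => max κ (1 - 2 * τ) * min 1 (2 - 2 * τ) with hα
  set β : ℝ → ℝ := fun τ => κ * max 0 (2 * τ - 1) with hβ
  have hcase : ∀ τ ∈ Icc (0 : ℝ) 1, (β τ = 0 ∧ α τ ∈ Ioc (0 : ℝ) 1) ∨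
      (0 ≤ α τ ∧ 0 ≤ β τ ∧ α τ + β τ = κ) := by
    intro τ hτ
    rcases le_total τ (1 / 2) with h | h
    · left
      simp only [hα, hβ]
      rw [max_eq_left (by linarith), min_eq_left (by linarith), mul_zero, mul_one]
      exact ⟨rfl, lt_max_of_lt_left hκ0, max_le hκ1 (by linarith [hτ.1])⟩
    · right
      simp only [hα, hβ]
      rw [max_eq_right (by linarith : 0 ≤ 2 * τ - 1), min_eq_right (by linarith),
        max_eq_left (by linarith)]
      exact ⟨mul_nonneg hκ0.le (by linarith [hτ.2]), mul_nonneg hκ0.le (by linarith), by ring⟩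
  refine ⟨κ, hκ0, V, hVn, fun τ ξ' => α τ • η ξ' + β τ • v, ?_, ?_, ?_, ?_⟩
  · have h1 : ContinuousOn (fun p : ℝ × (ℝ × ℝ) => η p.2) (Icc (0 : ℝ) 1 ×ˢ V) :=
      (hη.cont.mono hVU).comp continuousOn_snd fun p hp => hp.2
    have h2 : Continuous α := by simp only [hα]; fun_prop
    have h3 : Continuous β := by simp only [hβ]; fun_prop
    exact ((h2.comp continuous_fst).continuousOn.smul h1).add
      ((h3.comp continuous_fst).continuousOn.smul continuousOn_const)
  · intro τ hτ
    refine ⟨?_, ?_, ?_, ?_⟩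
    · have := hη.cont.mono hVU
      fun_prop
    · intro ξ' hξ' ε hε
      rcases hcase τ hτ with ⟨hb, ha⟩ | ⟨ha, hb, hab⟩
      · have := hη.flattable ξ' hξ'.1 (ε * α τ) ⟨mul_pos hε.1 ha.1,
          mul_le_one₀ hε.2 ha.1.le ha.2⟩
        simpa [hb, smul_smul] using this
      · exact ⟨(hξ'.2.1 _ _ ha hb hab).1 ε hε, (hξ'.2.2 _ _ ha hb hab).1 ε hε⟩
    · intro ξ' hξ' h0
      rcases hcase τ hτ with ⟨hb, ha⟩ | ⟨ha, hb, hab⟩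
      · have h1 := mul_ne_zero ha.1.ne' (hη.transverse₁ ξ' hξ'.1 h0)
        intro h2
        refine h1 (Eq.trans ?_ h2)
        simp only [hb, zero_smul, add_zero, Prod.smul_fst, Prod.smul_snd, smul_eq_mul]
        ring
      · exact (hξ'.2.1 _ _ ha hb hab).2
    · intro ξ' hξ' h0
      rcases hcase τ hτ with ⟨hb, ha⟩ | ⟨ha, hb, hab⟩
      · have h1 := mul_ne_zero ha.1.ne' (hη.transverse₂ ξ' hξ'.1 h0)
        intro h2
        refine h1 (Eq.trans ?_ h2)
        simp only [hb, zero_smul, add_zero, Prod.smul_fst, Prod.smul_snd, smul_eq_mul]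
        ring
      · exact (hξ'.2.2 _ _ ha hb hab).2
  · intro ξ' _
    simp [hα, hβ, hκ1]
  · simp only [hα, hβ]
    norm_num

/-- A point is active exactly when the bridge signs are the signs of `x'`. -/
theorem isActive_iff (hg₁ : RealProperty g₁) (hg₂ : RealProperty g₂)
    (hξ₁ : g₁ (toC ξ) = 0) (hξ₂ : g₂ (toC ξ) = 0) (hΔ : 0 < crossDet g₁ g₂ ξ)
    {U : Set (ℝ × ℝ)} (hU : U ∈ 𝓝 ξ) {η : ℝ × ℝ → ℝ × ℝ} (hη : AdmissibleOn g₁ g₂ U η)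
    {s₁ s₂ : ℝ} (hs₁ : s₁ = 1 ∨ s₁ = -1) (hs₂ : s₂ = 1 ∨ s₂ = -1)
    (hη₁ : 0 < s₁ * (coefA g₁ ξ * (η ξ).1 + coefB g₁ ξ * (η ξ).2))
    (hη₂ : 0 < s₂ * (coefA g₂ ξ * (η ξ).1 + coefB g₂ ξ * (η ξ).2))
    (hx₁ : xprime₁ g₁ g₂ ξ x ≠ 0) (hx₂ : xprime₂ g₁ g₂ ξ x ≠ 0) :
    IsActive g₁ g₂ η ξ x ↔ 0 < s₁ * xprime₁ g₁ g₂ ξ x ∧ 0 < s₂ * xprime₂ g₁ g₂ ξ x := by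
  constructor
  · intro hact
    by_contra hneg
    obtain ⟨q₁, q₂, h1, h2, h3⟩ := exists_neg_of_not_pos hs₁ hs₂ hx₁ hx₂ hneg
    -- the vector whose products with the two conormals are `q₁` and `q₂`
    set v : ℝ × ℝ := ((coefB g₂ ξ * q₁ - coefB g₁ ξ * q₂) / crossDet g₁ g₂ ξ,
      (coefA g₁ ξ * q₂ - coefA g₂ ξ * q₁) / crossDet g₁ g₂ ξ) with hv
    have e1 : coefA g₁ ξ * v.1 + coefB g₁ ξ * v.2 = q₁ := by
      rw [hv]
      simp only [mul_div_assoc', ← add_div]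
      rw [div_eq_iff hΔ.ne', crossDet]; ring
    have e2 : coefA g₂ ξ * v.1 + coefB g₂ ξ * v.2 = q₂ := by
      rw [hv]
      simp only [mul_div_assoc', ← add_div]
      rw [div_eq_iff hΔ.ne', crossDet]; ring
    obtain ⟨κ, hκ, V, hV, H, hc, hadm, h0, hH1⟩ := exists_admissible_deformation hg₁ hg₂ hU hη
      hη₁ hη₂ (v := v) (by rwa [e1]) (by rwa [e2])
    refine hact ⟨V, hV, H, hc, hadm, h0, ?_⟩
    rw [dot_eq_xprime hΔ, hH1]
    have : xprime₁ g₁ g₂ ξ x * (coefA g₁ ξ * (κ • v).1 + coefB g₁ ξ * (κ • v).2) +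
        xprime₂ g₁ g₂ ξ x * (coefA g₂ ξ * (κ • v).1 + coefB g₂ ξ * (κ • v).2) =
        κ * (xprime₁ g₁ g₂ ξ x * q₁ + xprime₂ g₁ g₂ ξ x * q₂) := by
      rw [← e1, ← e2]; simp only [Prod.smul_fst, Prod.smul_snd, smul_eq_mul]; ring
    rw [this]
    exact mul_neg_of_pos_of_neg hκ h3
  · rintro ⟨p1, p2⟩ ⟨V, hV, H, hc, hadm, h0, hneg⟩
    have hξV := mem_of_mem_nhds hV
    have b1 := bridge_pos_of_deformation hV hc
      (fun τ hτ => (hadm τ hτ).transverse₁ ξ hξV hξ₁) (s := s₁) (by rwa [h0 ξ hξV])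
    have b2 := bridge_pos_of_deformation hV hc
      (fun τ hτ => (hadm τ hτ).transverse₂ ξ hξV hξ₂) (s := s₂) (by rwa [h0 ξ hξV])
    rw [dot_eq_xprime hΔ] at hneg
    have q1 : s₁ * s₁ = 1 := by rcases hs₁ with rfl | rfl <;> simp
    have q2 : s₂ * s₂ = 1 := by rcases hs₂ with rfl | rfl <;> simp
    have m1 := mul_pos p1 b1
    have m2 := mul_pos p2 b2
    rw [mul_mul_mul_comm, q1, one_mul] at m1
    rw [mul_mul_mul_comm, q2, one_mul] at m2
    linarith

end Activity

/-! ### Contour changes for products of tents -/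

/-- The product of two cut discs of radius `R`, in the rotated coordinates. -/
def cutBox (R : ℝ) : Set (ℂ × ℂ) :=
  (Complex.slitPlane ∩ Metric.ball 0 R) ×ˢ (Complex.slitPlane ∩ Metric.ball 0 R)

theorem measurableSet_square (ρ : ℝ) : MeasurableSet (square ρ) :=
  measurableSet_Ioo.prod measurableSet_Ioo

theorem square_subset_Icc (ρ : ℝ) : square ρ ⊆ Icc (-ρ) ρ ×ˢ Icc (-ρ) ρ :=
  prod_mono Ioo_subset_Icc_self Ioo_subset_Icc_self

theorem integrableOn_square_of_continuousOn {f : ℝ × ℝ → ℂ} {ρ : ℝ}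
    (hf : ContinuousOn f (Icc (-ρ) ρ ×ˢ Icc (-ρ) ρ)) : IntegrableOn f (square ρ) :=
  (hf.integrableOn_compact (isCompact_Icc.prod isCompact_Icc)).mono_set (square_subset_Icc ρ)

theorem integrableOn_square_tent {f : ℂ × ℂ → ℂ} {S : Set (ℂ × ℂ)} (hf : ContinuousOn f S)
    {s₁ s₂ : ℝ} (hs₁ : s₁ = 1 ∨ s₁ = -1) (hs₂ : s₂ = 1 ∨ s₂ = -1) {δ₁ σ₁ δ₂ σ₂ ρ : ℝ}
    (hm : ∀ t ∈ Icc (-ρ) ρ ×ˢ Icc (-ρ) ρ, (tent s₁ δ₁ σ₁ t.1, tent s₂ δ₂ σ₂ t.2) ∈ S) :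
    IntegrableOn (fun t : ℝ × ℝ => f (tent s₁ δ₁ σ₁ t.1, tent s₂ δ₂ σ₂ t.2) *
      (tentDeriv s₁ σ₁ t.1 * tentDeriv s₂ σ₂ t.2)) (square ρ) := by
  refine Integrable.mul_bdd (c := (|σ₁| + 1) * (|σ₂| + 1)) ?_ ?_ (Eventually.of_forall fun t => ?_)
  · refine integrableOn_square_of_continuousOn (hf.comp (Continuous.continuousOn ?_) hm)
    have h1 := continuous_tent s₁ δ₁ σ₁
    have h2 := continuous_tent s₂ δ₂ σ₂
    fun_prop
  · exact (((measurable_tentDeriv s₁ σ₁).comp measurable_fst).mul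
      ((measurable_tentDeriv s₂ σ₂).comp measurable_snd)).aestronglyMeasurable
  · rw [norm_mul]
    exact mul_le_mul (norm_tentDeriv_le hs₁ _ _) (norm_tentDeriv_le hs₂ _ _) (norm_nonneg _)
      (by positivity)

theorem volume_restrict_square (ρ : ℝ) : (volume : Measure (ℝ × ℝ)).restrict (square ρ) =
    (volume.restrict (Ioo (-ρ) ρ)).prod (volume.restrict (Ioo (-ρ) ρ)) := by
  rw [Measure.prod_restrict, Measure.volume_eq_prod, square]

theorem setIntegral_Ioo_eq (f : ℝ → ℂ) {ρ : ℝ} (hρ : 0 ≤ ρ) :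
    ∫ t in Ioo (-ρ) ρ, f t = ∫ t in (-ρ)..ρ, f t := by
  rw [intervalIntegral.integral_of_le (by linarith), integral_Ioc_eq_integral_Ioo]

/-- Cauchy's theorem for products of two tents with the same end points, one variable after the
other. -/
theorem integral_square_tent_eq {f : ℂ × ℂ → ℂ} {R : ℝ} (hf : DifferentiableOn ℂ f (cutBox R))
    {s₁ s₂ : ℝ} (hs₁ : s₁ = 1 ∨ s₁ = -1) (hs₂ : s₂ = 1 ∨ s₂ = -1)
    {δ₁ σ₁ δ₁' σ₁' δ₂ σ₂ δ₂' σ₂' ρ : ℝ} (hρ : 0 ≤ ρ)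
    (h₁ : ∀ t ∈ Icc (-ρ) ρ, tent s₁ δ₁ σ₁ t ∈ Complex.slitPlane ∩ Metric.ball 0 R)
    (h₁' : ∀ t ∈ Icc (-ρ) ρ, tent s₁ δ₁' σ₁' t ∈ Complex.slitPlane ∩ Metric.ball 0 R)
    (h₂ : ∀ t ∈ Icc (-ρ) ρ, tent s₂ δ₂ σ₂ t ∈ Complex.slitPlane ∩ Metric.ball 0 R)
    (h₂' : ∀ t ∈ Icc (-ρ) ρ, tent s₂ δ₂' σ₂' t ∈ Complex.slitPlane ∩ Metric.ball 0 R)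
    (he₁ : δ₁ - σ₁ * ρ = δ₁' - σ₁' * ρ) (he₂ : δ₂ - σ₂ * ρ = δ₂' - σ₂' * ρ) :
    ∫ t in square ρ, f (tent s₁ δ₁ σ₁ t.1, tent s₂ δ₂ σ₂ t.2) *
        (tentDeriv s₁ σ₁ t.1 * tentDeriv s₂ σ₂ t.2) =
      ∫ t in square ρ, f (tent s₁ δ₁' σ₁' t.1, tent s₂ δ₂' σ₂' t.2) *
        (tentDeriv s₁ σ₁' t.1 * tentDeriv s₂ σ₂' t.2) := by
  have hi := integrableOn_square_tent hf.continuousOn hs₁ hs₂ (ρ := ρ)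
    (fun t ht => ⟨h₁ t.1 ht.1, h₂ t.2 ht.2⟩)
  have hm := integrableOn_square_tent hf.continuousOn hs₁ hs₂ (ρ := ρ)
    (fun t ht => ⟨h₁ t.1 ht.1, h₂' t.2 ht.2⟩)
  have hi' := integrableOn_square_tent hf.continuousOn hs₁ hs₂ (ρ := ρ)
    (fun t ht => ⟨h₁' t.1 ht.1, h₂' t.2 ht.2⟩)
  -- the contour is changed in the second variable, with the first one fixed
  have hsecond : ∫ t in square ρ, f (tent s₁ δ₁ σ₁ t.1, tent s₂ δ₂ σ₂ t.2) *
        (tentDeriv s₁ σ₁ t.1 * tentDeriv s₂ σ₂ t.2) =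
      ∫ t in square ρ, f (tent s₁ δ₁ σ₁ t.1, tent s₂ δ₂' σ₂' t.2) *
        (tentDeriv s₁ σ₁ t.1 * tentDeriv s₂ σ₂' t.2) := by
    rw [IntegrableOn, volume_restrict_square] at hi hm
    rw [volume_restrict_square, integral_prod _ hi, integral_prod _ hm]
    refine setIntegral_congr_fun measurableSet_Ioo fun t ht => ?_
    have hd : DifferentiableOn ℂ (fun z => f (tent s₁ δ₁ σ₁ t, z))
        (Complex.slitPlane ∩ Metric.ball 0 R) :=
      hf.comp (by fun_prop) fun z hz => ⟨h₁ t (Ioo_subset_Icc_self ht), hz⟩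
    have := integral_tent_eq_integral_tent hd hs₂ hρ h₂ h₂' he₂
    rw [← setIntegral_Ioo_eq _ hρ, ← setIntegral_Ioo_eq _ hρ] at this
    have e : ∀ a b c : ℂ, a * (b * c) = b * (a * c) := fun a b c => by ring
    simp only [e _ (tentDeriv s₁ σ₁ t)]
    rw [integral_const_mul, integral_const_mul, this]
  have hfirst : ∫ t in square ρ, f (tent s₁ δ₁ σ₁ t.1, tent s₂ δ₂' σ₂' t.2) *
        (tentDeriv s₁ σ₁ t.1 * tentDeriv s₂ σ₂' t.2) =
      ∫ t in square ρ, f (tent s₁ δ₁' σ₁' t.1, tent s₂ δ₂' σ₂' t.2) *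
        (tentDeriv s₁ σ₁' t.1 * tentDeriv s₂ σ₂' t.2) := by
    rw [IntegrableOn, volume_restrict_square] at hm hi'
    rw [volume_restrict_square, integral_prod_symm _ hm, integral_prod_symm _ hi']
    refine setIntegral_congr_fun measurableSet_Ioo fun t ht => ?_
    have hd : DifferentiableOn ℂ (fun z => f (z, tent s₂ δ₂' σ₂' t))
        (Complex.slitPlane ∩ Metric.ball 0 R) :=
      hf.comp (by fun_prop) fun z hz => ⟨hz, h₂' t (Ioo_subset_Icc_self ht)⟩
    have := integral_tent_eq_integral_tent hd hs₁ hρ h₁ h₁' he₁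
    rw [← setIntegral_Ioo_eq _ hρ, ← setIntegral_Ioo_eq _ hρ] at this
    simp only [← mul_assoc]
    rw [integral_mul_const, integral_mul_const, this]
  exact hsecond.trans hfirst

/-! ### The leading term by rescaling -/

theorem ofReal_mul_cpow {r : ℝ} (hr : 0 < r) {w : ℂ} (hw : w ≠ 0) (c : ℂ) :
    ((r : ℂ) * w) ^ c = (r : ℂ) ^ c * w ^ c := by
  have hr' : (r : ℂ) ≠ 0 := by exact_mod_cast hr.ne'
  rw [Complex.cpow_def_of_ne_zero (mul_ne_zero hr' hw), Complex.cpow_def_of_ne_zero hr',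
    Complex.cpow_def_of_ne_zero hw, Complex.log_ofReal_mul hr hw, Complex.ofReal_log hr.le,
    ← Complex.exp_add, add_mul]

theorem tentDeriv_mul {r : ℝ} (hr : 0 < r) (s σ t : ℝ) :
    tentDeriv s σ (r * t) = tentDeriv s σ t := by
  simp [tentDeriv, mul_pos_iff_of_pos_left hr]

/-- Asymptotics of `∫∫ G e^{-i r P}` over a product of tents, in the rotated coordinates, when `G`
behaves as `B w₁ ^ (-μ₁) w₂ ^ (-μ₂)` and `P` as `P 0 + i (a₁ w₁ + a₂ w₂)` at the origin.
Cauchy's theorem lowers the tips of the tents to height `1 / r`; after rescaling by `r` the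
integrand is dominated by a fixed exponential, and its limit is a product of two Hankel
integrands. -/
theorem tendsto_integral_tent {G P : ℂ × ℂ → ℂ} {R : ℝ} {μ₁ μ₂ B : ℂ} {s₁ s₂ a₁ a₂ : ℝ}
    (hs₁ : s₁ = 1 ∨ s₁ = -1) (hs₂ : s₂ = 1 ∨ s₂ = -1) (ha₁ : 0 < a₁) (ha₂ : 0 < a₂)
    (hG : DifferentiableOn ℂ G (cutBox R)) (hP : DifferentiableOn ℂ P (cutBox R))
    (hlead : Tendsto (fun w : ℂ × ℂ => G w / (w.1 ^ (-μ₁) * w.2 ^ (-μ₂))) (𝓝[cutBox R] 0) (𝓝 B))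
    {K : ℝ} (hbd : ∀ w ∈ cutBox R, ‖G w / (w.1 ^ (-μ₁) * w.2 ^ (-μ₂))‖ ≤ K)
    (hP0 : (P 0).im = 0)
    (hPd : HasFDerivAt P (Complex.I • (a₁ • ContinuousLinearMap.fst ℂ ℂ ℂ +
      a₂ • ContinuousLinearMap.snd ℂ ℂ ℂ)) 0)
    {σ₁ σ₂ ρ δ₀ : ℝ} (hσ₁ : 0 < σ₁) (hσ₂ : 0 < σ₂) (hρ : 0 < ρ) (hδ₀ : 0 < δ₀)
    (hball₁ : ∀ δ ∈ Ioc 0 δ₀, ∀ t ∈ Icc (-ρ) ρ, ‖tent s₁ δ (σ₁ + δ / ρ) t‖ < R)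
    (hball₂ : ∀ δ ∈ Ioc 0 δ₀, ∀ t ∈ Icc (-ρ) ρ, ‖tent s₂ δ (σ₂ + δ / ρ) t‖ < R)
    {C c : ℝ} (hc : 0 < c)
    (hPim : ∀ δ ∈ Ioc 0 δ₀, ∀ t ∈ square ρ,
      (P (tent s₁ δ (σ₁ + δ / ρ) t.1, tent s₂ δ (σ₂ + δ / ρ) t.2)).im ≤
        C * δ - c * (|t.1| + |t.2|)) :
    Tendsto (fun r : ℝ => (r : ℂ) ^ (2 - μ₁ - μ₂) * Complex.exp (Complex.I * r * P 0) *
      ∫ t in square ρ, (G (tent s₁ δ₀ (σ₁ + δ₀ / ρ) t.1, tent s₂ δ₀ (σ₂ + δ₀ / ρ) t.2) *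
        Complex.exp (-Complex.I * r *
          P (tent s₁ δ₀ (σ₁ + δ₀ / ρ) t.1, tent s₂ δ₀ (σ₂ + δ₀ / ρ) t.2))) *
        (tentDeriv s₁ (σ₁ + δ₀ / ρ) t.1 * tentDeriv s₂ (σ₂ + δ₀ / ρ) t.2)) atTop
      (𝓝 (B * ((-Complex.I * s₁ * (2 * Real.pi * (a₁ : ℂ) ^ (μ₁ - 1) / Complex.Gamma μ₁)) *
        (-Complex.I * s₂ * (2 * Real.pi * (a₂ : ℂ) ^ (μ₂ - 1) / Complex.Gamma μ₂))))) := by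
  have hmem₁ : ∀ δ ∈ Ioc 0 δ₀, ∀ t ∈ Icc (-ρ) ρ,
      tent s₁ δ (σ₁ + δ / ρ) t ∈ Complex.slitPlane ∩ Metric.ball 0 R := fun δ hδ t ht =>
    ⟨tent_mem_slitPlane hs₁ hδ.1 _ _, by rw [mem_ball_zero_iff]; exact hball₁ δ hδ t ht⟩
  have hmem₂ : ∀ δ ∈ Ioc 0 δ₀, ∀ t ∈ Icc (-ρ) ρ,
      tent s₂ δ (σ₂ + δ / ρ) t ∈ Complex.slitPlane ∩ Metric.ball 0 R := fun δ hδ t ht =>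
    ⟨tent_mem_slitPlane hs₂ hδ.1 _ _, by rw [mem_ball_zero_iff]; exact hball₂ δ hδ t ht⟩
  set f : ℝ → ℂ × ℂ → ℂ := fun r w => G w * Complex.exp (-Complex.I * r * P w) with hf
  have hfd : ∀ r, DifferentiableOn ℂ (f r) (cutBox R) := fun r => by fun_prop
  -- the slopes at tip height `1 / r`, the rescaled points, and the rescaled integrand
  set S₁ : ℝ → ℝ := fun r => σ₁ + r⁻¹ / ρ with hS₁
  set S₂ : ℝ → ℝ := fun r => σ₂ + r⁻¹ / ρ with hS₂
  set W : ℝ → ℝ × ℝ → ℂ × ℂ := fun r τ => (tent s₁ 1 (S₁ r) τ.1, tent s₂ 1 (S₂ r) τ.2) with hW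
  set Q : ℂ × ℂ → ℂ := fun w => G w / (w.1 ^ (-μ₁) * w.2 ^ (-μ₂)) with hQ
  set T : ℝ → ℝ × ℝ → ℂ := fun r t => f r (tent s₁ r⁻¹ (S₁ r) t.1, tent s₂ r⁻¹ (S₂ r) t.2) *
    (tentDeriv s₁ (S₁ r) t.1 * tentDeriv s₂ (S₂ r) t.2) with hT
  set Φ : ℝ → ℝ × ℝ → ℂ := fun r τ => (r : ℂ) ^ (-μ₁ - μ₂) * Complex.exp (Complex.I * r * P 0) *
    (square ρ).indicator (T r) (r⁻¹ • τ) with hΦ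
  have hscale : ∀ r > 0, ∀ τ : ℝ × ℝ,
      (tent s₁ r⁻¹ (S₁ r) (r⁻¹ * τ.1), tent s₂ r⁻¹ (S₂ r) (r⁻¹ * τ.2)) =
        ((r⁻¹ : ℝ) : ℂ) • W r τ := by
    intro r hr τ
    have h1 := tent_mul (inv_pos.2 hr).le s₁ 1 (S₁ r) τ.1
    have h2 := tent_mul (inv_pos.2 hr).le s₂ 1 (S₂ r) τ.2
    rw [mul_one] at h1 h2
    rw [h1, h2]
    rfl
  have hlarge : ∀ᶠ r : ℝ in atTop, 0 < r ∧ r⁻¹ ∈ Ioc 0 δ₀ := by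
    filter_upwards [eventually_gt_atTop 0, eventually_ge_atTop δ₀⁻¹] with r h0 h1
    exact ⟨h0, inv_pos.2 h0, inv_le_of_inv_le₀ hδ₀ h1⟩
  have hWbox : ∀ r : ℝ, 0 < r → r⁻¹ ∈ Ioc 0 δ₀ → ∀ τ : ℝ × ℝ, r⁻¹ • τ ∈ square ρ →
      ((r⁻¹ : ℝ) : ℂ) • W r τ ∈ cutBox R := by
    intro r hr hr' τ hτ
    rw [← hscale r hr τ]
    have := square_subset_Icc ρ hτ
    exact ⟨hmem₁ _ hr' _ this.1, hmem₂ _ hr' _ this.2⟩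
  have hWslit : ∀ r τ, (W r τ).1 ∈ Complex.slitPlane ∧ (W r τ).2 ∈ Complex.slitPlane := fun r τ =>
    ⟨tent_mem_slitPlane hs₁ one_pos _ _, tent_mem_slitPlane hs₂ one_pos _ _⟩
  have hpow : ∀ w : ℂ, w ∈ Complex.slitPlane → ∀ ν : ℂ, w ^ ν ≠ 0 := fun w hw ν => by
    simp [Complex.cpow_eq_zero_iff, Complex.slitPlane_ne_zero hw]
  -- on the square the powers of `r` cancel
  have hΦ_eq : ∀ r : ℝ, 0 < r → r⁻¹ ∈ Ioc 0 δ₀ → ∀ τ : ℝ × ℝ, r⁻¹ • τ ∈ square ρ →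
      Φ r τ = Q (((r⁻¹ : ℝ) : ℂ) • W r τ) * ((W r τ).1 ^ (-μ₁) * (W r τ).2 ^ (-μ₂)) *
        Complex.exp (-Complex.I * r * (P (((r⁻¹ : ℝ) : ℂ) • W r τ) - P 0)) *
        (tentDeriv s₁ (S₁ r) τ.1 * tentDeriv s₂ (S₂ r) τ.2) := by
    intro r hr hr' τ hτ
    have hr0 : (r : ℂ) ≠ 0 := by exact_mod_cast hr.ne'
    have hbox := hWbox r hr hr' τ hτ
    have hGQ : G (((r⁻¹ : ℝ) : ℂ) • W r τ) = Q (((r⁻¹ : ℝ) : ℂ) • W r τ) *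
        (((r : ℂ) ^ μ₁ * (W r τ).1 ^ (-μ₁)) * ((r : ℂ) ^ μ₂ * (W r τ).2 ^ (-μ₂))) := by
      have hinv : ∀ ν : ℂ, ((r⁻¹ : ℝ) : ℂ) ^ (-ν) = (r : ℂ) ^ ν := fun ν => by
        rw [Complex.ofReal_inv, Complex.inv_cpow _ _ (by
          rw [Complex.arg_ofReal_of_nonneg hr.le]; exact Real.pi_pos.ne), Complex.cpow_neg, inv_inv]
      have e1 := ofReal_mul_cpow (inv_pos.2 hr) (Complex.slitPlane_ne_zero (hWslit r τ).1) (-μ₁)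
      have e2 := ofReal_mul_cpow (inv_pos.2 hr) (Complex.slitPlane_ne_zero (hWslit r τ).2) (-μ₂)
      rw [hinv] at e1 e2
      rw [← e1, ← e2, hQ]
      refine (div_mul_cancel₀ _ (mul_ne_zero ?_ ?_)).symm
      · exact hpow _ hbox.1.1 _
      · exact hpow _ hbox.2.1 _
    have hTr : T r (r⁻¹ • τ) = f r (((r⁻¹ : ℝ) : ℂ) • W r τ) *
        (tentDeriv s₁ (S₁ r) τ.1 * tentDeriv s₂ (S₂ r) τ.2) := by
      simp only [hT, Prod.smul_fst, Prod.smul_snd, smul_eq_mul, tentDeriv_mul (inv_pos.2 hr)]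
      rw [hscale r hr τ]
    simp only [hΦ, indicator_of_mem hτ]
    rw [hTr, hf]
    simp only
    rw [hGQ]
    have h1 : (r : ℂ) ^ (-μ₁ - μ₂) * ((r : ℂ) ^ μ₁ * (r : ℂ) ^ μ₂) = 1 := by
      rw [← Complex.cpow_add _ _ hr0, ← Complex.cpow_add _ _ hr0,
        show -μ₁ - μ₂ + (μ₁ + μ₂) = 0 by ring, Complex.cpow_zero]
    have h2 : Complex.exp (-Complex.I * r * (P (((r⁻¹ : ℝ) : ℂ) • W r τ) - P 0)) =
        Complex.exp (Complex.I * r * P 0) *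
          Complex.exp (-Complex.I * r * P (((r⁻¹ : ℝ) : ℂ) • W r τ)) := by
      rw [← Complex.exp_add]; congr 1; ring
    rw [h2]
    linear_combination (Q (((r⁻¹ : ℝ) : ℂ) • W r τ) * ((W r τ).1 ^ (-μ₁) * (W r τ).2 ^ (-μ₂)) *
      (Complex.exp (Complex.I * r * P 0) *
          Complex.exp (-Complex.I * r * P (((r⁻¹ : ℝ) : ℂ) • W r τ))) *
      (tentDeriv s₁ (S₁ r) τ.1 * tentDeriv s₂ (S₂ r) τ.2)) * h1
  -- the integral is the integral of `Φ r` over the plane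
  have hint : ∀ᶠ r : ℝ in atTop, Integrable (Φ r) ∧
      (r : ℂ) ^ (2 - μ₁ - μ₂) * Complex.exp (Complex.I * r * P 0) *
      ∫ t in square ρ, f r (tent s₁ δ₀ (σ₁ + δ₀ / ρ) t.1, tent s₂ δ₀ (σ₂ + δ₀ / ρ) t.2) *
        (tentDeriv s₁ (σ₁ + δ₀ / ρ) t.1 * tentDeriv s₂ (σ₂ + δ₀ / ρ) t.2) = ∫ τ, Φ r τ := by
    filter_upwards [hlarge] with r ⟨hr, hr'⟩
    have hr0 : (r : ℂ) ≠ 0 := by exact_mod_cast hr.ne'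
    have hTi : IntegrableOn (T r) (square ρ) :=
      integrableOn_square_tent (hfd r).continuousOn hs₁ hs₂ fun t ht =>
        ⟨hmem₁ _ hr' _ ht.1, hmem₂ _ hr' _ ht.2⟩
    have hTi' : Integrable ((square ρ).indicator (T r)) :=
      (integrable_indicator_iff (measurableSet_square ρ)).2 hTi
    refine ⟨(hTi'.comp_smul (inv_pos.2 hr).ne').const_mul _, ?_⟩
    have hδ₀' : δ₀ ∈ Ioc 0 δ₀ := ⟨hδ₀, le_rfl⟩
    rw [integral_square_tent_eq (hfd r) hs₁ hs₂ hρ.le (hmem₁ δ₀ hδ₀') (hmem₁ _ hr')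
      (hmem₂ δ₀ hδ₀') (hmem₂ _ hr') (by field_simp; ring) (by field_simp; ring)]
    simp only [hΦ]
    rw [integral_const_mul, Measure.integral_comp_smul, integral_indicator (measurableSet_square ρ)]
    have hfin : Module.finrank ℝ (ℝ × ℝ) = 2 := by simp
    rw [hfin, show (2 - μ₁ - μ₂) = (-μ₁ - μ₂) + 2 by ring, Complex.cpow_add _ _ hr0]
    have : |((r⁻¹ ^ 2)⁻¹ : ℝ)| = r ^ 2 := by
      rw [inv_pow, inv_inv, abs_of_nonneg (sq_nonneg r)]
    rw [this, Complex.real_smul]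
    have e2 : (r : ℂ) ^ (2 : ℂ) = ((r ^ 2 : ℝ) : ℂ) := by
      rw [show (2 : ℂ) = ((2 : ℕ) : ℂ) by norm_num, Complex.cpow_natCast]; push_cast; rfl
    rw [e2]
    ring
  refine Tendsto.congr' (hint.mono fun r hr => hr.2.symm) ?_
  -- the dominating function
  set M : ℝ := max σ₁ σ₂ + δ₀ / ρ with hM
  have hM0 : 0 ≤ M := by have := lt_max_of_lt_left (b := σ₁) (c := σ₂) hσ₁; positivity
  obtain ⟨C₁, hC₁0, hC₁⟩ := exists_norm_tent_cpow_le hs₁ μ₁ hM0 (κ := c / 2) (by positivity)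
  obtain ⟨C₂, hC₂0, hC₂⟩ := exists_norm_tent_cpow_le hs₂ μ₂ hM0 (κ := c / 2) (by positivity)
  have hslope : ∀ r : ℝ, 0 < r → r⁻¹ ∈ Ioc 0 δ₀ → S₁ r ∈ Icc 0 M ∧ S₂ r ∈ Icc 0 M := by
    intro r hr hr'
    have h1 : r⁻¹ / ρ ≤ δ₀ / ρ := by gcongr; exact hr'.2
    have h2 : 0 < r⁻¹ / ρ := by positivity
    exact ⟨⟨by simp only [hS₁]; linarith, add_le_add (le_max_left _ _) h1⟩,
      ⟨by simp only [hS₂]; linarith, add_le_add (le_max_right _ _) h1⟩⟩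
  set bound : ℝ × ℝ → ℝ := fun τ => (|K| * (C₁ * C₂) * Real.exp C * ((M + 1) * (M + 1))) *
    (Real.exp (-(c / 2) * |τ.1|) * Real.exp (-(c / 2) * |τ.2|)) with hbound
  have hbi : Integrable bound :=
    ((integrable_exp_neg_mul_abs (c := c / 2) (by positivity)).mul_prod
      (integrable_exp_neg_mul_abs (c := c / 2) (by positivity))).const_mul _
  have hdom : ∀ᶠ r : ℝ in atTop, ∀ᵐ τ : ℝ × ℝ, ‖Φ r τ‖ ≤ bound τ := by
    filter_upwards [hlarge] with r ⟨hr, hr'⟩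
    refine Eventually.of_forall fun τ => ?_
    by_cases hτ : r⁻¹ • τ ∈ square ρ
    · rw [hΦ_eq r hr hr' τ hτ]
      obtain ⟨hs1, hs2⟩ := hslope r hr hr'
      have n1 : ‖Q (((r⁻¹ : ℝ) : ℂ) • W r τ)‖ ≤ |K| :=
        (hbd _ (hWbox r hr hr' τ hτ)).trans (le_abs_self K)
      have n2 := hC₁ _ hs1 τ.1
      have n3 := hC₂ _ hs2 τ.2
      have n4 : ‖tentDeriv s₁ (S₁ r) τ.1‖ ≤ M + 1 :=
        (norm_tentDeriv_le hs₁ _ _).trans (by rw [abs_of_nonneg hs1.1]; linarith [hs1.2])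
      have n5 : ‖tentDeriv s₂ (S₂ r) τ.2‖ ≤ M + 1 :=
        (norm_tentDeriv_le hs₂ _ _).trans (by rw [abs_of_nonneg hs2.1]; linarith [hs2.2])
      have n6 : ‖Complex.exp (-Complex.I * r * (P (((r⁻¹ : ℝ) : ℂ) • W r τ) - P 0))‖ ≤
          Real.exp (C - c * (|τ.1| + |τ.2|)) := by
        rw [Complex.norm_exp]
        apply Real.exp_le_exp.2
        have h1 : (-Complex.I * r * (P (((r⁻¹ : ℝ) : ℂ) • W r τ) - P 0)).re =
            r * (P (((r⁻¹ : ℝ) : ℂ) • W r τ)).im := by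
          simp [hP0]
        have h2 := hPim r⁻¹ hr' (r⁻¹ • τ) hτ
        simp only [Prod.smul_fst, Prod.smul_snd, smul_eq_mul] at h2
        rw [hscale r hr τ, abs_mul, abs_mul, abs_of_pos (inv_pos.2 hr)] at h2
        rw [h1]
        calc r * (P (((r⁻¹ : ℝ) : ℂ) • W r τ)).im
            ≤ r * (C * r⁻¹ - c * (r⁻¹ * |τ.1| + r⁻¹ * |τ.2|)) := by gcongr
          _ = C - c * (|τ.1| + |τ.2|) := by field_simp
      have hexp : Real.exp (c / 2 * |τ.1|) * Real.exp (c / 2 * |τ.2|) *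
          Real.exp (C - c * (|τ.1| + |τ.2|)) =
          Real.exp C * (Real.exp (-(c / 2) * |τ.1|) * Real.exp (-(c / 2) * |τ.2|)) := by
        simp only [← Real.exp_add]; congr 1; ring
      calc _ = ‖Q (((r⁻¹ : ℝ) : ℂ) • W r τ)‖ * (‖(W r τ).1 ^ (-μ₁)‖ * ‖(W r τ).2 ^ (-μ₂)‖) *
            ‖Complex.exp (-Complex.I * r * (P (((r⁻¹ : ℝ) : ℂ) • W r τ) - P 0))‖ *
            (‖tentDeriv s₁ (S₁ r) τ.1‖ * ‖tentDeriv s₂ (S₂ r) τ.2‖) := by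
            simp only [norm_mul]
        _ ≤ |K| * ((C₁ * Real.exp (c / 2 * |τ.1|)) * (C₂ * Real.exp (c / 2 * |τ.2|))) *
            Real.exp (C - c * (|τ.1| + |τ.2|)) * ((M + 1) * (M + 1)) := by
            gcongr
        _ = |K| * (C₁ * C₂) * (Real.exp (c / 2 * |τ.1|) * Real.exp (c / 2 * |τ.2|) *
            Real.exp (C - c * (|τ.1| + |τ.2|))) * ((M + 1) * (M + 1)) := by ring
        _ = bound τ := by rw [hexp, hbound]; ring
    · have : Φ r τ = 0 := by simp [hΦ, indicator_of_notMem hτ]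
      rw [this, norm_zero, hbound]
      positivity
  -- the pointwise limit
  set L : ℝ × ℝ → ℂ := fun τ => B *
    ((tent s₁ 1 σ₁ τ.1 ^ (-μ₁) * Complex.exp (a₁ * tent s₁ 1 σ₁ τ.1) * tentDeriv s₁ σ₁ τ.1) *
      (tent s₂ 1 σ₂ τ.2 ^ (-μ₂) * Complex.exp (a₂ * tent s₂ 1 σ₂ τ.2) * tentDeriv s₂ σ₂ τ.2))
    with hL
  have hlim : ∀ᵐ τ : ℝ × ℝ, Tendsto (fun r => Φ r τ) atTop (𝓝 (L τ)) := by
    refine Eventually.of_forall fun τ => ?_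
    have hinv0 : Tendsto (fun r : ℝ => r⁻¹) atTop (𝓝 0) := tendsto_inv_atTop_zero
    have hSl₁ : Tendsto S₁ atTop (𝓝 σ₁) := by simpa using (hinv0.div_const ρ).const_add σ₁
    have hSl₂ : Tendsto S₂ atTop (𝓝 σ₂) := by simpa using (hinv0.div_const ρ).const_add σ₂
    have ht : ∀ (s u : ℝ), Continuous fun σ => tent s 1 σ u := fun s u => by
      unfold tent; fun_prop
    have hdt : ∀ (s u : ℝ), Continuous fun σ => tentDeriv s σ u := fun s u => by
      unfold tentDeriv; split_ifs <;> fun_prop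
    have hW1 : Tendsto (fun r => (W r τ).1) atTop (𝓝 (tent s₁ 1 σ₁ τ.1)) :=
      ((ht s₁ τ.1).tendsto σ₁).comp hSl₁
    have hW2 : Tendsto (fun r => (W r τ).2) atTop (𝓝 (tent s₂ 1 σ₂ τ.2)) :=
      ((ht s₂ τ.2).tendsto σ₂).comp hSl₂
    have hWt : Tendsto (fun r => W r τ) atTop (𝓝 (tent s₁ 1 σ₁ τ.1, tent s₂ 1 σ₂ τ.2)) :=
      hW1.prodMk_nhds hW2
    have hz : Tendsto (fun r : ℝ => ((r⁻¹ : ℝ) : ℂ) • W r τ) atTop (𝓝 0) := by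
      have h1 : Tendsto (fun r : ℝ => ((r⁻¹ : ℝ) : ℂ)) atTop (𝓝 ((0 : ℝ) : ℂ)) :=
        (Complex.continuous_ofReal.tendsto 0).comp hinv0
      have := h1.smul hWt
      simpa only [Complex.ofReal_zero, zero_smul] using this
    have hsq : ∀ᶠ r : ℝ in atTop, r⁻¹ • τ ∈ square ρ := by
      have h1 : Tendsto (fun r : ℝ => r⁻¹ • τ) atTop (𝓝 0) := by
        have := hinv0.smul_const τ
        rwa [zero_smul] at this
      refine h1.eventually (IsOpen.mem_nhds (isOpen_Ioo.prod isOpen_Ioo) ?_)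
      exact ⟨⟨by simpa using hρ, by simpa using hρ⟩, ⟨by simpa using hρ, by simpa using hρ⟩⟩
    have hQl : Tendsto (fun r : ℝ => Q (((r⁻¹ : ℝ) : ℂ) • W r τ)) atTop (𝓝 B) := by
      refine hlead.comp (tendsto_nhdsWithin_iff.2 ⟨hz, ?_⟩)
      filter_upwards [hlarge, hsq] with r ⟨hr, hr'⟩ hτ using hWbox r hr hr' τ hτ
    have hpw : ∀ (w : ℂ) (ν : ℂ), w ∈ Complex.slitPlane → ContinuousAt (fun z : ℂ => z ^ ν) w :=
      fun w ν hw => by fun_prop (disch := assumption)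
    have hp1 : Tendsto (fun r => (W r τ).1 ^ (-μ₁)) atTop (𝓝 (tent s₁ 1 σ₁ τ.1 ^ (-μ₁))) :=
      (hpw _ _ (tent_mem_slitPlane hs₁ one_pos _ _)).tendsto.comp hW1
    have hp2 : Tendsto (fun r => (W r τ).2 ^ (-μ₂)) atTop (𝓝 (tent s₂ 1 σ₂ τ.2 ^ (-μ₂))) :=
      (hpw _ _ (tent_mem_slitPlane hs₂ one_pos _ _)).tendsto.comp hW2
    -- `r (P (W / r) - P 0)` tends to the derivative of `P` in the direction of the limit of `W`
    have hPl : Tendsto (fun r : ℝ => (r : ℂ) * (P (((r⁻¹ : ℝ) : ℂ) • W r τ) - P 0)) atTop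
        (𝓝 (Complex.I * (a₁ * tent s₁ 1 σ₁ τ.1 + a₂ * tent s₂ 1 σ₂ τ.2))) := by
      have hcd : Tendsto (fun r : ℝ => (r : ℂ) • (((r⁻¹ : ℝ) : ℂ) • W r τ)) atTop
          (𝓝 (tent s₁ 1 σ₁ τ.1, tent s₂ 1 σ₂ τ.2)) := by
        refine hWt.congr' ?_
        filter_upwards [eventually_gt_atTop 0] with r hr
        have hr0 : (r : ℂ) ≠ 0 := by exact_mod_cast hr.ne'
        rw [smul_smul, Complex.ofReal_inv, mul_inv_cancel₀ hr0, one_smul]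
      have h := (hPd.hasFDerivWithinAt (s := univ)).lim hz
        (Eventually.of_forall fun _ => mem_univ _) hcd
      simpa [mul_add] using h
    have hexp : Tendsto (fun r : ℝ =>
        Complex.exp (-Complex.I * r * (P (((r⁻¹ : ℝ) : ℂ) • W r τ) - P 0))) atTop
        (𝓝 (Complex.exp (a₁ * tent s₁ 1 σ₁ τ.1) * Complex.exp (a₂ * tent s₂ 1 σ₂ τ.2))) := by
      have h1 := (hPl.const_mul (-Complex.I)).cexp
      have h2 : -Complex.I * (Complex.I * (a₁ * tent s₁ 1 σ₁ τ.1 + a₂ * tent s₂ 1 σ₂ τ.2)) =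
          a₁ * tent s₁ 1 σ₁ τ.1 + a₂ * tent s₂ 1 σ₂ τ.2 := by
        linear_combination (-(a₁ * tent s₁ 1 σ₁ τ.1 + a₂ * tent s₂ 1 σ₂ τ.2)) * Complex.I_mul_I
      rw [h2, Complex.exp_add] at h1
      refine h1.congr fun r => ?_
      rw [mul_assoc]
    have hd1 : Tendsto (fun r => tentDeriv s₁ (S₁ r) τ.1) atTop (𝓝 (tentDeriv s₁ σ₁ τ.1)) :=
      ((hdt s₁ τ.1).tendsto σ₁).comp hSl₁
    have hd2 : Tendsto (fun r => tentDeriv s₂ (S₂ r) τ.2) atTop (𝓝 (tentDeriv s₂ σ₂ τ.2)) :=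
      ((hdt s₂ τ.2).tendsto σ₂).comp hSl₂
    have hall := ((hQl.mul (hp1.mul hp2)).mul hexp).mul (hd1.mul hd2)
    have hLτ : L τ = B * (tent s₁ 1 σ₁ τ.1 ^ (-μ₁) * tent s₂ 1 σ₂ τ.2 ^ (-μ₂)) *
        (Complex.exp (a₁ * tent s₁ 1 σ₁ τ.1) * Complex.exp (a₂ * tent s₂ 1 σ₂ τ.2)) *
        (tentDeriv s₁ σ₁ τ.1 * tentDeriv s₂ σ₂ τ.2) := by
      rw [hL]; ring
    rw [hLτ]
    refine hall.congr' ?_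
    filter_upwards [hlarge, hsq] with r ⟨hr, hr'⟩ hτ using (hΦ_eq r hr hr' τ hτ).symm
  have hfinal := tendsto_integral_filter_of_dominated_convergence bound
    (hint.mono fun r hr => hr.1.aestronglyMeasurable) hdom hbi hlim
  have hval : ∫ τ, L τ = B *
      ((-Complex.I * s₁ * (2 * Real.pi * (a₁ : ℂ) ^ (μ₁ - 1) / Complex.Gamma μ₁)) *
        (-Complex.I * s₂ * (2 * Real.pi * (a₂ : ℂ) ^ (μ₂ - 1) / Complex.Gamma μ₂))) := by
    rw [hL, integral_const_mul, Measure.volume_eq_prod, integral_prod_mul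
      (fun u : ℝ => tent s₁ 1 σ₁ u ^ (-μ₁) * Complex.exp (a₁ * tent s₁ 1 σ₁ u) * tentDeriv s₁ σ₁ u)
      (fun u : ℝ => tent s₂ 1 σ₂ u ^ (-μ₂) * Complex.exp (a₂ * tent s₂ 1 σ₂ u) * tentDeriv s₂ σ₂ u),
      integral_tent_hankel hs₁ μ₁ ha₁ hσ₁, integral_tent_hankel hs₂ μ₂ ha₂ hσ₂]
  rw [← hval]
  exact hfinal

/-! ### The local integral in the variables of the normal crossing -/

section LocalIntegral

variable {g₁ g₂ F : ℂ × ℂ → ℂ} {ξ : ℝ × ℝ} {φ : ℂ × ℂ → ℂ × ℂ} {s₁ s₂ : ℝ} {μ₁ μ₂ A : ℂ}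

/-- The points `ζ` with `ζ_j ∉ -i s_j [0, ∞)`. -/
def cutPairs (s₁ s₂ : ℝ) : Set (ℂ × ℂ) :=
  {ζ | -Complex.I * s₁ * ζ.1 ∈ Complex.slitPlane ∧ -Complex.I * s₂ * ζ.2 ∈ Complex.slitPlane}

/-- The leading coefficient of `F` and the Jacobian of `φ` combine to `A / Δ`. -/
theorem IsLocalInverse.tendsto_lead (hg₁ : RealProperty g₁) (hg₂ : RealProperty g₂)
    (hΔ : 0 < crossDet g₁ g₂ ξ) (hφ : IsLocalInverse g₁ g₂ ξ φ)
    (hF : CrossingBehaviour F g₁ g₂ s₁ s₂ μ₁ μ₂ A ξ) :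
    Tendsto (fun ζ => F (φ ζ) / (branchPow s₁ μ₁ ζ.1 * branchPow s₂ μ₂ ζ.2) * jacDet φ ζ)
      (𝓝[cutPairs s₁ s₂] 0) (𝓝 (A / crossDet g₁ g₂ ξ)) := by
  have hφc : Tendsto φ (𝓝 0) (𝓝 (toC ξ)) := hφ.base ▸ hφ.analytic.continuousAt
  have hφw : Tendsto φ (𝓝[cutPairs s₁ s₂] 0) (𝓝[cutDomain g₁ g₂ s₁ s₂] (toC ξ)) := by
    refine tendsto_nhdsWithin_iff.2 ⟨hφc.mono_left nhdsWithin_le_nhds, ?_⟩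
    filter_upwards [self_mem_nhdsWithin, nhdsWithin_le_nhds hφ.inverse] with ζ hζ hi
    have e1 : g₁ (φ ζ) = ζ.1 := congrArg Prod.fst hi
    have e2 : g₂ (φ ζ) = ζ.2 := congrArg Prod.snd hi
    rw [cutDomain, mem_ofPred_eq, e1, e2]
    exact hζ
  have hj : Tendsto (jacDet φ) (𝓝[cutPairs s₁ s₂] 0) (𝓝 (1 / crossDet g₁ g₂ ξ)) := by
    have := (AnalyticAt.jacDet hφ.analytic).continuousAt.tendsto
    rw [IsLocalInverse.jacDet_zero hg₁ hg₂ hΔ hφ] at this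
    exact this.mono_left nhdsWithin_le_nhds
  have h := (hF.lead.comp hφw).mul hj
  rw [mul_one_div] at h
  refine h.congr' ?_
  filter_upwards [nhdsWithin_le_nhds hφ.inverse] with ζ hi
  have e1 : g₁ (φ ζ) = ζ.1 := congrArg Prod.fst hi
  have e2 : g₂ (φ ζ) = ζ.2 := congrArg Prod.snd hi
  simp only [Function.comp_apply, e1, e2]

/-- A ball on which `φ` is an analytic inverse of `(g₁, g₂)`, while `F ∘ φ` is holomorphic off the
cuts, and of the size of its leading term. -/
theorem IsLocalInverse.exists_radius (hg₁ : RealProperty g₁) (hg₂ : RealProperty g₂)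
    (hΔ : 0 < crossDet g₁ g₂ ξ) (hφ : IsLocalInverse g₁ g₂ ξ φ)
    (hF : CrossingBehaviour F g₁ g₂ s₁ s₂ μ₁ μ₂ A ξ) :
    ∃ R > 0, ∃ K : ℝ, ∀ ζ : ℂ × ℂ, ‖ζ‖ < R → AnalyticAt ℂ φ ζ ∧ (g₁ (φ ζ), g₂ (φ ζ)) = ζ ∧
      (ζ ∈ cutPairs s₁ s₂ → DifferentiableAt ℂ F (φ ζ) ∧
        ‖F (φ ζ) / (branchPow s₁ μ₁ ζ.1 * branchPow s₂ μ₂ ζ.2) * jacDet φ ζ‖ ≤ K) := by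
  have hφc : Tendsto φ (𝓝 0) (𝓝 (toC ξ)) := hφ.base ▸ hφ.analytic.continuousAt
  have h1 := hφc.eventually (eventually_nhdsWithin_iff.1 hF.holo)
  have h2 := eventually_nhdsWithin_iff.1
    ((IsLocalInverse.tendsto_lead hg₁ hg₂ hΔ hφ hF).norm.eventually_le_const
      (lt_add_one ‖A / (crossDet g₁ g₂ ξ : ℂ)‖))
  obtain ⟨R, hR, h⟩ := Metric.eventually_nhds_iff.1
    (((hφ.analytic.eventually_analyticAt.and hφ.inverse).and (h1.and h2)))
  refine ⟨R, hR, ‖A / (crossDet g₁ g₂ ξ : ℂ)‖ + 1, fun ζ hζ => ?_⟩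
  obtain ⟨⟨ha, hi⟩, hd, hb⟩ := h (by rwa [dist_zero_right])
  refine ⟨ha, hi, fun hc => ⟨hd ?_, hb hc⟩⟩
  have e1 : g₁ (φ ζ) = ζ.1 := congrArg Prod.fst hi
  have e2 : g₂ (φ ζ) = ζ.2 := congrArg Prod.snd hi
  rw [cutDomain, mem_ofPred_eq, e1, e2]
  exact hc

theorem norm_cplx_le (t y : ℝ × ℝ) : ‖cplx t y‖ ≤ ‖t‖ + ‖y‖ := by
  have key : ∀ a b : ℝ, ‖(a : ℂ) + Complex.I * b‖ ≤ |a| + |b| := fun a b =>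
    (norm_add_le _ _).trans (by simp)
  refine max_le ((key _ _).trans ?_) ((key _ _).trans ?_)
  · exact add_le_add (norm_fst_le t) (norm_fst_le y)
  · exact add_le_add (norm_snd_le t) (norm_snd_le y)

theorem cplx_mem_cutPairs (hs₁ : s₁ = 1 ∨ s₁ = -1) (hs₂ : s₂ = 1 ∨ s₂ = -1) {t y : ℝ × ℝ}
    (h₁ : t.1 = 0 → 0 < s₁ * y.1) (h₂ : t.2 = 0 → 0 < s₂ * y.2) :
    cplx t y ∈ cutPairs s₁ s₂ := by
  have key : ∀ s a b : ℝ, (s = 1 ∨ s = -1) → (a = 0 → 0 < s * b) →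
      -Complex.I * s * ((a : ℂ) + Complex.I * b) ∈ Complex.slitPlane := by
    intro s a b hs h
    have hre : (-Complex.I * s * ((a : ℂ) + Complex.I * b)).re = s * b := by simp
    have him : (-Complex.I * s * ((a : ℂ) + Complex.I * b)).im = -(s * a) := by simp
    rw [Complex.mem_slitPlane_iff, hre, him]
    by_cases ha : a = 0
    · exact Or.inl (h ha)
    · refine Or.inr (neg_ne_zero.2 (mul_ne_zero ?_ ha))
      rcases hs with rfl | rfl <;> norm_num
  exact ⟨key _ _ _ hs₁ h₁, key _ _ _ hs₂ h₂⟩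

theorem closure_square {ρ : ℝ} (hρ : 0 < ρ) : closure (square ρ) = Icc (-ρ) ρ ×ˢ Icc (-ρ) ρ := by
  rw [square, closure_prod_eq, closure_Ioo (by linarith)]

theorem norm_le_of_mem_closure_square {ρ : ℝ} (hρ : 0 < ρ) {t : ℝ × ℝ}
    (ht : t ∈ closure (square ρ)) : ‖t‖ ≤ ρ := by
  rw [closure_square hρ] at ht
  exact max_le (abs_le.2 ht.1) (abs_le.2 ht.2)

theorem norm_eq_of_mem_frontier_square {ρ : ℝ} (hρ : 0 < ρ) {t : ℝ × ℝ}
    (ht : t ∈ frontier (square ρ)) : ‖t‖ = ρ := by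
  have ho : IsOpen (square ρ) := isOpen_Ioo.prod isOpen_Ioo
  rw [ho.frontier_eq] at ht
  refine le_antisymm (norm_le_of_mem_closure_square hρ ht.1) ?_
  by_contra! h
  refine ht.2 ⟨abs_lt.1 ?_, abs_lt.1 ?_⟩
  · exact (norm_fst_le t).trans_lt h
  · exact (norm_snd_le t).trans_lt h

/-- A surface over the square is flattable as soon as it stays in the domain of the local inverse
and bypasses the two traces, because `g_j` is the coordinate `ζ_j`. -/
theorem suitableSurface_of_bridge {R ρ : ℝ} (hs₁ : s₁ = 1 ∨ s₁ = -1) (hs₂ : s₂ = 1 ∨ s₂ = -1)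
    (hinv : ∀ ζ : ℂ × ℂ, ‖ζ‖ < R → (g₁ (φ ζ), g₂ (φ ζ)) = ζ) {x : ℝ × ℝ} {h : ℝ × ℝ → ℝ × ℝ}
    (hR : ∀ t ∈ closure (square ρ), ‖t‖ + ‖h t‖ < R)
    (hb₁ : ∀ t ∈ closure (square ρ), t.1 = 0 → 0 < s₁ * (h t).1)
    (hb₂ : ∀ t ∈ closure (square ρ), t.2 = 0 → 0 < s₂ * (h t).2)
    (hd : ∀ t ∈ frontier (square ρ), (phase φ x (cplx t (h t))).im < 0) :
    SuitableSurface g₁ g₂ φ s₁ s₂ x h ρ := by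
  refine ⟨fun t ht ε hε => ?_, hb₁, hb₂, hd⟩
  have hn : ‖cplx t (ε • h t)‖ < R := by
    refine (norm_cplx_le _ _).trans_lt (lt_of_le_of_lt ?_ (hR t ht))
    rw [norm_smul, Real.norm_eq_abs, abs_of_pos hε.1]
    have := mul_le_of_le_one_left (norm_nonneg (h t)) hε.2
    linarith
  have hi := hinv _ hn
  have hc := cplx_mem_cutPairs hs₁ hs₂ (t := t) (y := ε • h t)
    (fun h0 => by
      have := mul_pos hε.1 (hb₁ t ht h0)
      simp only [Prod.smul_fst, smul_eq_mul]
      linarith)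
    (fun h0 => by
      have := mul_pos hε.1 (hb₂ t ht h0)
      simp only [Prod.smul_snd, smul_eq_mul]
      linarith)
  rw [show surf φ (fun t => ε • h t) t = φ (cplx t (ε • h t)) from rfl,
    show g₁ (φ (cplx t (ε • h t))) = (cplx t (ε • h t)).1 from congrArg Prod.fst hi,
    show g₂ (φ (cplx t (ε • h t))) = (cplx t (ε • h t)).2 from congrArg Prod.snd hi]
  exact ⟨right_ne_zero_of_mul (Complex.slitPlane_ne_zero hc.1),
    right_ne_zero_of_mul (Complex.slitPlane_ne_zero hc.2)⟩

/-- The Jacobian of a surface whose field has its components in separate variables. -/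
theorem jac_surf {k₁ k₂ : ℝ → ℝ} {d₁ d₂ : ℝ} {t : ℝ × ℝ} (hk₁ : HasDerivAt k₁ d₁ t.1)
    (hk₂ : HasDerivAt k₂ d₂ t.2) (hφ : DifferentiableAt ℂ φ (cplx t (k₁ t.1, k₂ t.2))) :
    jac (surf φ fun t => (k₁ t.1, k₂ t.2)) t =
      jacDet φ (cplx t (k₁ t.1, k₂ t.2)) * ((1 + Complex.I * d₁) * (1 + Complex.I * d₂)) := by
  set ζ := cplx t (k₁ t.1, k₂ t.2) with hζ
  have hfd : HasFDerivAt φ ((fderiv ℂ φ ζ).restrictScalars ℝ) ζ :=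
    hφ.hasFDerivAt.restrictScalars ℝ
  have hc : ∀ {k : ℝ → ℝ} {d u : ℝ}, HasDerivAt k d u →
      HasDerivAt (fun y : ℝ => (y : ℂ) + Complex.I * (k y : ℂ)) (1 + Complex.I * d) u :=
    fun h => (Complex.ofRealCLM.hasDerivAt).add ((h.ofReal_comp).const_mul Complex.I)
  have e₁ : HasDerivAt (fun y : ℝ => φ (cplx (y, t.2) (k₁ y, k₂ t.2)))
      (fderiv ℂ φ ζ (1 + Complex.I * d₁, 0)) t.1 :=
    HasFDerivAt.comp_hasDerivAt (f := fun y : ℝ => cplx (y, t.2) (k₁ y, k₂ t.2)) t.1 hfd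
      ((hc hk₁).prodMk (hasDerivAt_const t.1 ((t.2 : ℂ) + Complex.I * (k₂ t.2 : ℂ))))
  have e₂ : HasDerivAt (fun y : ℝ => φ (cplx (t.1, y) (k₁ t.1, k₂ y)))
      (fderiv ℂ φ ζ (0, 1 + Complex.I * d₂)) t.2 :=
    HasFDerivAt.comp_hasDerivAt (f := fun y : ℝ => cplx (t.1, y) (k₁ t.1, k₂ y)) t.2 hfd
      ((hasDerivAt_const t.2 ((t.1 : ℂ) + Complex.I * (k₁ t.1 : ℂ))).prodMk (hc hk₂))
  have l₁ : fderiv ℂ φ ζ (1 + Complex.I * d₁, 0) = (1 + Complex.I * d₁) • fderiv ℂ φ ζ (1, 0) := by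
    rw [← map_smul]; simp
  have l₂ : fderiv ℂ φ ζ (0, 1 + Complex.I * d₂) = (1 + Complex.I * d₂) • fderiv ℂ φ ζ (0, 1) := by
    rw [← map_smul]; simp
  have hfst : ∀ {f : ℝ → ℂ × ℂ} {f' : ℂ × ℂ} {u : ℝ}, HasDerivAt f f' u →
      deriv (fun y => (f y).1) u = f'.1 ∧ deriv (fun y => (f y).2) u = f'.2 := fun h =>
    ⟨(HasFDerivAt.comp_hasDerivAt _ (ContinuousLinearMap.fst ℝ ℂ ℂ).hasFDerivAt h).deriv,
      (HasFDerivAt.comp_hasDerivAt _ (ContinuousLinearMap.snd ℝ ℂ ℂ).hasFDerivAt h).deriv⟩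
  have r₁ := hfst e₁
  have r₂ := hfst e₂
  rw [jac]
  simp only [surf]
  rw [r₁.1, r₁.2, r₂.1, r₂.2, l₁, l₂, jacDet]
  simp only [Prod.smul_fst, Prod.smul_snd, smul_eq_mul]
  ring

theorem integrand_smul (x : ℝ × ℝ) (r : ℝ) (h : ℝ × ℝ → ℝ × ℝ) (t : ℝ × ℝ) :
    integrand F (r • x) (surf φ h) t = F (φ (cplx t (h t))) *
      Complex.exp (-Complex.I * r * phase φ x (cplx t (h t))) * jac (surf φ h) t := by
  simp only [integrand, surf, phase, Prod.smul_fst, Prod.smul_snd, smul_eq_mul]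
  congr 3
  push_cast
  ring

/-! ### Inactive directions -/

/-- Over a constant field pointing against the direction of observation the integral decays
exponentially. -/
theorem IsLocalInverse.exists_exp_decay (hg₁ : RealProperty g₁) (hg₂ : RealProperty g₂)
    (hΔ : 0 < crossDet g₁ g₂ ξ) (hφ : IsLocalInverse g₁ g₂ ξ φ)
    (hs₁ : s₁ = 1 ∨ s₁ = -1) (hs₂ : s₂ = 1 ∨ s₂ = -1)
    (hF : CrossingBehaviour F g₁ g₂ s₁ s₂ μ₁ μ₂ A ξ) (x : ℝ × ℝ) {v : ℝ × ℝ}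
    (hv₁ : 0 < s₁ * v.1) (hv₂ : 0 < s₂ * v.2)
    (hv : xprime₁ g₁ g₂ ξ x * v.1 + xprime₂ g₁ g₂ ξ x * v.2 < 0) :
    ∃ ρ₀ > 0, ∀ ρ ∈ Ioo (0 : ℝ) ρ₀, ∃ β₀ > 0, ∀ β ∈ Ioo (0 : ℝ) β₀,
      SuitableSurface g₁ g₂ φ s₁ s₂ x (fun _ => β • v) ρ ∧
      (∀ r : ℝ, IntegrableOn (integrand F (r • x) (surf φ (fun _ => β • v))) (square ρ)) ∧
      ∃ c > 0, (fun r : ℝ => uLoc F (surf φ (fun _ => β • v)) ρ (r • x))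
        =O[atTop] fun r : ℝ => Real.exp (-c * r) := by
  set q := xprime₁ g₁ g₂ ξ x * v.1 + xprime₂ g₁ g₂ ξ x * v.2 with hq
  have hvn : 0 < ‖v‖ := norm_pos_iff.2 fun h => by simp [h] at hv₁
  obtain ⟨R, hR, K, hloc⟩ := IsLocalInverse.exists_radius hg₁ hg₂ hΔ hφ hF
  obtain ⟨R', hR', him⟩ := IsLocalInverse.abs_im_phase_sub_le hg₁ hg₂ hΔ hφ x
    (c := -q / (2 * ‖v‖)) (div_pos (by linarith) (by positivity))
  refine ⟨min (R / 2) R', lt_min (by linarith) hR', fun ρ hρ => ?_⟩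
  have hρR : ρ < R / 2 := hρ.2.trans_le (min_le_left _ _)
  have hρR' : ρ < R' := hρ.2.trans_le (min_le_right _ _)
  refine ⟨min (R / 2) R' / ‖v‖, div_pos (lt_min (by linarith) hR') hvn, fun β hβ => ?_⟩
  have hβv : ‖β • v‖ < min (R / 2) R' := by
    rw [norm_smul, Real.norm_eq_abs, abs_of_pos hβ.1]
    exact (lt_div_iff₀ hvn).1 hβ.2
  have hβR : ‖β • v‖ < R / 2 := hβv.trans_le (min_le_left _ _)
  have hβR' : ‖β • v‖ < R' := hβv.trans_le (min_le_right _ _)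
  -- the phase over the whole closed square
  have hphase : ∀ t ∈ closure (square ρ), (phase φ x (cplx t (β • v))).im ≤ β * q / 2 := by
    intro t ht
    have h1 := him t (β • v) ((norm_le_of_mem_closure_square hρ.1 ht).trans_lt hρR') hβR'
    have h2 : -q / (2 * ‖v‖) * ‖β • v‖ = -(β * q) / 2 := by
      rw [norm_smul, Real.norm_eq_abs, abs_of_pos hβ.1]; field_simp
    rw [h2] at h1
    have h3 := (abs_le.1 h1).2
    simp only [Prod.smul_fst, Prod.smul_snd, smul_eq_mul] at h3
    have h4 : xprime₁ g₁ g₂ ξ x * (β * v.1) + xprime₂ g₁ g₂ ξ x * (β * v.2) = β * q := by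
      rw [hq]; ring
    linarith
  have hβq : β * q < 0 := mul_neg_of_pos_of_neg hβ.1 hv
  have hnorm : ∀ t ∈ closure (square ρ), ‖t‖ + ‖β • v‖ < R := fun t ht => by
    linarith [norm_le_of_mem_closure_square hρ.1 ht]
  have hβ₁ : 0 < s₁ * (β • v).1 := by
    have := mul_pos hβ.1 hv₁; simp only [Prod.smul_fst, smul_eq_mul]; linarith
  have hβ₂ : 0 < s₂ * (β • v).2 := by
    have := mul_pos hβ.1 hv₂; simp only [Prod.smul_snd, smul_eq_mul]; linarith
  have hcont : ContinuousOn (fun t => F (φ (cplx t (β • v))) * jacDet φ (cplx t (β • v)))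
      (closure (square ρ)) := by
    intro t ht
    obtain ⟨ha, -, hd⟩ := hloc _ ((norm_cplx_le t (β • v)).trans_lt (hnorm t ht))
    have hc : Continuous fun t => cplx t (β • v) := by unfold cplx; fun_prop
    have h1 : ContinuousAt (fun ζ => F (φ ζ) * jacDet φ ζ) (cplx t (β • v)) :=
      (ContinuousAt.comp (hd (cplx_mem_cutPairs hs₁ hs₂ (fun _ => hβ₁)
        fun _ => hβ₂)).1.continuousAt ha.continuousAt).mul (AnalyticAt.jacDet ha).continuousAt
    exact (ContinuousAt.comp (f := fun t => cplx t (β • v)) h1 hc.continuousAt).continuousWithinAt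
  have hcontP : ContinuousOn (fun t => phase φ x (cplx t (β • v))) (closure (square ρ)) := by
    intro t ht
    obtain ⟨ha, -, -⟩ := hloc _ ((norm_cplx_le t (β • v)).trans_lt (hnorm t ht))
    have hc : Continuous fun t => cplx t (β • v) := by unfold cplx; fun_prop
    have ha' := ha.continuousAt
    have h1 : ContinuousAt (phase φ x) (cplx t (β • v)) := by unfold phase; fun_prop
    exact (ContinuousAt.comp (f := fun t => cplx t (β • v)) h1 hc.continuousAt).continuousWithinAt
  have hform : ∀ r : ℝ, ∀ t ∈ closure (square ρ),
      integrand F (r • x) (surf φ (fun _ => β • v)) t =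
        F (φ (cplx t (β • v))) * jacDet φ (cplx t (β • v)) *
          Complex.exp (-Complex.I * r * phase φ x (cplx t (β • v))) := by
    intro r t ht
    obtain ⟨ha, -, -⟩ := hloc _ ((norm_cplx_le t (β • v)).trans_lt (hnorm t ht))
    have h1 := jac_surf (φ := φ) (t := t) (hasDerivAt_const t.1 (β • v).1)
      (hasDerivAt_const t.2 (β • v).2) ha.differentiableAt
    rw [integrand_smul, show jac (surf φ fun _ => β • v) t = jac (surf φ fun t =>
      ((fun _ => (β • v).1) t.1, (fun _ => (β • v).2) t.2)) t from rfl, h1]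
    simp only [Prod.mk.eta, Complex.ofReal_zero, mul_zero, add_zero, mul_one]
    ring
  have hcompact : IsCompact (closure (square ρ)) := by
    rw [closure_square hρ.1]; exact isCompact_Icc.prod isCompact_Icc
  have hint : ∀ r : ℝ, IntegrableOn (integrand F (r • x) (surf φ (fun _ => β • v)))
      (square ρ) := by
    intro r
    have hce : ContinuousOn (fun t => Complex.exp (-Complex.I * r * phase φ x (cplx t (β • v))))
        (closure (square ρ)) := (continuousOn_const.mul hcontP).cexp
    have := ((hcont.mul hce).congr (hform r)).integrableOn_compact hcompact (μ := volume)
    exact this.mono_set subset_closure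
  obtain ⟨M, hM⟩ := hcompact.exists_bound_of_continuousOn hcont
  refine ⟨suitableSurface_of_bridge hs₁ hs₂ (fun ζ hζ => (hloc ζ hζ).2.1) hnorm (fun _ _ _ => hβ₁)
    (fun _ _ _ => hβ₂) fun t ht => (hphase t (frontier_subset_closure ht)).trans_lt (by linarith),
    hint, -(β * q / 2), by linarith, ?_⟩
  refine IsBigO.of_bound (M * volume.real (square ρ)) ?_
  filter_upwards [eventually_ge_atTop 0] with r hr
  have hfin : volume (square ρ) < ⊤ :=
    (measure_mono subset_closure).trans_lt hcompact.measure_lt_top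
  have hb : ∀ t ∈ square ρ, ‖integrand F (r • x) (surf φ (fun _ => β • v)) t‖ ≤
      M * Real.exp (-(-(β * q / 2)) * r) := by
    intro t ht
    have ht' := subset_closure ht
    rw [hform r t ht', norm_mul, Complex.norm_exp]
    have h1 : (-Complex.I * r * phase φ x (cplx t (β • v))).re =
        r * (phase φ x (cplx t (β • v))).im := by simp
    rw [h1]
    have h2 : r * (phase φ x (cplx t (β • v))).im ≤ -(-(β * q / 2)) * r := by
      have := mul_le_mul_of_nonneg_left (hphase t ht') hr
      linarith
    exact mul_le_mul (hM t ht') (Real.exp_le_exp.2 h2) (Real.exp_pos _).le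
      ((norm_nonneg _).trans (hM t ht'))
  have := norm_setIntegral_le_of_norm_le_const hfin hb
  rw [uLoc, Real.norm_eq_abs, abs_of_pos (Real.exp_pos _)]
  linarith

end LocalIntegral

/-! ### Active directions -/

theorem sq_eq_one_of_sign {s : ℝ} (hs : s = 1 ∨ s = -1) : s * s = 1 := by
  rcases hs with rfl | rfl <;> norm_num

/-- The rotation `w ↦ i s w` in each variable, which takes the slit plane to the plane cut along
`-i s [0, ∞)`. -/
noncomputable def rotPair (s₁ s₂ : ℝ) : ℂ × ℂ →L[ℂ] ℂ × ℂ :=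
  ((Complex.I * s₁) • ContinuousLinearMap.fst ℂ ℂ ℂ).prod
    ((Complex.I * s₂) • ContinuousLinearMap.snd ℂ ℂ ℂ)

theorem rotPair_apply (s₁ s₂ : ℝ) (w : ℂ × ℂ) :
    rotPair s₁ s₂ w = (Complex.I * s₁ * w.1, Complex.I * s₂ * w.2) := by
  simp [rotPair]

section Rotation

variable {s₁ s₂ : ℝ}

theorem norm_rotPair (hs₁ : s₁ = 1 ∨ s₁ = -1) (hs₂ : s₂ = 1 ∨ s₂ = -1) (w : ℂ × ℂ) :
    ‖rotPair s₁ s₂ w‖ = ‖w‖ := by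
  rw [rotPair_apply, Prod.norm_mk, Prod.norm_def]
  rcases hs₁ with rfl | rfl <;> rcases hs₂ with rfl | rfl <;> simp

theorem neg_I_mul_rot {s : ℝ} (hs : s = 1 ∨ s = -1) (w : ℂ) :
    -Complex.I * s * (Complex.I * s * w) = w := by
  have h : (s : ℂ) * s = 1 := by exact_mod_cast sq_eq_one_of_sign hs
  linear_combination (-(s : ℂ) * s * w) * Complex.I_mul_I + w * h

theorem branchPow_rot {s : ℝ} (hs : s = 1 ∨ s = -1) (μ w : ℂ) :
    branchPow s μ (Complex.I * s * w) =
      Complex.exp (-(Complex.I * Real.pi * s * μ / 2)) * w ^ (-μ) := by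
  rw [branchPow, neg_I_mul_rot hs]

theorem rotPair_mem_cutPairs (hs₁ : s₁ = 1 ∨ s₁ = -1) (hs₂ : s₂ = 1 ∨ s₂ = -1) {R : ℝ}
    {w : ℂ × ℂ} (hw : w ∈ cutBox R) : rotPair s₁ s₂ w ∈ cutPairs s₁ s₂ := by
  rw [rotPair_apply, cutPairs, mem_ofPred_eq, neg_I_mul_rot hs₁, neg_I_mul_rot hs₂]
  exact ⟨hw.1.1, hw.2.1⟩

theorem norm_lt_of_mem_cutBox {R : ℝ} {w : ℂ × ℂ} (hw : w ∈ cutBox R) : ‖w‖ < R :=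
  max_lt (mem_ball_zero_iff.1 hw.1.2) (mem_ball_zero_iff.1 hw.2.2)

theorem rotPair_tent (hs₁ : s₁ = 1 ∨ s₁ = -1) (hs₂ : s₂ = 1 ∨ s₂ = -1) (δ₁ σ₁ δ₂ σ₂ : ℝ)
    (t : ℝ × ℝ) : rotPair s₁ s₂ (tent s₁ δ₁ σ₁ t.1, tent s₂ δ₂ σ₂ t.2) =
      cplx t (s₁ * (δ₁ - σ₁ * |t.1|), s₂ * (δ₂ - σ₂ * |t.2|)) := by
  have key : ∀ s δ σ u : ℝ, (s = 1 ∨ s = -1) →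
      Complex.I * s * tent s δ σ u = (u : ℂ) + Complex.I * ((s * (δ - σ * |u|) : ℝ) : ℂ) := by
    intro s δ σ u hs
    have h : (s : ℂ) * s = 1 := by exact_mod_cast sq_eq_one_of_sign hs
    rw [tent]
    push_cast
    linear_combination (-(s : ℂ) * s * u) * Complex.I_mul_I + u * h
  rw [rotPair_apply, key _ _ _ _ hs₁, key _ _ _ _ hs₂, cplx]

/-- The slope of the field over a tent, and the chain rule `dζ = i s dw` for the rotation. -/
theorem hasDerivAt_tent_field {s : ℝ} (hs : s = 1 ∨ s = -1) (δ σ : ℝ) {u : ℝ} (hu : u ≠ 0) :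
    ∃ d : ℝ, HasDerivAt (fun u => s * (δ - σ * |u|)) d u ∧
      1 + Complex.I * d = Complex.I * s * tentDeriv s σ u := by
  have h : (s : ℂ) * s = 1 := by exact_mod_cast sq_eq_one_of_sign hs
  refine ⟨_, (((hasDerivAt_abs hu).const_mul σ).const_sub δ).const_mul s, ?_⟩
  rcases lt_or_gt_of_ne hu with hu | hu
  · have hsign : ((SignType.sign u : SignType) : ℝ) = -1 := by simp [sign_neg hu]
    rw [tentDeriv, if_neg hu.not_gt, hsign]
    push_cast
    linear_combination (s : ℂ) * s * Complex.I_mul_I - h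
  · have hsign : ((SignType.sign u : SignType) : ℝ) = 1 := by simp [sign_pos hu]
    rw [tentDeriv, if_pos hu, hsign]
    push_cast
    linear_combination (s : ℂ) * s * Complex.I_mul_I - h

theorem ae_fst_snd_ne_zero : ∀ᵐ t : ℝ × ℝ, t.1 ≠ 0 ∧ t.2 ≠ 0 := by
  have h : ∀ᵐ u : ℝ, u ≠ 0 := Measure.ae_ne volume 0
  rw [Measure.volume_eq_prod]
  exact (Measure.quasiMeasurePreserving_fst.ae h).and (Measure.quasiMeasurePreserving_snd.ae h)

/-- When `x_j'` has the sign `s_j`, each component of `crossField` is `s_j` times the height of a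
tent in its own variable. -/
theorem crossField_eq (hs₁ : s₁ = 1 ∨ s₁ = -1) (hs₂ : s₂ = 1 ∨ s₂ = -1) {a₁ a₂ : ℝ}
    (ha₁ : 0 < a₁) (ha₂ : 0 < a₂) (ρ β : ℝ) :
    crossField s₁ s₂ (s₁ * a₁) (s₂ * a₂) ρ β = fun t =>
      (s₁ * (β * ρ - 2 * β * ((a₁ + a₂) / a₁) * |t.1|),
        s₂ * (β * ρ - 2 * β * ((a₁ + a₂) / a₂) * |t.2|)) := by
  have habs : ∀ s a : ℝ, (s = 1 ∨ s = -1) → 0 < a → |s * a| = a := by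
    rintro s a (rfl | rfl) ha <;> simp [abs_of_pos ha]
  have hdiv : ∀ s a X : ℝ, (s = 1 ∨ s = -1) → X / (s * a) = s * (X / a) := by
    rintro s a X (rfl | rfl) <;> simp [div_neg]
  funext t
  rw [crossField, habs _ _ hs₁ ha₁, habs _ _ hs₂ ha₂, hdiv _ _ _ hs₁, hdiv _ _ _ hs₂]
  refine Prod.ext ?_ ?_ <;> simp only <;> ring

end Rotation

section Active

variable {g₁ g₂ F : ℂ × ℂ → ℂ} {ξ : ℝ × ℝ} {φ : ℂ × ℂ → ℂ × ℂ} {s₁ s₂ : ℝ} {μ₁ μ₂ A : ℂ}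

/-- The imaginary part of the phase over a tent, up to an arbitrarily small multiple of the
height. -/
theorem IsLocalInverse.im_phase_le (hg₁ : RealProperty g₁) (hg₂ : RealProperty g₂)
    (hΔ : 0 < crossDet g₁ g₂ ξ) (hφ : IsLocalInverse g₁ g₂ ξ φ)
    (hs₁ : s₁ = 1 ∨ s₁ = -1) (hs₂ : s₂ = 1 ∨ s₂ = -1) (x : ℝ × ℝ) {c : ℝ} (hc : 0 < c) :
    ∃ R > 0, ∀ (t : ℝ × ℝ) (z₁ z₂ : ℝ), ‖t‖ < R → |z₁| < R → |z₂| < R →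
      (phase φ x (cplx t (s₁ * z₁, s₂ * z₂))).im ≤
        s₁ * xprime₁ g₁ g₂ ξ x * z₁ + s₂ * xprime₂ g₁ g₂ ξ x * z₂ + c * (|z₁| + |z₂|) := by
  obtain ⟨R, hR, h⟩ := IsLocalInverse.abs_im_phase_sub_le hg₁ hg₂ hΔ hφ x hc
  refine ⟨R, hR, fun t z₁ z₂ ht h₁ h₂ => ?_⟩
  have habs : ∀ s z : ℝ, (s = 1 ∨ s = -1) → |s * z| = |z| := by
    rintro s z (rfl | rfl) <;> simp
  have hn : ‖((s₁ * z₁, s₂ * z₂) : ℝ × ℝ)‖ = max |z₁| |z₂| := by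
    rw [Prod.norm_mk, Real.norm_eq_abs, Real.norm_eq_abs, habs _ _ hs₁, habs _ _ hs₂]
  have h3 := (abs_le.1 (h t (s₁ * z₁, s₂ * z₂) ht (by rw [hn]; exact max_lt h₁ h₂))).2
  rw [hn] at h3
  have h4 : c * max |z₁| |z₂| ≤ c * (|z₁| + |z₂|) := by
    gcongr
    exact max_le (by linarith [abs_nonneg z₂]) (by linarith [abs_nonneg z₁])
  simp only at h3
  linarith

/-- Size and phase of the tents used in active directions: `crossField` is the tent of
height `β ρ`, and the lower tents with the same end points satisfy the bounds uniformly. -/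
theorem IsLocalInverse.exists_tent_estimates (hg₁ : RealProperty g₁) (hg₂ : RealProperty g₂)
    (hΔ : 0 < crossDet g₁ g₂ ξ) (hφ : IsLocalInverse g₁ g₂ ξ φ)
    (hs₁ : s₁ = 1 ∨ s₁ = -1) (hs₂ : s₂ = 1 ∨ s₂ = -1) (x : ℝ × ℝ) {a₁ a₂ : ℝ}
    (ha₁ : 0 < a₁) (ha₂ : 0 < a₂) (hx₁ : xprime₁ g₁ g₂ ξ x = s₁ * a₁)
    (hx₂ : xprime₂ g₁ g₂ ξ x = s₂ * a₂) {R : ℝ} (hR : 0 < R) {K₁ K₂ : ℝ}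
    (hK₁ : K₁ = (a₁ + a₂) / a₁) (hK₂ : K₂ = (a₁ + a₂) / a₂) :
    ∃ ρ₀ > 0, ∀ ρ ∈ Ioo (0 : ℝ) ρ₀, ∀ β ∈ Ioo (0 : ℝ) 1, ∀ σ₁ σ₂ : ℝ,
      σ₁ = β * (2 * K₁ - 1) → σ₂ = β * (2 * K₂ - 1) →
      (∀ δ ∈ Ioc 0 (β * ρ), ∀ t ∈ Icc (-ρ) ρ, ‖tent s₁ δ (σ₁ + δ / ρ) t‖ < R) ∧
      (∀ δ ∈ Ioc 0 (β * ρ), ∀ t ∈ Icc (-ρ) ρ, ‖tent s₂ δ (σ₂ + δ / ρ) t‖ < R) ∧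
      (∀ t ∈ closure (square ρ), ‖t‖ + ‖((s₁ * (β * ρ - 2 * β * K₁ * |t.1|),
        s₂ * (β * ρ - 2 * β * K₂ * |t.2|)) : ℝ × ℝ)‖ < R) ∧
      ∃ c₀ > 0, c₀ < a₁ ∧ c₀ < a₂ ∧ c₀ * (2 + 2 * K₁ + 2 * K₂) < a₁ + a₂ ∧
        ∀ δ ∈ Ioc 0 (β * ρ), ∀ t ∈ closure (square ρ),
          (phase φ x (cplx t (s₁ * (δ - (σ₁ + δ / ρ) * |t.1|),
            s₂ * (δ - (σ₂ + δ / ρ) * |t.2|)))).im ≤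
          a₁ * (δ - (σ₁ + δ / ρ) * |t.1|) + a₂ * (δ - (σ₂ + δ / ρ) * |t.2|) +
            c₀ * ((δ + (σ₁ + δ / ρ) * |t.1|) + (δ + (σ₂ + δ / ρ) * |t.2|)) := by
  have hq₁ := sq_eq_one_of_sign hs₁
  have hq₂ := sq_eq_one_of_sign hs₂
  set X := a₁ + a₂ with hX
  have hX0 : 0 < X := by positivity
  -- the error allowed in the phase, small against `a₁`, `a₂` and the decay on the boundary
  set c₀ := a₁ * a₂ / (4 * X) with hc₀
  have hc₀0 : 0 < c₀ := by positivity
  have hc₀₁ : c₀ < a₁ := by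
    rw [hc₀, div_lt_iff₀ (by positivity)]; nlinarith [mul_pos ha₁ ha₂, mul_pos ha₁ ha₁]
  have hc₀₂ : c₀ < a₂ := by
    rw [hc₀, div_lt_iff₀ (by positivity)]; nlinarith [mul_pos ha₁ ha₂, mul_pos ha₂ ha₂]
  have hK₁1 : 1 ≤ K₁ := hK₁ ▸ (one_le_div ha₁).2 (by linarith)
  have hK₂1 : 1 ≤ K₂ := hK₂ ▸ (one_le_div ha₂).2 (by linarith)
  have hc₀K : c₀ * (2 + 2 * K₁ + 2 * K₂) < X := by
    have e1 : c₀ * (2 + 2 * K₁ + 2 * K₂) = a₁ * a₂ / (2 * X) + X / 2 := by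
      rw [hc₀, hK₁, hK₂, hX]; field_simp; ring
    have e2 : a₁ * a₂ / (2 * X) < X / 2 := by
      rw [div_lt_iff₀ (by positivity), hX]; nlinarith [mul_pos ha₁ ha₂, sq_nonneg (a₁ - a₂)]
    linarith
  obtain ⟨R', hR', him⟩ := IsLocalInverse.im_phase_le hg₁ hg₂ hΔ hφ hs₁ hs₂ x hc₀0
  have hsx₁ : s₁ * xprime₁ g₁ g₂ ξ x = a₁ := by rw [hx₁, ← mul_assoc, hq₁, one_mul]
  have hsx₂ : s₂ * xprime₂ g₁ g₂ ξ x = a₂ := by rw [hx₂, ← mul_assoc, hq₂, one_mul]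
  rw [hsx₁, hsx₂] at him
  set N := 3 + 2 * K₁ + 2 * K₂ with hN
  have hN0 : 0 < N := by positivity
  refine ⟨min R R' / N, div_pos (lt_min hR hR') hN0, fun ρ hρ β hβ σ₁ σ₂ hσ₁ hσ₂ => ?_⟩
  have hρN : ρ * N < min R R' := (lt_div_iff₀ hN0).1 hρ.2
  have hρR : ρ * N < R := hρN.trans_le (min_le_left _ _)
  have hρR' : ρ * N < R' := hρN.trans_le (min_le_right _ _)
  have hρ0 := hρ.1
  have hβ0 := hβ.1
  have hβρ : 0 < β * ρ := mul_pos hβ0 hρ0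
  have hσ₁0 : 0 < σ₁ := hσ₁ ▸ mul_pos hβ0 (by linarith)
  have hσ₂0 : 0 < σ₂ := hσ₂ ▸ mul_pos hβ0 (by linarith)
  -- heights and slopes of the tents in use
  have hslope : ∀ δ ∈ Ioc 0 (β * ρ), 0 < δ / ρ ∧ δ / ρ ≤ β ∧ δ ≤ ρ := fun δ hδ =>
    ⟨div_pos hδ.1 hρ0, (div_le_iff₀ hρ0).2 hδ.2,
      hδ.2.trans (mul_le_of_le_one_left hρ0.le hβ.2.le)⟩
  have hS₁ : ∀ δ ∈ Ioc 0 (β * ρ), 0 < σ₁ + δ / ρ ∧ σ₁ + δ / ρ ≤ 2 * K₁ := fun δ hδ => by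
    obtain ⟨h1, h2, -⟩ := hslope δ hδ
    refine ⟨by linarith, ?_⟩
    have : β * K₁ ≤ 1 * K₁ := by gcongr; exact hβ.2.le
    rw [hσ₁]; linarith
  have hS₂ : ∀ δ ∈ Ioc 0 (β * ρ), 0 < σ₂ + δ / ρ ∧ σ₂ + δ / ρ ≤ 2 * K₂ := fun δ hδ => by
    obtain ⟨h1, h2, -⟩ := hslope δ hδ
    refine ⟨by linarith, ?_⟩
    have : β * K₂ ≤ 1 * K₂ := by gcongr; exact hβ.2.le
    rw [hσ₂]; linarith
  have hsize : ∀ δ ∈ Ioc 0 (β * ρ), ∀ S k u : ℝ, 0 < S → S ≤ 2 * k → |u| ≤ ρ →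
      |(δ - S * |u|)| ≤ δ + S * |u| ∧ δ + S * |u| ≤ ρ * (1 + 2 * k) := by
    intro δ hδ S k u hS hSk hu
    obtain ⟨-, -, h3⟩ := hslope δ hδ
    have h4 : 0 ≤ S * |u| := by positivity
    have h5 : S * |u| ≤ 2 * k * ρ := by gcongr; linarith
    exact ⟨abs_le.2 ⟨by linarith [hδ.1], by linarith⟩, by linarith⟩
  have hball : ∀ s, (s = 1 ∨ s = -1) → ∀ δ ∈ Ioc 0 (β * ρ), ∀ S k : ℝ, 0 < S → S ≤ 2 * k →
      1 + (1 + 2 * k) ≤ N → ∀ t ∈ Icc (-ρ) ρ, ‖tent s δ S t‖ < R := by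
    intro s hs δ hδ S k hS hSk hk t ht
    have htρ : |t| ≤ ρ := abs_le.2 ht
    have h1 := norm_tent_le hs δ S t
    rw [abs_of_pos hδ.1, abs_of_pos hS] at h1
    have h2 := (hsize δ hδ S k t hS hSk htρ).2
    have h3 : ρ * (1 + (1 + 2 * k)) ≤ ρ * N := by gcongr
    linarith
  have hball₁ : ∀ δ ∈ Ioc 0 (β * ρ), ∀ t ∈ Icc (-ρ) ρ, ‖tent s₁ δ (σ₁ + δ / ρ) t‖ < R :=
    fun δ hδ => hball s₁ hs₁ δ hδ _ K₁ (hS₁ δ hδ).1 (hS₁ δ hδ).2 (by rw [hN]; linarith)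
  have hball₂ : ∀ δ ∈ Ioc 0 (β * ρ), ∀ t ∈ Icc (-ρ) ρ, ‖tent s₂ δ (σ₂ + δ / ρ) t‖ < R :=
    fun δ hδ => hball s₂ hs₂ δ hδ _ K₂ (hS₂ δ hδ).1 (hS₂ δ hδ).2 (by rw [hN]; linarith)
  -- the imaginary part of the phase over the tents
  have hIm : ∀ δ ∈ Ioc 0 (β * ρ), ∀ t : ℝ × ℝ, |t.1| ≤ ρ → |t.2| ≤ ρ →
      (phase φ x (cplx t (s₁ * (δ - (σ₁ + δ / ρ) * |t.1|), s₂ * (δ - (σ₂ + δ / ρ) * |t.2|)))).im ≤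
        a₁ * (δ - (σ₁ + δ / ρ) * |t.1|) + a₂ * (δ - (σ₂ + δ / ρ) * |t.2|) +
          c₀ * ((δ + (σ₁ + δ / ρ) * |t.1|) + (δ + (σ₂ + δ / ρ) * |t.2|)) := by
    intro δ hδ t h1 h2
    obtain ⟨p1, p2⟩ := hsize δ hδ _ K₁ t.1 (hS₁ δ hδ).1 (hS₁ δ hδ).2 h1
    obtain ⟨q1, q2⟩ := hsize δ hδ _ K₂ t.2 (hS₂ δ hδ).1 (hS₂ δ hδ).2 h2
    have k1 : ρ * (1 + 2 * K₁) ≤ ρ * N := by gcongr; rw [hN]; linarith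
    have k2 : ρ * (1 + 2 * K₂) ≤ ρ * N := by gcongr; rw [hN]; linarith
    have k3 : ρ * 1 ≤ ρ * N := by gcongr; rw [hN]; linarith
    have ht : ‖t‖ ≤ ρ := max_le h1 h2
    refine (him t _ _ (by linarith) (by linarith) (by linarith)).trans ?_
    gcongr
  have hclosure : ∀ t ∈ closure (square ρ), |t.1| ≤ ρ ∧ |t.2| ≤ ρ := fun t ht => by
    rw [closure_square hρ0] at ht
    exact ⟨abs_le.2 ht.1, abs_le.2 ht.2⟩
  have habs : ∀ s z : ℝ, (s = 1 ∨ s = -1) → |s * z| = |z| := by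
    rintro s z (rfl | rfl) <;> simp
  have hδ₀ : β * ρ ∈ Ioc 0 (β * ρ) := ⟨hβρ, le_rfl⟩
  have e₁ : σ₁ + β * ρ / ρ = 2 * β * K₁ := by rw [mul_div_cancel_right₀ _ hρ0.ne', hσ₁]; ring
  have e₂ : σ₂ + β * ρ / ρ = 2 * β * K₂ := by rw [mul_div_cancel_right₀ _ hρ0.ne', hσ₂]; ring
  refine ⟨hball₁, hball₂, fun t ht => ?_, c₀, hc₀0, hc₀₁, hc₀₂, hc₀K, fun δ hδ t ht =>
    hIm δ hδ t (hclosure t ht).1 (hclosure t ht).2⟩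
  obtain ⟨h1, h2⟩ := hclosure t ht
  obtain ⟨p1, p2⟩ := hsize _ hδ₀ _ K₁ t.1 (hS₁ _ hδ₀).1 (hS₁ _ hδ₀).2 h1
  obtain ⟨q1, q2⟩ := hsize _ hδ₀ _ K₂ t.2 (hS₂ _ hδ₀).1 (hS₂ _ hδ₀).2 h2
  rw [e₁] at p1 p2
  rw [e₂] at q1 q2
  have hρK₁ : 0 ≤ ρ * K₁ := mul_nonneg hρ0.le (by linarith)
  have hρK₂ : 0 ≤ ρ * K₂ := mul_nonneg hρ0.le (by linarith)
  have h3 : ‖((s₁ * (β * ρ - 2 * β * K₁ * |t.1|), s₂ * (β * ρ - 2 * β * K₂ * |t.2|)) :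
      ℝ × ℝ)‖ ≤ ρ * (1 + 2 * K₁ + 2 * K₂) := by
    refine max_le ?_ ?_
    · rw [Real.norm_eq_abs, habs _ _ hs₁]
      linarith
    · rw [Real.norm_eq_abs, habs _ _ hs₂]
      linarith
  have h4 : ‖t‖ ≤ ρ := max_le h1 h2
  have h5 : ρ * N = 3 * ρ + ρ * (2 * K₁ + 2 * K₂) := by rw [hN]; ring
  linarith

/-- The decay on the boundary of the square, where the larger of the two coordinates is `ρ`. -/
theorem tent_boundary_neg {a₁ a₂ K₁ K₂ c β ρ u₁ u₂ : ℝ} (ha₁ : 0 < a₁) (ha₂ : 0 < a₂)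
    (haK₁ : a₁ * K₁ = a₁ + a₂) (haK₂ : a₂ * K₂ = a₁ + a₂) (hc : 0 < c)
    (hcK : c * (2 + 2 * K₁ + 2 * K₂) < a₁ + a₂) (hβ : 0 < β) (hρ : 0 < ρ) (hK₁ : 0 ≤ K₁)
    (hK₂ : 0 ≤ K₂) (hu₁ : 0 ≤ u₁) (hu₂ : 0 ≤ u₂) (hu : max u₁ u₂ = ρ) :
    a₁ * (β * ρ - 2 * β * K₁ * u₁) + a₂ * (β * ρ - 2 * β * K₂ * u₂) +
      c * ((β * ρ + 2 * β * K₁ * u₁) + (β * ρ + 2 * β * K₂ * u₂)) < 0 := by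
  have h1 : u₁ ≤ ρ := hu ▸ le_max_left _ _
  have h2 : u₂ ≤ ρ := hu ▸ le_max_right _ _
  have h4 : ρ ≤ u₁ + u₂ := hu ▸ max_le (by linarith) (by linarith)
  have h5 : a₁ * (β * ρ - 2 * β * K₁ * u₁) + a₂ * (β * ρ - 2 * β * K₂ * u₂) =
      β * (a₁ + a₂) * (ρ - 2 * (u₁ + u₂)) := by
    linear_combination (-2 * β * u₁) * haK₁ + (-2 * β * u₂) * haK₂
  have h6 : β * (a₁ + a₂) * (ρ - 2 * (u₁ + u₂)) ≤ β * (a₁ + a₂) * (-ρ) := by gcongr; linarith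
  have h7 : (β * ρ + 2 * β * K₁ * u₁) + (β * ρ + 2 * β * K₂ * u₂) ≤
      (β * ρ + 2 * β * K₁ * ρ) + (β * ρ + 2 * β * K₂ * ρ) := by gcongr
  have h8 := mul_le_mul_of_nonneg_left h7 hc.le
  have h9 := mul_lt_mul_of_pos_left hcK (mul_pos hβ hρ)
  rw [h5]
  linarith

/-- The estimate in active directions, with the leading term multiplied out. -/
theorem IsLocalInverse.tendsto_uLoc (hg₁ : RealProperty g₁) (hg₂ : RealProperty g₂)
    (hΔ : 0 < crossDet g₁ g₂ ξ) (hφ : IsLocalInverse g₁ g₂ ξ φ)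
    (hs₁ : s₁ = 1 ∨ s₁ = -1) (hs₂ : s₂ = 1 ∨ s₂ = -1)
    (hF : CrossingBehaviour F g₁ g₂ s₁ s₂ μ₁ μ₂ A ξ) (x : ℝ × ℝ) {a₁ a₂ : ℝ}
    (ha₁ : 0 < a₁) (ha₂ : 0 < a₂) (hx₁ : xprime₁ g₁ g₂ ξ x = s₁ * a₁)
    (hx₂ : xprime₂ g₁ g₂ ξ x = s₂ * a₂) :
    ∃ ρ₀ > 0, ∀ ρ ∈ Ioo (0 : ℝ) ρ₀, ∃ β₀ > 0, ∀ β ∈ Ioo (0 : ℝ) β₀,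
      SuitableSurface g₁ g₂ φ s₁ s₂ x (crossField s₁ s₂ (s₁ * a₁) (s₂ * a₂) ρ β) ρ ∧
      (∀ r : ℝ, IntegrableOn
        (integrand F (r • x) (surf φ (crossField s₁ s₂ (s₁ * a₁) (s₂ * a₂) ρ β))) (square ρ)) ∧
      Tendsto (fun r : ℝ => (r : ℂ) ^ (2 - μ₁ - μ₂) * Complex.exp (Complex.I * r * phase φ x 0) *
          uLoc F (surf φ (crossField s₁ s₂ (s₁ * a₁) (s₂ * a₂) ρ β)) ρ (r • x)) atTop
        (𝓝 (A / crossDet g₁ g₂ ξ * calJValue μ₁ a₁ s₁ * calJValue μ₂ a₂ s₂)) := by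
  have hq₁ := sq_eq_one_of_sign hs₁
  have hq₂ := sq_eq_one_of_sign hs₂
  obtain ⟨R, hR, K, hloc⟩ := IsLocalInverse.exists_radius hg₁ hg₂ hΔ hφ hF
  set K₁ := (a₁ + a₂) / a₁ with hK₁
  set K₂ := (a₁ + a₂) / a₂ with hK₂
  have haK₁ : a₁ * K₁ = a₁ + a₂ := mul_div_cancel₀ _ ha₁.ne'
  have haK₂ : a₂ * K₂ = a₁ + a₂ := mul_div_cancel₀ _ ha₂.ne'
  have hK₁1 : 1 ≤ K₁ := (one_le_div ha₁).2 (by linarith)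
  have hK₂1 : 1 ≤ K₂ := (one_le_div ha₂).2 (by linarith)
  have hsx₁ : s₁ * xprime₁ g₁ g₂ ξ x = a₁ := by rw [hx₁, ← mul_assoc, hq₁, one_mul]
  have hsx₂ : s₂ * xprime₂ g₁ g₂ ξ x = a₂ := by rw [hx₂, ← mul_assoc, hq₂, one_mul]
  obtain ⟨ρ₀, hρ₀, hest⟩ := IsLocalInverse.exists_tent_estimates hg₁ hg₂ hΔ hφ hs₁ hs₂ x ha₁ ha₂
    hx₁ hx₂ hR hK₁ hK₂
  refine ⟨ρ₀, hρ₀, fun ρ hρ => ⟨1, one_pos, fun β hβ => ?_⟩⟩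
  set σ₁ := β * (2 * K₁ - 1) with hσ₁
  set σ₂ := β * (2 * K₂ - 1) with hσ₂
  obtain ⟨hball₁, hball₂, hnorm, c₀, hc₀0, hc₀₁, hc₀₂, hc₀K, hIm⟩ :=
    hest ρ hρ β hβ σ₁ σ₂ hσ₁ hσ₂
  have hρ0 := hρ.1
  have hβ0 := hβ.1
  have hβρ : 0 < β * ρ := mul_pos hβ0 hρ0
  have hσ₁0 : 0 < σ₁ := mul_pos hβ0 (by linarith)
  have hσ₂0 : 0 < σ₂ := mul_pos hβ0 (by linarith)
  have hδ₀ : β * ρ ∈ Ioc 0 (β * ρ) := ⟨hβρ, le_rfl⟩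
  have e₁ : σ₁ + β * ρ / ρ = 2 * β * K₁ := by rw [mul_div_cancel_right₀ _ hρ0.ne', hσ₁]; ring
  have e₂ : σ₂ + β * ρ / ρ = 2 * β * K₂ := by rw [mul_div_cancel_right₀ _ hρ0.ne', hσ₂]; ring
  set k₁ : ℝ → ℝ := fun u => s₁ * (β * ρ - 2 * β * K₁ * |u|) with hk₁
  set k₂ : ℝ → ℝ := fun u => s₂ * (β * ρ - 2 * β * K₂ * |u|) with hk₂
  have hfield : crossField s₁ s₂ (s₁ * a₁) (s₂ * a₂) ρ β = fun t => (k₁ t.1, k₂ t.2) :=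
    crossField_eq hs₁ hs₂ ha₁ ha₂ ρ β
  rw [hfield]
  have hsuit : SuitableSurface g₁ g₂ φ s₁ s₂ x (fun t => (k₁ t.1, k₂ t.2)) ρ := by
    refine suitableSurface_of_bridge hs₁ hs₂ (fun ζ hζ => (hloc ζ hζ).2.1) hnorm
      (fun t _ h0 => ?_) (fun t _ h0 => ?_) fun t ht => ?_
    · simp only [hk₁, h0, abs_zero, mul_zero, sub_zero]
      rw [← mul_assoc, hq₁, one_mul]; exact hβρ
    · simp only [hk₂, h0, abs_zero, mul_zero, sub_zero]
      rw [← mul_assoc, hq₂, one_mul]; exact hβρ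
    · have h3 := hIm _ hδ₀ t (frontier_subset_closure ht)
      rw [e₁, e₂] at h3
      refine h3.trans_lt (tent_boundary_neg ha₁ ha₂ haK₁ haK₂ hc₀0 hc₀K hβ0 hρ0 (by linarith)
        (by linarith) (abs_nonneg _) (abs_nonneg _) ?_)
      rw [← norm_eq_of_mem_frontier_square hρ0 ht]
      rfl
  -- the data in the rotated coordinates
  set G : ℂ × ℂ → ℂ := fun w => F (φ (rotPair s₁ s₂ w)) * jacDet φ (rotPair s₁ s₂ w) with hG
  set P : ℂ × ℂ → ℂ := fun w => phase φ x (rotPair s₁ s₂ w) with hP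
  have hrot : ∀ w ∈ cutBox R, ‖rotPair s₁ s₂ w‖ < R := fun w hw => by
    rw [norm_rotPair hs₁ hs₂]; exact norm_lt_of_mem_cutBox hw
  have hGd : DifferentiableOn ℂ G (cutBox R) := fun w hw => by
    obtain ⟨ha, -, hd⟩ := hloc _ (hrot w hw)
    have h1 := (hd (rotPair_mem_cutPairs hs₁ hs₂ hw)).1
    have h2 : DifferentiableAt ℂ (fun ζ => F (φ ζ) * jacDet φ ζ) (rotPair s₁ s₂ w) :=
      (h1.comp _ ha.differentiableAt).mul (AnalyticAt.jacDet ha).differentiableAt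
    exact (h2.comp w (rotPair s₁ s₂).differentiableAt).differentiableWithinAt
  have hPd : DifferentiableOn ℂ P (cutBox R) := fun w hw => by
    obtain ⟨ha, -, -⟩ := hloc _ (hrot w hw)
    have h1 := ha.differentiableAt
    have h2 : DifferentiableAt ℂ (phase φ x) (rotPair s₁ s₂ w) := by
      unfold phase; fun_prop
    exact (h2.comp w (rotPair s₁ s₂).differentiableAt).differentiableWithinAt
  set E₁ := Complex.exp (-(Complex.I * Real.pi * s₁ * μ₁ / 2)) with hE₁
  set E₂ := Complex.exp (-(Complex.I * Real.pi * s₂ * μ₂ / 2)) with hE₂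
  have hquot : ∀ w, G w / (w.1 ^ (-μ₁) * w.2 ^ (-μ₂)) = E₁ * E₂ *
      (F (φ (rotPair s₁ s₂ w)) / (branchPow s₁ μ₁ (rotPair s₁ s₂ w).1 *
        branchPow s₂ μ₂ (rotPair s₁ s₂ w).2) * jacDet φ (rotPair s₁ s₂ w)) := by
    intro w
    have hE : E₁ * E₂ ≠ 0 := mul_ne_zero (Complex.exp_ne_zero _) (Complex.exp_ne_zero _)
    have h1 : branchPow s₁ μ₁ (rotPair s₁ s₂ w).1 * branchPow s₂ μ₂ (rotPair s₁ s₂ w).2 =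
        E₁ * E₂ * (w.1 ^ (-μ₁) * w.2 ^ (-μ₂)) := by
      rw [rotPair_apply, branchPow_rot hs₁, branchPow_rot hs₂]; ring
    rw [h1, div_mul_eq_mul_div, ← mul_div_assoc, mul_div_mul_left _ _ hE]
  have hrot0 : Tendsto (rotPair s₁ s₂) (𝓝[cutBox R] 0) (𝓝[cutPairs s₁ s₂] 0) := by
    refine tendsto_nhdsWithin_iff.2 ⟨?_, ?_⟩
    · have := (rotPair s₁ s₂).continuous.tendsto 0
      rw [map_zero] at this
      exact this.mono_left nhdsWithin_le_nhds
    · filter_upwards [self_mem_nhdsWithin] with w hw using rotPair_mem_cutPairs hs₁ hs₂ hw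
  have hlead : Tendsto (fun w : ℂ × ℂ => G w / (w.1 ^ (-μ₁) * w.2 ^ (-μ₂))) (𝓝[cutBox R] 0)
      (𝓝 (E₁ * E₂ * (A / crossDet g₁ g₂ ξ))) := by
    refine Tendsto.congr (fun w => (hquot w).symm) ?_
    exact ((IsLocalInverse.tendsto_lead hg₁ hg₂ hΔ hφ hF).comp hrot0).const_mul _
  have hbd : ∀ w ∈ cutBox R, ‖G w / (w.1 ^ (-μ₁) * w.2 ^ (-μ₂))‖ ≤ ‖E₁ * E₂‖ * K := by
    intro w hw
    rw [hquot, norm_mul]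
    gcongr
    exact ((hloc _ (hrot w hw)).2.2 (rotPair_mem_cutPairs hs₁ hs₂ hw)).2
  have hP0 : P 0 = phase φ x 0 := by simp only [hP, map_zero]
  have hP0im : (P 0).im = 0 := by rw [hP0, phase, hφ.base]; simp [toC]
  have hPd0 : HasFDerivAt P (Complex.I • (a₁ • ContinuousLinearMap.fst ℂ ℂ ℂ +
      a₂ • ContinuousLinearMap.snd ℂ ℂ ℂ)) 0 := by
    have h1 : HasFDerivAt (phase φ x) (linForm (xprime₁ g₁ g₂ ξ x) (xprime₂ g₁ g₂ ξ x))
        (rotPair s₁ s₂ 0) := by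
      rw [map_zero]
      exact (IsLocalInverse.hasStrictFDerivAt_phase hg₁ hg₂ hΔ hφ x).hasFDerivAt
    have h2 := h1.comp (0 : ℂ × ℂ) (rotPair s₁ s₂).hasFDerivAt
    refine h2.congr_fderiv ?_
    have c₁ : (s₁ : ℂ) * xprime₁ g₁ g₂ ξ x = a₁ := by exact_mod_cast hsx₁
    have c₂ : (s₂ : ℂ) * xprime₂ g₁ g₂ ξ x = a₂ := by exact_mod_cast hsx₂
    ext
    · simp [rotPair_apply]
      linear_combination Complex.I * c₁
    · simp [rotPair_apply]
      linear_combination Complex.I * c₂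
  have hmin : 0 < min ((a₁ - c₀) * σ₁) ((a₂ - c₀) * σ₂) :=
    lt_min (mul_pos (by linarith) hσ₁0) (mul_pos (by linarith) hσ₂0)
  have hPim : ∀ δ ∈ Ioc 0 (β * ρ), ∀ t ∈ square ρ,
      (P (tent s₁ δ (σ₁ + δ / ρ) t.1, tent s₂ δ (σ₂ + δ / ρ) t.2)).im ≤
        (a₁ + a₂ + 2 * c₀) * δ -
          min ((a₁ - c₀) * σ₁) ((a₂ - c₀) * σ₂) * (|t.1| + |t.2|) := by
    intro δ hδ t ht
    simp only [hP]
    rw [rotPair_tent hs₁ hs₂]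
    refine (hIm δ hδ t (subset_closure ht)).trans ?_
    have h3 : 0 < δ / ρ := div_pos hδ.1 hρ0
    have m1 : min ((a₁ - c₀) * σ₁) ((a₂ - c₀) * σ₂) * |t.1| ≤ (a₁ - c₀) * (σ₁ + δ / ρ) * |t.1| := by
      gcongr
      refine (min_le_left _ _).trans ?_
      gcongr
      · linarith
    have m2 : min ((a₁ - c₀) * σ₁) ((a₂ - c₀) * σ₂) * |t.2| ≤ (a₂ - c₀) * (σ₂ + δ / ρ) * |t.2| := by
      gcongr
      refine (min_le_right _ _).trans ?_
      gcongr
      · linarith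
    linarith
  have hlim := tendsto_integral_tent hs₁ hs₂ ha₁ ha₂ hGd hPd hlead hbd hP0im hPd0 hσ₁0 hσ₂0 hρ0
    hβρ hball₁ hball₂ hmin hPim
  rw [e₁, e₂, hP0] at hlim
  -- comparison of the two forms of the integrand off the axes
  have hform : ∀ r : ℝ, ∀ᵐ t : ℝ × ℝ, t ∈ square ρ →
      integrand F (r • x) (surf φ fun t => (k₁ t.1, k₂ t.2)) t =
        (Complex.I * s₁ * (Complex.I * s₂)) *
        ((G (tent s₁ (β * ρ) (2 * β * K₁) t.1, tent s₂ (β * ρ) (2 * β * K₂) t.2) *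
          Complex.exp (-Complex.I * r *
            P (tent s₁ (β * ρ) (2 * β * K₁) t.1, tent s₂ (β * ρ) (2 * β * K₂) t.2))) *
          (tentDeriv s₁ (2 * β * K₁) t.1 * tentDeriv s₂ (2 * β * K₂) t.2)) := by
    intro r
    filter_upwards [ae_fst_snd_ne_zero] with t ht hts
    obtain ⟨d₁, hd₁, hd₁'⟩ := hasDerivAt_tent_field hs₁ (β * ρ) (2 * β * K₁) ht.1
    obtain ⟨d₂, hd₂, hd₂'⟩ := hasDerivAt_tent_field hs₂ (β * ρ) (2 * β * K₂) ht.2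
    have hζ := rotPair_tent hs₁ hs₂ (β * ρ) (2 * β * K₁) (β * ρ) (2 * β * K₂) t
    have hts' := square_subset_Icc ρ hts
    have hb1 := hball₁ _ hδ₀ t.1 hts'.1
    have hb2 := hball₂ _ hδ₀ t.2 hts'.2
    rw [e₁] at hb1
    rw [e₂] at hb2
    have hn : ‖cplx t (k₁ t.1, k₂ t.2)‖ < R := by
      rw [hk₁, hk₂, ← hζ, norm_rotPair hs₁ hs₂]
      exact max_lt hb1 hb2
    obtain ⟨ha, -, -⟩ := hloc _ hn
    rw [integrand_smul, jac_surf hd₁ hd₂ ha.differentiableAt, hd₁', hd₂', hG, hP]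
    simp only
    rw [hζ]
    ring
  refine ⟨hsuit, fun r => ?_, ?_⟩
  · have hint := integrableOn_square_tent (f := fun w => G w * Complex.exp (-Complex.I * r * P w))
      (S := cutBox R) (by
        have h1 := hGd.continuousOn
        have h2 := hPd.continuousOn
        fun_prop) hs₁ hs₂ (δ₁ := β * ρ) (σ₁ := 2 * β * K₁) (δ₂ := β * ρ) (σ₂ := 2 * β * K₂) (ρ := ρ)
      fun t ht => ⟨⟨tent_mem_slitPlane hs₁ hβρ _ _, mem_ball_zero_iff.2 (by
          rw [← e₁]; exact hball₁ _ hδ₀ t.1 ht.1)⟩,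
        ⟨tent_mem_slitPlane hs₂ hβρ _ _, mem_ball_zero_iff.2 (by
          rw [← e₂]; exact hball₂ _ hδ₀ t.2 ht.2)⟩⟩
    have hint' := hint.const_mul (Complex.I * s₁ * (Complex.I * s₂))
    refine hint'.congr ?_
    refine (ae_restrict_iff' (measurableSet_square ρ)).2 ?_
    filter_upwards [hform r] with t ht hts using (ht hts).symm
  · have hval : ∀ r : ℝ, uLoc F (surf φ fun t => (k₁ t.1, k₂ t.2)) ρ (r • x) =
        (Complex.I * s₁ * (Complex.I * s₂)) * ∫ t in square ρ,
          ((G (tent s₁ (β * ρ) (2 * β * K₁) t.1, tent s₂ (β * ρ) (2 * β * K₂) t.2) *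
          Complex.exp (-Complex.I * r *
            P (tent s₁ (β * ρ) (2 * β * K₁) t.1, tent s₂ (β * ρ) (2 * β * K₂) t.2))) *
          (tentDeriv s₁ (2 * β * K₁) t.1 * tentDeriv s₂ (2 * β * K₂) t.2)) := by
      intro r
      rw [uLoc, ← integral_const_mul]
      exact setIntegral_congr_ae (measurableSet_square ρ) (hform r)
    have h1 := hlim.const_mul (Complex.I * s₁ * (Complex.I * s₂))
    have hlimval : Complex.I * s₁ * (Complex.I * s₂) * (E₁ * E₂ * (A / crossDet g₁ g₂ ξ) *
        ((-Complex.I * s₁ * (2 * Real.pi * (a₁ : ℂ) ^ (μ₁ - 1) / Complex.Gamma μ₁)) *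
        (-Complex.I * s₂ * (2 * Real.pi * (a₂ : ℂ) ^ (μ₂ - 1) / Complex.Gamma μ₂)))) =
        A / crossDet g₁ g₂ ξ * calJValue μ₁ a₁ s₁ * calJValue μ₂ a₂ s₂ := by
      have i₁ := neg_I_mul_rot hs₁ 1
      have i₂ := neg_I_mul_rot hs₂ 1
      have v₁ : calJValue μ₁ a₁ s₁ =
          E₁ * (2 * Real.pi * (a₁ : ℂ) ^ (μ₁ - 1) / Complex.Gamma μ₁) := by
        rw [calJValue, if_pos ha₁, hE₁,
          show Complex.I * s₁ * μ₁ * Real.pi / 2 = Complex.I * Real.pi * s₁ * μ₁ / 2 by ring]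
        ring
      have v₂ : calJValue μ₂ a₂ s₂ =
          E₂ * (2 * Real.pi * (a₂ : ℂ) ^ (μ₂ - 1) / Complex.Gamma μ₂) := by
        rw [calJValue, if_pos ha₂, hE₂,
          show Complex.I * s₂ * μ₂ * Real.pi / 2 = Complex.I * Real.pi * s₂ * μ₂ / 2 by ring]
        ring
      rw [v₁, v₂]
      set H₁ := 2 * (Real.pi : ℂ) * (a₁ : ℂ) ^ (μ₁ - 1) / Complex.Gamma μ₁
      set H₂ := 2 * (Real.pi : ℂ) * (a₂ : ℂ) ^ (μ₂ - 1) / Complex.Gamma μ₂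
      set D := A / (crossDet g₁ g₂ ξ : ℂ)
      calc _ = (-Complex.I * s₁ * (Complex.I * s₁ * 1)) * (-Complex.I * s₂ * (Complex.I * s₂ * 1)) *
            (D * (E₁ * H₁) * (E₂ * H₂)) := by ring
        _ = _ := by rw [i₁, i₂]; ring
    rw [hlimval] at h1
    refine h1.congr fun r => ?_
    rw [hval]
    ring

end Active

/-! ### The leading term -/

/-- Passage from a limit of the normalised integral to its asymptotics. -/
theorem asymptotics_of_tendsto {u L : ℝ → ℂ} {μ p ℓ : ℂ} (hp : p.im = 0)
    (h : Tendsto (fun r : ℝ => (r : ℂ) ^ (2 - μ) * Complex.exp (Complex.I * r * p) * u r) atTop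
      (𝓝 ℓ))
    (hL : ∀ r : ℝ, 0 < r → L r = Complex.exp (-Complex.I * r * p) * (r : ℂ) ^ (μ - 2) * ℓ) :
    ((fun r => u r - L r) =o[atTop] fun r : ℝ => r ^ (μ.re - 2)) ∧
      (ℓ ≠ 0 → u ~[atTop] L ∧
        ∀ c > 0, ¬ (u =O[atTop] fun r : ℝ => Real.exp (-c * r))) := by
  have hexp : ∀ r : ℝ, ‖Complex.exp (-Complex.I * r * p)‖ = 1 ∧
      ‖Complex.exp (Complex.I * r * p)‖ = 1 := fun r => by
    constructor <;> · rw [Complex.norm_exp]; simp [hp]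
  have hpow : ∀ r : ℝ, 0 < r → ∀ ν : ℂ, ‖(r : ℂ) ^ ν‖ = r ^ ν.re := fun r hr ν =>
    Complex.norm_cpow_eq_rpow_re_of_pos hr ν
  have hnorm : ∀ r : ℝ, 0 < r →
      ‖Complex.exp (-Complex.I * r * p) * (r : ℂ) ^ (μ - 2)‖ = r ^ (μ.re - 2) := fun r hr => by
    rw [norm_mul, (hexp r).1, hpow r hr, one_mul]; simp
  have hfac : (fun r : ℝ => Complex.exp (-Complex.I * r * p) * (r : ℂ) ^ (μ - 2)) =O[atTop]
      fun r : ℝ => r ^ (μ.re - 2) := by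
    refine IsBigO.of_bound 1 ?_
    filter_upwards [eventually_gt_atTop 0] with r hr
    rw [hnorm r hr, one_mul]
    exact le_abs_self _
  have hsub : (fun r => u r - L r) =o[atTop] fun r : ℝ => r ^ (μ.re - 2) := by
    have h1 : (fun r : ℝ => (r : ℂ) ^ (2 - μ) * Complex.exp (Complex.I * r * p) * u r - ℓ)
        =o[atTop] fun _ : ℝ => (1 : ℝ) :=
      (isLittleO_one_iff ℝ).2 (by simpa using h.sub_const ℓ)
    have h2 := hfac.mul_isLittleO h1
    simp only [mul_one] at h2
    refine h2.congr' ?_ EventuallyEq.rfl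
    filter_upwards [eventually_gt_atTop 0] with r hr
    have hr0 : (r : ℂ) ≠ 0 := by exact_mod_cast hr.ne'
    have e1 : Complex.exp (-Complex.I * r * p) * Complex.exp (Complex.I * r * p) = 1 := by
      rw [← Complex.exp_add]; simp
    have e2 : (r : ℂ) ^ (μ - 2) * (r : ℂ) ^ (2 - μ) = 1 := by
      rw [← Complex.cpow_add _ _ hr0]; simp
    rw [hL r hr]
    linear_combination (u r * (r : ℂ) ^ (μ - 2) * (r : ℂ) ^ (2 - μ)) * e1 + u r * e2
  refine ⟨hsub, fun hℓ => ⟨?_, fun c hc hO => hℓ ?_⟩⟩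
  · refine hsub.trans_isBigO (IsBigO.of_bound ‖ℓ‖⁻¹ ?_)
    filter_upwards [eventually_gt_atTop 0] with r hr
    rw [hL r hr, norm_mul _ ℓ, hnorm r hr, Real.norm_eq_abs,
      abs_of_pos (Real.rpow_pos_of_pos hr _)]
    have := norm_pos_iff.2 hℓ
    exact le_of_eq (by field_simp)
  · refine tendsto_nhds_unique h ?_
    have h1 : (fun r : ℝ => (r : ℂ) ^ (2 - μ) * Complex.exp (Complex.I * r * p)) =O[atTop]
        fun r : ℝ => r ^ (2 - μ.re) := by
      refine IsBigO.of_bound 1 ?_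
      filter_upwards [eventually_gt_atTop 0] with r hr
      rw [norm_mul, (hexp r).2, hpow r hr, one_mul, mul_one]
      simpa using le_abs_self _
    exact (h1.mul hO).trans_tendsto
      (tendsto_rpow_mul_exp_neg_mul_atTop_nhds_zero (2 - μ.re) c hc)

section LeadingTerm

variable {ξ x : ℝ × ℝ} {s₁ s₂ a₁ a₂ Δ : ℝ} {A μ₁ μ₂ : ℂ}

/-- The dependence of the leading term on the distance `r`. -/
theorem crossTerm_smul (hs₁ : s₁ = 1 ∨ s₁ = -1) (hs₂ : s₂ = 1 ∨ s₂ = -1) (ha₁ : 0 < a₁)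
    (ha₂ : 0 < a₂) {r : ℝ} (hr : 0 < r) :
    crossTerm A μ₁ μ₂ Δ s₁ s₂ ξ (r • x) (r * a₁) (r * a₂) =
      Complex.exp (-Complex.I * r * ((x.1 : ℂ) * ξ.1 + (x.2 : ℂ) * ξ.2)) *
        (r : ℂ) ^ (μ₁ + μ₂ - 2) * (A / Δ * calJValue μ₁ a₁ s₁ * calJValue μ₂ a₂ s₂) := by
  have hr0 : (r : ℂ) ≠ 0 := by exact_mod_cast hr.ne'
  rw [crossTerm, calJ_eq (by positivity) hs₁, calJ_eq (by positivity) hs₂, calJValue_mul hr,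
    calJValue_mul hr, show μ₁ + μ₂ - 2 = (μ₁ - 1) + (μ₂ - 1) by ring, Complex.cpow_add _ _ hr0,
    show -Complex.I * ((((r • x).1 : ℝ) : ℂ) * ξ.1 + (((r • x).2 : ℝ) : ℂ) * ξ.2) =
      -Complex.I * r * ((x.1 : ℂ) * ξ.1 + (x.2 : ℂ) * ξ.2) by
        simp only [Prod.smul_fst, Prod.smul_snd, smul_eq_mul]; push_cast; ring]
  ring

/-- The leading term in terms of the distances `Δ a_j`. -/
theorem crossTerm_eq_closedForm (hs₁ : s₁ = 1 ∨ s₁ = -1) (hs₂ : s₂ = 1 ∨ s₂ = -1) (hΔ : 0 < Δ)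
    {y : ℝ × ℝ} (ha₁ : 0 < a₁) (ha₂ : 0 < a₂) :
    crossTerm A μ₁ μ₂ Δ s₁ s₂ ξ y a₁ a₂ =
      4 * Real.pi ^ 2 * A * Complex.exp (-Complex.I * ((y.1 : ℂ) * ξ.1 + (y.2 : ℂ) * ξ.2)) *
        Complex.exp (-(Complex.I * (Real.pi / 2) * (s₁ * μ₁ + s₂ * μ₂))) /
        (Complex.Gamma μ₁ * Complex.Gamma μ₂ * (Δ : ℂ) ^ (μ₁ + μ₂ - 1)) *
        ((Δ * a₁ : ℝ) : ℂ) ^ (μ₁ - 1) * ((Δ * a₂ : ℝ) : ℂ) ^ (μ₂ - 1) := by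
  have hΔ0 : (Δ : ℂ) ≠ 0 := by exact_mod_cast hΔ.ne'
  have ha₁0 : (a₁ : ℂ) ≠ 0 := by exact_mod_cast ha₁.ne'
  have ha₂0 : (a₂ : ℂ) ≠ 0 := by exact_mod_cast ha₂.ne'
  have hpow : (Δ : ℂ) ^ (μ₁ + μ₂ - 1) = (Δ : ℂ) ^ (μ₁ - 1) * (Δ : ℂ) ^ (μ₂ - 1) * Δ := by
    rw [show μ₁ + μ₂ - 1 = (μ₁ - 1) + (μ₂ - 1) + 1 by ring, Complex.cpow_add _ _ hΔ0,
      Complex.cpow_add _ _ hΔ0, Complex.cpow_one]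
  have hE : Complex.exp (-(Complex.I * (Real.pi / 2) * (s₁ * μ₁ + s₂ * μ₂))) =
      Complex.exp (-(Complex.I * s₁ * μ₁ * Real.pi / 2)) *
        Complex.exp (-(Complex.I * s₂ * μ₂ * Real.pi / 2)) := by
    rw [← Complex.exp_add]; congr 1; ring
  have hD₁ : (Δ : ℂ) ^ (μ₁ - 1) ≠ 0 := by simp [Complex.cpow_eq_zero_iff, hΔ0]
  have hD₂ : (Δ : ℂ) ^ (μ₂ - 1) ≠ 0 := by simp [Complex.cpow_eq_zero_iff, hΔ0]
  rw [crossTerm, calJ_eq ha₁.ne' hs₁, calJ_eq ha₂.ne' hs₂, calJValue, calJValue, if_pos ha₁,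
    if_pos ha₂, hpow, hE, Complex.ofReal_mul, Complex.ofReal_mul, ofReal_mul_cpow hΔ ha₁0,
    ofReal_mul_cpow hΔ ha₂0]
  set D₁ := (Δ : ℂ) ^ (μ₁ - 1)
  set D₂ := (Δ : ℂ) ^ (μ₂ - 1)
  set Γ₁ := Complex.Gamma μ₁
  set Γ₂ := Complex.Gamma μ₂
  -- `Γ` may vanish by convention at its poles, so only the powers of `Δ` are cancelled
  have hcancel : ∀ N p q : ℂ, N / (Γ₁ * Γ₂ * (D₁ * D₂ * Δ)) * (D₁ * p) * (D₂ * q) =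
      N * p * q / Δ / (Γ₁ * Γ₂) := by
    intro N p q
    calc _ = N * p * q / Δ / (Γ₁ * Γ₂) * (D₁ * D₁⁻¹) * (D₂ * D₂⁻¹) := by
          simp only [div_eq_mul_inv, mul_inv]; ring
      _ = _ := by rw [mul_inv_cancel₀ hD₁, mul_inv_cancel₀ hD₂, mul_one, mul_one]
  rw [hcancel]
  simp only [div_eq_mul_inv, mul_inv]
  ring

theorem crossTerm_ne_zero_iff (hs₁ : s₁ = 1 ∨ s₁ = -1) (hs₂ : s₂ = 1 ∨ s₂ = -1) (hΔ : 0 < Δ)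
    (hA : A ≠ 0) (hμ₁ : ∀ n : ℕ, μ₁ ≠ -n) (hμ₂ : ∀ n : ℕ, μ₂ ≠ -n) {y : ℝ × ℝ}
    (ha₁ : a₁ ≠ 0) (ha₂ : a₂ ≠ 0) :
    crossTerm A μ₁ μ₂ Δ s₁ s₂ ξ y a₁ a₂ ≠ 0 ↔ 0 < a₁ ∧ 0 < a₂ := by
  have hΔ0 : (Δ : ℂ) ≠ 0 := by exact_mod_cast hΔ.ne'
  rw [crossTerm, calJ_eq ha₁ hs₁, calJ_eq ha₂ hs₂, mul_ne_zero_iff, mul_ne_zero_iff,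
    calJValue_ne_zero_iff hμ₁, calJValue_ne_zero_iff hμ₂]
  have : A * Complex.exp (-Complex.I * ((y.1 : ℂ) * ξ.1 + (y.2 : ℂ) * ξ.2)) / Δ ≠ 0 :=
    div_ne_zero (mul_ne_zero hA (Complex.exp_ne_zero _)) hΔ0
  tauto

end LeadingTerm

theorem mainTheorem3
    (g₁ g₂ F : ℂ × ℂ → ℂ) (hg₁ : RealProperty g₁) (hg₂ : RealProperty g₂)
    (ξ : ℝ × ℝ) (hξ₁ : g₁ (toC ξ) = 0) (hξ₂ : g₂ (toC ξ) = 0)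
    (hΔ : 0 < crossDet g₁ g₂ ξ)
    (U : Set (ℝ × ℝ)) (hU : U ∈ 𝓝 ξ) (η : ℝ × ℝ → ℝ × ℝ) (hη : AdmissibleOn g₁ g₂ U η)
    (s₁ s₂ : ℝ) (hs₁ : s₁ = bridgeSign g₁ η ξ) (hs₂ : s₂ = bridgeSign g₂ η ξ)
    (A μ₁ μ₂ : ℂ) (hF : CrossingBehaviour F g₁ g₂ s₁ s₂ μ₁ μ₂ A ξ) :
    -- the values of `𝒥`
    (∀ a s : ℝ, a ≠ 0 → (s = 1 ∨ s = -1) →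
      IsCalJ a s (fun μ => calJ μ a s) ∧
      ∀ μ : ℂ, calJ μ a s =
        if 0 < a then
          2 * Real.pi * Complex.exp (-(Complex.I * s * μ * Real.pi / 2)) * (a : ℂ) ^ (μ - 1) /
            Complex.Gamma μ
        else 0) ∧
    -- the local change of variables exists
    (∃ φ, IsLocalInverse g₁ g₂ ξ φ) ∧
    ∀ φ, IsLocalInverse g₁ g₂ ξ φ →
    -- observation directions that are not orthogonal to either real trace
    ∀ x : ℝ × ℝ, x.1 ^ 2 + x.2 ^ 2 = 1 → xprime₁ g₁ g₂ ξ x ≠ 0 → xprime₂ g₁ g₂ ξ x ≠ 0 →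
    -- activity
    (IsActive g₁ g₂ η ξ x ↔ x ∈ activeQuadrant g₁ g₂ s₁ s₂ ξ) ∧
    (x ∈ activeQuadrant g₁ g₂ s₁ s₂ ξ ↔
      Real.sign (x.1 * coefB g₂ ξ - x.2 * coefA g₂ ξ) = s₁ ∧
      Real.sign (-x.1 * coefB g₁ ξ + x.2 * coefA g₁ ξ) = s₂) ∧
    -- the estimate in active directions
    (IsActive g₁ g₂ η ξ x →
      -- closed form of the leading term
      (∀ r : ℝ, 0 < r →
        crossTerm A μ₁ μ₂ (crossDet g₁ g₂ ξ) s₁ s₂ ξ (r • x)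
            (r * |xprime₁ g₁ g₂ ξ x|) (r * |xprime₂ g₁ g₂ ξ x|) =
          4 * Real.pi ^ 2 * A *
            Complex.exp (-Complex.I * (((r * x.1 : ℝ) : ℂ) * ξ.1 + ((r * x.2 : ℝ) : ℂ) * ξ.2)) *
            Complex.exp (-(Complex.I * (Real.pi / 2) * (s₁ * μ₁ + s₂ * μ₂))) /
            (Complex.Gamma μ₁ * Complex.Gamma μ₂ *
              (crossDet g₁ g₂ ξ : ℂ) ^ (μ₁ + μ₂ - 1)) *
            ((|r * x.1 * coefB g₂ ξ - r * x.2 * coefA g₂ ξ| : ℝ) : ℂ) ^ (μ₁ - 1) *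
            ((|-(r * x.1) * coefB g₁ ξ + r * x.2 * coefA g₁ ξ| : ℝ) : ℂ) ^ (μ₂ - 1)) ∧
      ∃ ρ₀ > 0, ∀ ρ ∈ Ioo (0 : ℝ) ρ₀, ∃ β₀ > 0, ∀ β ∈ Ioo (0 : ℝ) β₀,
        SuitableSurface g₁ g₂ φ s₁ s₂ x
          (crossField s₁ s₂ (xprime₁ g₁ g₂ ξ x) (xprime₂ g₁ g₂ ξ x) ρ β) ρ ∧
        (∀ r : ℝ, IntegrableOn (integrand F (r • x) (surf φ
          (crossField s₁ s₂ (xprime₁ g₁ g₂ ξ x) (xprime₂ g₁ g₂ ξ x) ρ β))) (square ρ)) ∧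
        ((fun r : ℝ =>
            uLoc F (surf φ
              (crossField s₁ s₂ (xprime₁ g₁ g₂ ξ x) (xprime₂ g₁ g₂ ξ x) ρ β)) ρ (r • x) -
            crossTerm A μ₁ μ₂ (crossDet g₁ g₂ ξ) s₁ s₂ ξ (r • x)
              (r * |xprime₁ g₁ g₂ ξ x|) (r * |xprime₂ g₁ g₂ ξ x|))
          =o[atTop] fun r : ℝ => r ^ ((μ₁ + μ₂).re - 2)) ∧
        (A ≠ 0 → (∀ n : ℕ, μ₁ ≠ -n) → (∀ n : ℕ, μ₂ ≠ -n) →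
          ((fun r : ℝ =>
              uLoc F (surf φ
                (crossField s₁ s₂ (xprime₁ g₁ g₂ ξ x) (xprime₂ g₁ g₂ ξ x) ρ β)) ρ (r • x))
            ~[atTop] fun r : ℝ =>
              crossTerm A μ₁ μ₂ (crossDet g₁ g₂ ξ) s₁ s₂ ξ (r • x)
                (r * |xprime₁ g₁ g₂ ξ x|) (r * |xprime₂ g₁ g₂ ξ x|)) ∧
          ∀ c > 0, ¬ ((fun r : ℝ =>
              uLoc F (surf φ
                (crossField s₁ s₂ (xprime₁ g₁ g₂ ξ x) (xprime₂ g₁ g₂ ξ x) ρ β)) ρ (r • x))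
            =O[atTop] fun r : ℝ => Real.exp (-c * r)))) ∧
    -- no contribution in the other directions
    (¬ IsActive g₁ g₂ η ξ x →
      ∃ v : ℝ × ℝ, ∃ ρ₀ > 0, ∀ ρ ∈ Ioo (0 : ℝ) ρ₀, ∃ β₀ > 0, ∀ β ∈ Ioo (0 : ℝ) β₀,
        SuitableSurface g₁ g₂ φ s₁ s₂ x (fun _ => β • v) ρ ∧
        (∀ r : ℝ, IntegrableOn (integrand F (r • x) (surf φ (fun _ => β • v))) (square ρ)) ∧
        ∃ c > 0, (fun r : ℝ => uLoc F (surf φ (fun _ => β • v)) ρ (r • x))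
          =O[atTop] fun r : ℝ => Real.exp (-c * r)) ∧
    -- the leading term is nonzero exactly in the active quadrant
    (A ≠ 0 → (∀ n : ℕ, μ₁ ≠ -n) → (∀ n : ℕ, μ₂ ≠ -n) → ∀ r : ℝ, 0 < r →
      (crossTerm A μ₁ μ₂ (crossDet g₁ g₂ ξ) s₁ s₂ ξ (r • x)
          (r * (s₁ * xprime₁ g₁ g₂ ξ x)) (r * (s₂ * xprime₂ g₁ g₂ ξ x)) ≠ 0 ↔
        x ∈ activeQuadrant g₁ g₂ s₁ s₂ ξ)) := by
  have hξU := mem_of_mem_nhds hU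
  obtain ⟨hs₁', hη₁⟩ := sign_spec (hη.transverse₁ ξ hξU hξ₁) hs₁
  obtain ⟨hs₂', hη₂⟩ := sign_spec (hη.transverse₂ ξ hξU hξ₂) hs₂
  refine ⟨fun a s ha hs => ⟨?_, fun μ => calJ_eq ha hs μ⟩,
    exists_isLocalInverse hg₁ hg₂ hξ₁ hξ₂ hΔ, fun φ hφ x _ hx₁ hx₂ => ?_⟩
  · rw [show (fun μ => calJ μ a s) = fun μ => calJValue μ a s from
      funext fun μ => calJ_eq ha hs μ]
    exact isCalJ_calJValue ha hs
  have hact := isActive_iff hg₁ hg₂ hξ₁ hξ₂ hΔ hU hη hs₁' hs₂' hη₁ hη₂ hx₁ hx₂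
  have hquad := mem_activeQuadrant_iff (x := x) hΔ hs₁' hs₂'
  have hΔx₁ : x.1 * coefB g₂ ξ - x.2 * coefA g₂ ξ = crossDet g₁ g₂ ξ * xprime₁ g₁ g₂ ξ x :=
    (mul_div_cancel₀ _ hΔ.ne').symm
  have hΔx₂ : -x.1 * coefB g₁ ξ + x.2 * coefA g₁ ξ = crossDet g₁ g₂ ξ * xprime₂ g₁ g₂ ξ x :=
    (mul_div_cancel₀ _ hΔ.ne').symm
  refine ⟨hact.trans hquad.symm, ?_, fun h => ?_, fun h => ?_, fun hA hμ₁ hμ₂ r hr => ?_⟩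
  · have hsign : ∀ s y : ℝ, (s = 1 ∨ s = -1) → y ≠ 0 →
        (Real.sign (crossDet g₁ g₂ ξ * y) = s ↔ 0 < s * y) := by
      intro s y hs hy
      rw [sign_eq_iff (mul_ne_zero hΔ.ne' hy) hs, mul_left_comm, mul_pos_iff_of_pos_left hΔ]
    rw [hquad, hΔx₁, hΔx₂, hsign _ _ hs₁' hx₁, hsign _ _ hs₂' hx₂]
  · obtain ⟨hp₁, hp₂⟩ := hact.1 h
    have ha₁ : 0 < |xprime₁ g₁ g₂ ξ x| := abs_pos.2 hx₁
    have ha₂ : 0 < |xprime₂ g₁ g₂ ξ x| := abs_pos.2 hx₂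
    have habs : ∀ s y : ℝ, (s = 1 ∨ s = -1) → 0 < s * y → y = s * |y| := by
      rintro s y (rfl | rfl) hy
      · rw [abs_of_pos (by linarith), one_mul]
      · rw [abs_of_neg (by linarith)]; ring
    have hxa₁ := habs _ _ hs₁' hp₁
    have hxa₂ := habs _ _ hs₂' hp₂
    constructor
    · intro r hr
      have f₁ : |r * x.1 * coefB g₂ ξ - r * x.2 * coefA g₂ ξ| =
          crossDet g₁ g₂ ξ * (r * |xprime₁ g₁ g₂ ξ x|) := by
        rw [show r * x.1 * coefB g₂ ξ - r * x.2 * coefA g₂ ξ =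
          r * (x.1 * coefB g₂ ξ - x.2 * coefA g₂ ξ) by ring, hΔx₁, abs_mul, abs_mul,
          abs_of_pos hr, abs_of_pos hΔ]
        ring
      have f₂ : |-(r * x.1) * coefB g₁ ξ + r * x.2 * coefA g₁ ξ| =
          crossDet g₁ g₂ ξ * (r * |xprime₂ g₁ g₂ ξ x|) := by
        rw [show -(r * x.1) * coefB g₁ ξ + r * x.2 * coefA g₁ ξ =
          r * (-x.1 * coefB g₁ ξ + x.2 * coefA g₁ ξ) by ring, hΔx₂, abs_mul, abs_mul,
          abs_of_pos hr, abs_of_pos hΔ]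
        ring
      rw [f₁, f₂]
      exact crossTerm_eq_closedForm hs₁' hs₂' hΔ (mul_pos hr ha₁) (mul_pos hr ha₂)
    · obtain ⟨ρ₀, hρ₀, hmain⟩ := IsLocalInverse.tendsto_uLoc hg₁ hg₂ hΔ hφ hs₁' hs₂' hF x ha₁ ha₂
        hxa₁ hxa₂
      rw [← hxa₁, ← hxa₂] at hmain
      refine ⟨ρ₀, hρ₀, fun ρ hρ => ?_⟩
      obtain ⟨β₀, hβ₀, hmain⟩ := hmain ρ hρ
      refine ⟨β₀, hβ₀, fun β hβ => ?_⟩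
      obtain ⟨hsuit, hint, hlim⟩ := hmain β hβ
      have hphase : phase φ x 0 = (x.1 : ℂ) * ξ.1 + (x.2 : ℂ) * ξ.2 := by
        rw [phase, hφ.base]; rfl
      rw [hphase] at hlim
      simp only [sub_sub] at hlim
      obtain ⟨ho, heq⟩ := asymptotics_of_tendsto (by simp) hlim
        (L := fun r => crossTerm A μ₁ μ₂ (crossDet g₁ g₂ ξ) s₁ s₂ ξ (r • x)
          (r * |xprime₁ g₁ g₂ ξ x|) (r * |xprime₂ g₁ g₂ ξ x|))
        fun r hr => crossTerm_smul hs₁' hs₂' ha₁ ha₂ hr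
      refine ⟨hsuit, hint, ho, fun hA hμ₁ hμ₂ => heq ?_⟩
      refine mul_ne_zero (mul_ne_zero (div_ne_zero hA ?_) ?_) ?_
      · exact_mod_cast hΔ.ne'
      · exact (calJValue_ne_zero_iff hμ₁ s₁).2 ha₁
      · exact (calJValue_ne_zero_iff hμ₂ s₂).2 ha₂
  · rw [hact] at h
    obtain ⟨q₁, q₂, h₁, h₂, hq⟩ := exists_neg_of_not_pos hs₁' hs₂' hx₁ hx₂ h
    exact ⟨(q₁, q₂), IsLocalInverse.exists_exp_decay hg₁ hg₂ hΔ hφ hs₁' hs₂' hF x h₁ h₂ hq⟩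
  · rw [hquad]
    have hne : ∀ s y : ℝ, (s = 1 ∨ s = -1) → y ≠ 0 → r * (s * y) ≠ 0 := by
      rintro s y (rfl | rfl) hy <;> simp [hr.ne', hy]
    rw [crossTerm_ne_zero_iff hs₁' hs₂' hΔ hA hμ₁ hμ₂ (hne _ _ hs₁' hx₁) (hne _ _ hs₂' hx₂),
      mul_pos_iff_of_pos_left hr, mul_pos_iff_of_pos_left hr]
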